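/- **Setting.** Let $P$ be a probability measure on $\mathcal X\times\{-1,1\}$, where $\mathcal X$ is a measurable space, let $P_X$ be its first marginal, and let $\eta$ be a measurable version of $x\mapsto P(Y=1\mid X=x)$. Let $s^*(x)=1$ if $\eta(x)\ge\frac12$ and $s^*(x)=-1$ otherwise (the Bayes classifier). Let $\mathcal H_k$ be a reproducing kernel Hilbert space of real functions on $\mathcal X$ whose kernel $k$ is such that $k(x,\cdot)$ is measurable for every $x$, let $\mathcal B(R)=\{g\in\mathcal H_k:\|g\|_k\le R\}$, and let $M,\eta_0>0$ be such that * (A1) $\mathcal H_k$ is separable and $k(x,x)\le M^2$ for all $x\in\mathcal X$; * (A2) $|\eta(x)-\frac12|\ge\eta_0$ for all $x\in\mathcal X$. Let $\ell(g)(x,y)=(1-yg(x))_+$ be the hinge loss and $\mathfrak G$ the class of functions $g:\mathcal X\to\mathbb R$ that are square integrable with respect to $P_X$. Put $Pf=\mathbb E f(X,Y)$ and $L(g,s^*)=P(\ell(g)-\ell(s^*))$. For $n\ge1$ let $P_nf=\frac1n\sum_{i=1}^nf(X_i,Y_i)$, where $(X_i,Y_i)_{i\le n}$ are i.i.d. with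 law $P$. A function $\phi:[0,\infty)\to[0,\infty)$ is *sub-root* if it is nondecreasing and $r\mapsto\phi(r)/\sqrt r$ is nonincreasing on $(0,\infty)$. Let $\mathcal R$ be a countable set of positive real numbers. Given families $(b_R),(C_R)$ of positive numbers and $(r_R^*)$ of nonnegative numbers, indexed by $R\in\mathcal R$, we say that $(\mathcal B(R))_{R\in\mathcal R}$ satisfies (H1)–(H4) with $b_R$, $C_R$, $r_R^*$ if $\ell(g)\in L^2(P)$ for all $g\in\mathfrak G$, $s^*\in\mathfrak G$ minimizes $g\mapsto P\ell(g)$ over $\mathfrak G$, $\mathcal B(R)\subset\mathfrak G$ for all $R\in\mathcal R$, and there are a pseudo-distance $d$ on $\mathfrak G$ and sub-root functions $(\phi_R)_{R\in\mathcal R}$ such that, for every $R\in\mathcal R$, $r_R^*$ is the greatest nonnegative solution of $\phi_R(r)=r/C_R$ (that is, the unique positive solution, or $0$ if $\phi_R\equiv0$), and * (H1) $\|\ell(g)\|_\infty\le b_R$ for all $g\in\mathcal B(R)$; * (H2) $\operatorname{Var}(\ell(g)-\ell(g'))\le d^2(g,g')$ for all $g,g'\in\mathfrak G$; * (H3) $d^2(g,s^*)\le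 C_R\,L(g,s^*)$ for all $g\in\mathcal B(R)$; * (H4) for all $g_0\in\mathcal B(R)$ and all $r\ge r_R^*$, $$\mathbb E\Big[\sup_{g\in\mathcal B(R),\ d^2(g,g_0)\le r}(P-P_n)(\ell(g)-\ell(g_0))\Big]\le\phi_R(r),$$ where the supremum is almost surely finite and is an integrable random variable. **Theorem 4.4.** Let $n\ge1$. *Setting (S1).* Suppose in addition that $\eta_1>0$ and (A3) $\min(\eta(x),1-\eta(x))\ge\eta_1$ for all $x\in\mathcal X$. Let $\lambda_1\ge\lambda_2\ge\dots\ge 0$ be the eigenvalues, repeated according to their multiplicities, of the operator $(L_kf)(x)=\int k(x,x')f(x')\,dP_X(x')$ on $L^2(P_X)$ (the nonzero eigenvalues in nonincreasing order, followed by zeros if there are only finitely many). Then $\sum_j\lambda_j<\infty$, and $(\mathcal B(R))_{R\in\mathcal R}$ satisfies (H1)–(H4) with $$b_R=1+MR,\qquad C_R=2\Big(\frac{MR}{\eta_1}+\frac1{\eta_0}\Big),$$ and with some $r_R^*$ such that $$r_R^*\le16\,\frac{C_R^2}{\sqrt n}\,\inf_{d\in\mathbb N,\,d\ge0}\Big(\frac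 d{\sqrt n}+\frac{\eta_1}M\sqrt{\sum_{j>d}\lambda_j}\Big).$$ *Setting (S2).* Suppose in addition that $\mathcal X$ carries a topology such that $\mathcal H_k$ is included by a compact injection in the space of bounded continuous functions on $\mathcal X$ with the supremum norm. For $\varepsilon>0$ let $H_\infty(\varepsilon)$ be the logarithm of the least number of supremum norm balls of radius $\varepsilon$, centered at bounded continuous functions, that cover $\mathcal B(1)$. Suppose that $\xi(x)=\int_0^x\sqrt{H_\infty(\varepsilon)}\,d\varepsilon$ is finite for all $x>0$, and let $x_*(n)$ be the greatest nonnegative solution of $\xi(x)=M^{-1}n^{1/2}x^2$ (that is, the unique positive solution, or $0$ if $\mathcal H_k=\{0\}$). Then $(\mathcal B(R))_{R\in\mathcal R}$ satisfies (H1)–(H4) with $$b_R=1+MR,\qquad C_R=MR+\frac1{\eta_0},$$ and with some $r_R^*$ such that $$r_R^*\le2500\,M^{-2}C_R^2\,x_*^2(n).$$ -/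

import Mathlib

open MeasureTheory ProbabilityTheory Set
open scoped BoundedContinuousFunction

noncomputable section

/-! ### Hypotheses of the abstract model selection theorem -/

/-- Sub-root functions `ψ : [0, ∞) → [0, ∞)` (values of `ψ` at negative reals are irrelevant). -/
structure IsSubRoot (ψ : ℝ → ℝ) : Prop where
  nonneg : ∀ r, 0 ≤ r → 0 ≤ ψ r
  mono : MonotoneOn ψ (Ici 0)
  anti : AntitoneOn (fun r => ψ r / √r) (Ioi 0)

/-- `d` is a pseudo-distance on the class `𝔊`. -/
structure IsPseudoDistanceOn {F : Type*} (d : F → F → ℝ) (𝔊 : Set F) : Prop where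
  nonneg : ∀ g ∈ 𝔊, ∀ g' ∈ 𝔊, 0 ≤ d g g'
  self : ∀ g ∈ 𝔊, d g g = 0
  symm : ∀ g ∈ 𝔊, ∀ g' ∈ 𝔊, d g g' = d g' g
  triangle : ∀ g ∈ 𝔊, ∀ g' ∈ 𝔊, ∀ g'' ∈ 𝔊, d g g'' ≤ d g g' + d g' g''

/-- The empirical process `(P - Pₙ) f = 𝔼 f - n⁻¹ ∑ᵢ f(Zᵢ)` at the sample `z = (Z₁, …, Zₙ)`. -/
def empiricalProcess {Z : Type*} [MeasurableSpace Z] (P : Measure Z) (n : ℕ) (f : Z → ℝ)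
    (z : Fin n → Z) : ℝ :=
  (∫ w, f w ∂P) - (n : ℝ)⁻¹ * ∑ i, f (z i)

/-- The localized supremum of the empirical process: `(P - Pₙ)(ℓ g - ℓ g₀)` over all `g` in the model with
`d² (g, g₀) ≤ r`. -/
def localizedSup {Z F : Type*} [MeasurableSpace Z] (P : Measure Z) (n : ℕ) (ℓ : F → Z → ℝ)
    (model : Set F) (d : F → F → ℝ) (g₀ : F) (r : ℝ) (z : Fin n → Z) : ℝ :=
  ⨆ g : {g : F // g ∈ model ∧ d g g₀ ^ 2 ≤ r},
    empiricalProcess P n (fun w => ℓ g w - ℓ g₀ w) z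

/-- The standing assumptions of the abstract model selection theorem and its four hypotheses, namely
`H1`, a uniform bound on the loss over each model, `H2`, a bound on variances by the squared
pseudo-distance, `H3`, a bound on the squared pseudo-distance to the target by the relative loss,
and `H4`, a bound on the expected localized supremum of the empirical process; for
sample size `n`, the ambient class `𝔊`, the loss `ℓ : 𝔊 → L²(P)`, the models `𝒢 m`, the target
`gstar`, the pseudo-distance `d`, the sub-root functions `φ m`, the constants `b m`, `C m`, and the
solutions `rstar m` of `φ m r = r / C m`. The solution that is meant is the positive one; it is
unique if it exists, and it exists unless `φ m` vanishes identically on `[0, ∞)`, in which case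
`rstar m = 0`. Both cases are covered by saying that it is the greatest nonnegative solution. -/
structure ModelSelectionHypotheses {Z F ι : Type*} [MeasurableSpace Z] (P : Measure Z) (n : ℕ)
    (𝔊 : Set F) (ℓ : F → Z → ℝ) (𝒢 : ι → Set F) (gstar : F) (d : F → F → ℝ)
    (φ : ι → ℝ → ℝ) (b C rstar : ι → ℝ) : Prop where
  loss_memLp : ∀ g ∈ 𝔊, MemLp (ℓ g) 2 P
  gstar_mem : gstar ∈ 𝔊
  gstar_min : ∀ g ∈ 𝔊, ∫ z, ℓ gstar z ∂P ≤ ∫ z, ℓ g z ∂P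
  model_subset : ∀ m, 𝒢 m ⊆ 𝔊
  pseudoDistance : IsPseudoDistanceOn d 𝔊
  subRoot : ∀ m, IsSubRoot (φ m)
  b_pos : ∀ m, 0 < b m
  C_pos : ∀ m, 0 < C m
  rstar_spec : ∀ m, IsGreatest {r : ℝ | 0 ≤ r ∧ φ m r = r / C m} (rstar m)
  H1 : ∀ m, ∀ g ∈ 𝒢 m, ∀ z, |ℓ g z| ≤ b m
  H2 : ∀ g ∈ 𝔊, ∀ g' ∈ 𝔊, variance (fun z => ℓ g z - ℓ g' z) P ≤ d g g' ^ 2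
  H3 : ∀ m, ∀ g ∈ 𝒢 m, d g gstar ^ 2 ≤ C m * ∫ z, (ℓ g z - ℓ gstar z) ∂P
  H4 : ∀ m, ∀ g₀ ∈ 𝒢 m, ∀ r, rstar m ≤ r →
    (∀ᵐ z ∂(Measure.pi fun _ : Fin n => P),
      BddAbove (range fun g : {g : F // g ∈ 𝒢 m ∧ d g g₀ ^ 2 ≤ r} =>
        empiricalProcess P n (fun w => ℓ g w - ℓ g₀ w) z)) ∧
    Integrable (localizedSup P n ℓ (𝒢 m) d g₀ r) (Measure.pi fun _ : Fin n => P) ∧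
    ∫ z, localizedSup P n ℓ (𝒢 m) d g₀ r z ∂(Measure.pi fun _ : Fin n => P) ≤ φ m r

/-! ### Binary classification with the hinge loss -/

/-- The label set `{-1, 1}`, with its elements regarded as real numbers. -/
abbrev Label : Type := ({-1, 1} : Set ℝ)

/-- The hinge loss `ℓ(g)(x, y) = (1 - y g(x))₊`. -/
def hingeLoss {X : Type*} (g : X → ℝ) (z : X × Label) : ℝ :=
  max (1 - (z.2 : ℝ) * g z.1) 0

/-- `η` is a version of `x ↦ P(Y = 1 | X = x)`. -/
structure IsRegressionFunction {X : Type*} [MeasurableSpace X] (P : Measure (X × Label))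
    (η : X → ℝ) : Prop where
  measurable : Measurable η
  ae_eq : (fun z : X × Label => η z.1) =ᵐ[P]
    P⟦{z : X × Label | (z.2 : ℝ) = 1} | MeasurableSpace.comap Prod.fst inferInstance⟧

/-- The Bayes classifier, with value `1` where `η = 1/2`. -/
def bayesClassifier {X : Type*} (η : X → ℝ) (x : X) : ℝ :=
  open scoped Classical in if 1 / 2 ≤ η x then 1 else -1

/-- The square integrable functions on `X`, as functions, not as classes of functions. -/
def squareIntegrable {X : Type*} [MeasurableSpace X] (μ : Measure X) : Set (X → ℝ) :=
  {g | MemLp g 2 μ}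

/-! ### Reproducing kernel Hilbert spaces -/

/-- The reproducing kernel `k(x, y)` of a Hilbert space `H` of real functions on `X`; Mathlib's
kernel takes values in the linear maps `ℝ → ℝ`. -/
def rkhsKernel {X : Type*} (H : Type*) [NormedAddCommGroup H] [InnerProductSpace ℝ H]
    [CompleteSpace H] [RKHS ℝ H X ℝ] (x y : X) : ℝ :=
  RKHS.kernel H x y 1

/-- The ball of radius `R` of the RKHS `H`, as a set of functions on `X`. -/
def rkhsBall {X : Type*} (H : Type*) [NormedAddCommGroup H] [InnerProductSpace ℝ H]
    [RKHS ℝ H X ℝ] (R : ℝ) : Set (X → ℝ) :=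
  {g | ∃ h : H, ‖h‖ ≤ R ∧ ⇑h = g}

/-! ### The kernel integral operator and its eigenvalues -/

/-- `L` is the operator `(L f)(x) = ∫ k(x, y) f(y) dμ(y)` on `L²(μ)`. -/
def IsKernelIntegralOperator {X : Type*} [MeasurableSpace X] (k : X → X → ℝ) (μ : Measure X)
    (L : Lp ℝ 2 μ →L[ℝ] Lp ℝ 2 μ) : Prop :=
  ∀ f : Lp ℝ 2 μ, (L f : X → ℝ) =ᵐ[μ] fun x => ∫ y, k x y * f y ∂μ

open scoped Classical in
/-- The operator `(L f)(x) = ∫ k(x, y) f(y) dμ(y)` on `L²(μ)` (and `0` if there is no such bounded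
operator). -/
def kernelIntegralOperator {X : Type*} [MeasurableSpace X] (k : X → X → ℝ) (μ : Measure X) :
    Lp ℝ 2 μ →L[ℝ] Lp ℝ 2 μ :=
  if h : ∃ L, IsKernelIntegralOperator k μ L then h.choose else 0

/-- For a bounded measurable kernel and a finite measure the integral operator exists, so that
`kernelIntegralOperator` is the operator of the formula. -/
theorem isKernelIntegralOperator_kernelIntegralOperator {X : Type*} [MeasurableSpace X]
    {k : X → X → ℝ} {μ : Measure X} [IsFiniteMeasure μ] (hk : Measurable (Function.uncurry k))
    {B : ℝ} (hB : ∀ x y, |k x y| ≤ B) :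
    IsKernelIntegralOperator k μ (kernelIntegralOperator k μ) := by
  have key : ∃ L, IsKernelIntegralOperator k μ L := by
    have hint : ∀ (f : Lp ℝ 2 μ) (x : X), Integrable (fun y => k x y * f y) μ := by
      intro f x
      refine ((Lp.memLp f).integrable (by norm_num)).bdd_mul (c := B) ?_ ?_
      · exact (hk.comp measurable_prodMk_left).aestronglyMeasurable
      · exact Filter.Eventually.of_forall fun y => by simpa using hB x y
    have hbd : ∀ (f : Lp ℝ 2 μ) (x : X), |∫ y, k x y * f y ∂μ| ≤ |B| * ∫ y, |f y| ∂μ := by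
      intro f x
      rw [← integral_const_mul, ← Real.norm_eq_abs]
      refine norm_integral_le_of_norm_le
        (((Lp.memLp f).integrable (by norm_num)).abs.const_mul _) ?_
      refine Filter.Eventually.of_forall fun y => ?_
      rw [norm_mul, Real.norm_eq_abs, Real.norm_eq_abs]
      exact mul_le_mul_of_nonneg_right ((hB x y).trans (le_abs_self B)) (abs_nonneg _)
    have hmem : ∀ f : Lp ℝ 2 μ, MemLp (fun x => ∫ y, k x y * f y ∂μ) 2 μ := by
      intro f
      refine MemLp.of_bound (C := |B| * ∫ y, |f y| ∂μ) ?_ ?_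
      · have h1 : StronglyMeasurable (fun p : X × X => k p.1 p.2 * f p.2) :=
          hk.stronglyMeasurable.mul ((Lp.stronglyMeasurable f).comp_measurable measurable_snd)
        exact h1.integral_prod_right'.aestronglyMeasurable
      · exact Filter.Eventually.of_forall fun x => hbd f x
    let A : Lp ℝ 2 μ →ₗ[ℝ] Lp ℝ 2 μ :=
      { toFun := fun f => (hmem f).toLp
        map_add' := by
          intro f g
          rw [← MemLp.toLp_add]
          apply (MemLp.toLp_eq_toLp_iff _ _).2
          refine Filter.Eventually.of_forall fun x => ?_
          simp only [Pi.add_apply]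
          rw [← integral_add (hint f x) (hint g x)]
          refine integral_congr_ae ?_
          filter_upwards [Lp.coeFn_add f g] with y hy
          rw [hy, Pi.add_apply, mul_add]
        map_smul' := by
          intro c f
          rw [RingHom.id_apply, ← MemLp.toLp_const_smul]
          apply (MemLp.toLp_eq_toLp_iff _ _).2
          refine Filter.Eventually.of_forall fun x => ?_
          simp only [Pi.smul_apply, smul_eq_mul]
          rw [← integral_const_mul]
          refine integral_congr_ae ?_
          filter_upwards [Lp.coeFn_smul c f] with y hy
          rw [hy, Pi.smul_apply, smul_eq_mul]
          ring }
    have hA : Continuous A := by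
      have h1 : ∀ f : Lp ℝ 2 μ, ∫ y, |f y| ∂μ ≤
          (eLpNorm f 2 μ * μ univ ^ (1 / (1 : ENNReal).toReal - 1 / (2 : ENNReal).toReal)).toReal := by
        intro f
        have h2 : ∫ y, |f y| ∂μ = (eLpNorm f 1 μ).toReal := by
          rw [eLpNorm_one_eq_lintegral_enorm]
          exact integral_norm_eq_lintegral_enorm (Lp.aestronglyMeasurable f)
        rw [h2]
        refine ENNReal.toReal_mono ?_ (eLpNorm_le_eLpNorm_mul_rpow_measure_univ (by norm_num)
          (Lp.aestronglyMeasurable f))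
        refine ENNReal.mul_ne_top (Lp.eLpNorm_ne_top f) ?_
        refine ENNReal.rpow_ne_top_of_nonneg (by norm_num) (measure_ne_top μ univ)
      refine AddMonoidHomClass.continuous_of_bound A
        ((μ univ ^ (ENNReal.toReal 2)⁻¹).toReal * (|B| *
          (μ univ ^ (1 / (1 : ENNReal).toReal - 1 / (2 : ENNReal).toReal)).toReal)) ?_
      intro f
      have h3 : ‖A f‖ ≤ (μ univ ^ (ENNReal.toReal 2)⁻¹).toReal * (|B| * ∫ y, |f y| ∂μ) := by
        refine (Lp.norm_le_of_ae_bound (f := A f) (C := |B| * ∫ y, |f y| ∂μ) ?_ ?_).trans ?_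
        · positivity
        · filter_upwards [(hmem f).coeFn_toLp] with x hx
          change ‖((hmem f).toLp : X → ℝ) x‖ ≤ _
          rw [hx]
          exact hbd f x
        · simp [measureUnivNNReal]
          exact le_of_eq (by rw [← ENNReal.toReal_rpow]; rfl)
      refine h3.trans ?_
      have h4 := h1 f
      rw [ENNReal.toReal_mul, ← Lp.norm_def] at h4
      calc _ ≤ (μ univ ^ (ENNReal.toReal 2)⁻¹).toReal * (|B| * (‖f‖ *
            (μ univ ^ (1 / (1 : ENNReal).toReal - 1 / (2 : ENNReal).toReal)).toReal)) := by gcongr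
        _ = _ := by ring
    exact ⟨⟨A, hA⟩, fun f => (hmem f).coeFn_toLp⟩
  rw [kernelIntegralOperator, dif_pos key]
  exact key.choose_spec

/-- `lam 0 ≥ lam 1 ≥ …` are the nonzero eigenvalues of the operator `T`, all of them positive, each
repeated according to its multiplicity, and followed by zeros if they are finitely many. -/
structure IsEigenvalueSequence {E : Type*} [NormedAddCommGroup E] [InnerProductSpace ℝ E]
    (T : E →L[ℝ] E) (lam : ℕ → ℝ) : Prop where
  antitone : Antitone lam
  nonneg : ∀ j, 0 ≤ lam j
  multiplicity : ∀ μ : ℝ, μ ≠ 0 →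
    FiniteDimensional ℝ (Module.End.eigenspace (T : E →ₗ[ℝ] E) μ) ∧
    {j | lam j = μ}.Finite ∧
    {j | lam j = μ}.ncard = Module.finrank ℝ (Module.End.eigenspace (T : E →ₗ[ℝ] E) μ)

/-! ### Supremum norm entropy -/

/-- `H` is included in the bounded continuous functions on `X` (in all continuous functions, if `X`
is compact) by a compact injection. -/
def HasCompactInclusion {X : Type*} [TopologicalSpace X] (H : Type*) [NormedAddCommGroup H]
    [InnerProductSpace ℝ H] [RKHS ℝ H X ℝ] : Prop :=
  ∃ T : H →L[ℝ] (X →ᵇ ℝ), IsCompactOperator T ∧ ∀ h : H, ⇑(T h) = ⇑h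

/-- The `ε`-entropy in the supremum norm of the unit ball of `H`: the logarithm of the least number
of balls of radius `ε` in the space of bounded continuous functions that cover the unit ball. For
`ε > 0` that number is finite if `H` has a compact inclusion. -/
def supEntropy {X : Type*} [TopologicalSpace X] (H : Type*) [NormedAddCommGroup H]
    [InnerProductSpace ℝ H] [RKHS ℝ H X ℝ] (ε : ℝ) : ℝ :=
  Real.log (Metric.externalCoveringNumber ε.toNNReal
    {f : X →ᵇ ℝ | ∃ h : H, ‖h‖ ≤ 1 ∧ ⇑h = ⇑f}).toNat

/-- The entropy integral `ξ(x) = ∫₀ˣ √(H_∞(ε)) dε`. -/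
def entropyIntegral {X : Type*} [TopologicalSpace X] (H : Type*) [NormedAddCommGroup H]
    [InnerProductSpace ℝ H] [RKHS ℝ H X ℝ] (x : ℝ) : ℝ :=
  ∫ ε in (0 : ℝ)..x, √(supEntropy H ε)

end

/-! In both settings `φ_R(r) = α √r` with an `α` that does not depend on `R`. The equation `φ_R(r) =
r / C_R` then has the greatest solution `r* = (C_R α)²`, and for `r ≥ r*` one has `√r ≥ C_R α`, so
terms of a local bound that are free of `r` can be absorbed into `α √r`. What is left is to choose
`d` and `α`, to prove the margin inequality (H3) and to bound the local suprema (H4); (H2) is the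
bound of a variance by a second moment.

For (H3), conditioning on `X` turns the relative risk into the integral of a pointwise excess risk
(`integral_hingeLoss_sub`), which is piecewise linear in the prediction. In (S1), `d` is the
`L²(P_X)` distance of the predictions, and (A3) is what makes the excess risk grow at rate `η₁`
beyond the correct label. In (S2), `d` is the `L²(P)` distance of the losses; overshooting the
correct label then costs only on the less likely label, with the same weight in the squared distance
as in the excess risk, so (A3) is not needed.

For (H4), separability and continuity reduce the supremum over a ball to a countable one
(`localizedSup_hingeLoss_rkhsBall`), and symmetrization bounds its mean by `2 / n` times a mean
Rademacher average.

In (S1), contraction removes the hinge loss. Let `S` be the inclusion of the RKHS into `L²(P_X)`, so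
that the integral operator is `S S*`; it is compact, and its eigenvectors yield vectors `vⱼ`,
orthonormal in the RKHS up to padding by zeros, with `‖S vⱼ‖² = λⱼ`. The signed sum of the
representers `k_{Xᵢ}` is split along `v₀, …, v_{D-1}`. On their span the `L²` radius of the class
gives `√(n D r)`; on the residual the RKHS radius `2 R` gives `2 R √(n ∑_{j ≥ D} λⱼ)`, by the trace
formula for the residual of the kernel (`exists_eigenfunctions`). With `α² = 16 / √n · (D / √n + η₁
/ M · √(∑_{j ≥ D} λⱼ))` each of the two terms is at most `α √r / 2`: the first by the choice of 16,
the second because `√r ≥ C_R α` and `C_R ≥ 2 M R / η₁`.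

In (S2), Dudley's chaining bounds the mean Rademacher average by the entropy integral up to half the
mean-square empirical radius `s` of the class. A second symmetrization, with contraction for the
square, gives `s² ≤ r + 8 M R A`, where `A` is the mean Rademacher average divided by `n`. Concavity
of `ξ` makes it at most linear beyond `x_*`, so that `A ≤ 6 (x_* / M) √(r + 8 M R A)`. For `√r ≥ 50
R x_*` this self-referential inequality forces `A ≤ 25 (x_* / M) √r`, whence `α = 50 x_* / M` and
`2500 = 50²`. -/

noncomputable section

/-! ### Rademacher averages -/

/-- If `A ≤ p / t + t q` for all `t > 0`, then `A ≤ 2 √(p q)`. -/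
theorem le_two_mul_sqrt_of_forall_le {A p q : ℝ} (hp : 0 ≤ p) (hq : 0 ≤ q)
    (h : ∀ t, 0 < t → A ≤ p / t + t * q) : A ≤ 2 * √(p * q) := by
  -- The minimizer `t = √p / √q` degenerates when `p` or `q` vanishes; these two cases use a small,
  -- respectively large, `t` that already contradicts `A > 0`.
  rcases hp.eq_or_lt with rfl | hp
  · simp only [zero_div, zero_add, zero_mul, Real.sqrt_zero, mul_zero] at h ⊢
    by_contra! hA
    have h1 := h (A / (2 * (q + 1))) (by positivity)
    have h2 : A / (2 * (q + 1)) * q < A := by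
      rw [div_mul_eq_mul_div, div_lt_iff₀ (by positivity)]
      nlinarith
    linarith
  rcases hq.eq_or_lt with rfl | hq
  · simp only [mul_zero, add_zero, Real.sqrt_zero] at h ⊢
    by_contra! hA
    have h1 := h (2 * p / A) (by positivity)
    have h2 : p / (2 * p / A) = A / 2 := by field_simp
    linarith
  have h1 := h (√p / √q) (by positivity)
  have h2 : p / (√p / √q) + √p / √q * q = 2 * (√p * √q) := by
    have hp' := Real.sq_sqrt hp.le
    have hq' := Real.sq_sqrt hq.le
    have h3 : 0 < √p := Real.sqrt_pos.2 hp
    have h4 : 0 < √q := Real.sqrt_pos.2 hq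
    field_simp
    rw [hp', hq']
    ring
  rw [Real.sqrt_mul hp.le]
  linarith

/-- The average of a function of `n` signs. -/
def signAverage {n : ℕ} (F : (Fin n → ℤˣ) → ℝ) : ℝ :=
  ((2 : ℝ) ^ n)⁻¹ * ∑ ε, F ε

/-- The signed sum `∑ⱼ εⱼ aⱼ`. -/
def signSum {n : ℕ} (ε : Fin n → ℤˣ) (a : Fin n → ℝ) : ℝ :=
  ∑ j, ((ε j : ℤ) : ℝ) * a j

theorem abs_sign (u : ℤˣ) : |((u : ℤ) : ℝ)| = 1 := by
  rcases Int.units_eq_one_or u with rfl | rfl <;> simp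

section signAverage

variable {n : ℕ}

theorem signAverage_mono {F G : (Fin n → ℤˣ) → ℝ} (h : ∀ ε, F ε ≤ G ε) :
    signAverage F ≤ signAverage G :=
  mul_le_mul_of_nonneg_left (Finset.sum_le_sum fun ε _ => h ε) (by positivity)

theorem signAverage_add (F G : (Fin n → ℤˣ) → ℝ) :
    signAverage (fun ε => F ε + G ε) = signAverage F + signAverage G := by
  simp [signAverage, Finset.sum_add_distrib, mul_add]

theorem signAverage_const_mul (c : ℝ) (F : (Fin n → ℤˣ) → ℝ) :
    signAverage (fun ε => c * F ε) = c * signAverage F := by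
  simp only [signAverage, ← Finset.mul_sum]
  ring

theorem signAverage_const (c : ℝ) : signAverage (fun _ : Fin n → ℤˣ => c) = c := by
  simp [signAverage]

theorem signAverage_sum {κ : Type*} (s : Finset κ) (F : κ → (Fin n → ℤˣ) → ℝ) :
    signAverage (fun ε => ∑ k ∈ s, F k ε) = ∑ k ∈ s, signAverage (F k) := by
  simp only [signAverage]
  rw [Finset.sum_comm, Finset.mul_sum]

/-- Multiplication by a fixed sign vector permutes the cube. It serves to flip one sign
(orthogonality, contraction) or all of them (symmetrization). -/
theorem signAverage_mul_left (δ : Fin n → ℤˣ) (F : (Fin n → ℤˣ) → ℝ) :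
    signAverage (fun ε => F (δ * ε)) = signAverage F := by
  simp only [signAverage]
  rw [Fintype.sum_equiv (Equiv.mulLeft δ) (fun ε => F (δ * ε)) F (fun _ => rfl)]

theorem signAverage_nonneg {F : (Fin n → ℤˣ) → ℝ} (h : ∀ ε, 0 ≤ F ε) : 0 ≤ signAverage F :=
  mul_nonneg (by positivity) (Finset.sum_nonneg fun ε _ => h ε)

/-- The mean square of `∑ⱼ εⱼ wⱼ`. -/
theorem signAverage_norm_sq {E : Type*} [NormedAddCommGroup E] [InnerProductSpace ℝ E]
    (w : Fin n → E) :
    signAverage (fun ε => ‖∑ j, ((ε j : ℤ) : ℝ) • w j‖ ^ 2) = ∑ j, ‖w j‖ ^ 2 := by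
  have h1 : ∀ ε : Fin n → ℤˣ, ‖∑ j, ((ε j : ℤ) : ℝ) • w j‖ ^ 2
      = ∑ i, ∑ j, inner ℝ (w i) (w j) * (((ε i : ℤ) : ℝ) * ((ε j : ℤ) : ℝ)) := by
    intro ε
    rw [← real_inner_self_eq_norm_sq, sum_inner]
    refine Finset.sum_congr rfl fun i _ => ?_
    rw [inner_sum]
    refine Finset.sum_congr rfl fun j _ => ?_
    rw [real_inner_smul_left, real_inner_smul_right]
    ring
  simp only [h1, signAverage_sum, signAverage_const_mul]
  refine Finset.sum_congr rfl fun i _ => ?_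
  rw [Finset.sum_eq_single i]
  · have h2 : ∀ ε : Fin n → ℤˣ, ((ε i : ℤ) : ℝ) * ((ε i : ℤ) : ℝ) = 1 := by
      intro ε
      rcases Int.units_eq_one_or (ε i) with h | h <;> simp [h]
    simp only [h2, signAverage_const, real_inner_self_eq_norm_sq, mul_one]
  -- Flipping the sign `i` alone negates the cross term, so its average vanishes.
  · intro j _ hj
    have h3 := signAverage_mul_left (Pi.mulSingle i (-1))
      (fun ε : Fin n → ℤˣ => ((ε i : ℤ) : ℝ) * ((ε j : ℤ) : ℝ))
    have h4 : (fun ε : Fin n → ℤˣ => ((((Pi.mulSingle i (-1) : Fin n → ℤˣ) * ε) i : ℤ) : ℝ) *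
        ((((Pi.mulSingle i (-1) : Fin n → ℤˣ) * ε) j : ℤ) : ℝ))
        = fun ε => (-1) * (((ε i : ℤ) : ℝ) * ((ε j : ℤ) : ℝ)) := by
      funext ε
      simp [Pi.mulSingle_eq_of_ne hj]
    rw [h4, signAverage_const_mul] at h3
    have h5 : signAverage (fun ε : Fin n → ℤˣ => ((ε i : ℤ) : ℝ) * ((ε j : ℤ) : ℝ)) = 0 := by
      linarith
    rw [h5, mul_zero]
  · simp

theorem signAverage_signSum_sq (a : Fin n → ℝ) :
    signAverage (fun ε => signSum ε a ^ 2) = ∑ j, a j ^ 2 := by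
  have := signAverage_norm_sq a
  simpa [signSum] using this

theorem signSum_le (ε : Fin n → ℤˣ) {a : Fin n → ℝ} {B : ℝ} (h : ∀ j, |a j| ≤ B) :
    |signSum ε a| ≤ n * B := by
  calc |signSum ε a| ≤ ∑ j, |((ε j : ℤ) : ℝ) * a j| := Finset.abs_sum_le_sum_abs _ _
    _ ≤ ∑ _j : Fin n, B := Finset.sum_le_sum fun j _ => by
        rw [abs_mul, abs_sign, one_mul]
        exact h j
    _ = n * B := by simp

theorem bddAbove_range_signSum {ι : Type*} (ε : Fin n → ℤˣ) {a : ι → Fin n → ℝ} {B : ℝ}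
    (h : ∀ i j, |a i j| ≤ B) : BddAbove (range fun i => signSum ε (a i)) :=
  ⟨n * B, by rintro _ ⟨i, rfl⟩; exact (abs_le.1 (signSum_le ε (h i))).2⟩

/-- The Rademacher average `𝔼_ε supᵢ ∑ⱼ εⱼ aᵢⱼ`. -/
def rademacherAverage {ι : Type*} (a : ι → Fin n → ℝ) : ℝ :=
  signAverage fun ε => ⨆ i, signSum ε (a i)

theorem rademacherAverage_const_mul {ι : Type*} {c : ℝ} (hc : 0 ≤ c) (a : ι → Fin n → ℝ) :
    rademacherAverage (fun i j => c * a i j) = c * rademacherAverage a := by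
  rw [rademacherAverage, rademacherAverage, ← signAverage_const_mul]
  congr 1
  funext ε
  rw [Real.mul_iSup_of_nonneg hc]
  congr 1
  funext i
  rw [signSum, signSum, Finset.mul_sum]
  exact Finset.sum_congr rfl fun j _ => by ring

theorem signSum_update (ε : Fin n → ℤˣ) (a : Fin n → ℝ) (m : Fin n) (x : ℝ) :
    signSum ε (Function.update a m x)
      = signSum ε (Function.update a m 0) + ((ε m : ℤ) : ℝ) * x := by
  rw [signSum, signSum, ← Finset.add_sum_erase _ _ (Finset.mem_univ m),
    ← Finset.add_sum_erase (Finset.univ) (fun j => ((ε j : ℤ) : ℝ) * Function.update a m 0 j)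
      (Finset.mem_univ m)]
  simp only [Function.update_self, mul_zero, zero_add]
  rw [add_comm]
  congr 1
  refine Finset.sum_congr rfl fun j hj => ?_
  rw [Function.update_of_ne (Finset.ne_of_mem_erase hj),
    Function.update_of_ne (Finset.ne_of_mem_erase hj)]

theorem abs_update_le {a : Fin n → ℝ} {B x : ℝ} (ha : ∀ j, |a j| ≤ B) (hx : |x| ≤ B) (m j : Fin n) :
    |Function.update a m x j| ≤ B := by
  by_cases h : j = m
  · subst h; simpa using hx
  · simpa [Function.update_of_ne h] using ha j

/-- Replacing one coordinate by a coordinate with larger increments increases the Rademacher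
average. -/
theorem rademacherAverage_update_le {ι : Type*} [Nonempty ι] {w : ι → Fin n → ℝ} {u v : ι → ℝ}
    {B : ℝ} (hw : ∀ i j, |w i j| ≤ B) (hv : ∀ i, |v i| ≤ B)
    (m : Fin n) (huv : ∀ i k, |u i - u k| ≤ |v i - v k|) :
    rademacherAverage (fun i => Function.update (w i) m (u i))
      ≤ rademacherAverage (fun i => Function.update (w i) m (v i)) := by
  set δ : Fin n → ℤˣ := Pi.mulSingle m (-1) with hδ
  -- Each `ε` is paired with the vector that differs from it in the sign `m`; the comparison then
  -- holds pair by pair, before averaging.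
  have key : ∀ x : ι → ℝ, rademacherAverage (fun i => Function.update (w i) m (x i))
      = (1 / 2) * signAverage (fun ε => (⨆ i, signSum ε (Function.update (w i) m (x i)))
        + ⨆ i, signSum (δ * ε) (Function.update (w i) m (x i))) := by
    intro x
    rw [signAverage_add, signAverage_mul_left δ
      (fun ε => ⨆ i, signSum ε (Function.update (w i) m (x i)))]
    rw [rademacherAverage]
    ring
  rw [key u, key v]
  refine mul_le_mul_of_nonneg_left (signAverage_mono fun ε => ?_) (by norm_num)
  have hflip : ∀ (a : Fin n → ℝ) (x : ℝ), signSum (δ * ε) (Function.update a m x)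
      = signSum ε (Function.update a m 0) - ((ε m : ℤ) : ℝ) * x := by
    intro a x
    rw [signSum_update]
    have h1 : signSum (δ * ε) (Function.update a m 0) = signSum ε (Function.update a m 0) := by
      refine Finset.sum_congr rfl fun j _ => ?_
      by_cases h : j = m
      · subst h; simp
      · simp [hδ, Pi.mulSingle_eq_of_ne h]
    rw [h1]
    simp [hδ]
    ring
  have hb1 : BddAbove (range fun i => signSum ε (Function.update (w i) m (v i))) :=
    bddAbove_range_signSum ε fun i j => abs_update_le (hw i) (hv i) m j
  have hb2 : BddAbove (range fun i => signSum (δ * ε) (Function.update (w i) m (v i))) :=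
    bddAbove_range_signSum (δ * ε) fun i j => abs_update_le (hw i) (hv i) m j
  have hpair : ∀ i k, signSum ε (Function.update (w i) m (u i))
      + signSum (δ * ε) (Function.update (w k) m (u k))
      ≤ (⨆ i, signSum ε (Function.update (w i) m (v i)))
        + ⨆ i, signSum (δ * ε) (Function.update (w i) m (v i)) := by
    intro i k
    -- The two suprema contribute `± (u i - u k)`, at most `|v i - v k|`. Depending on the sign of
    -- `v i - v k`, this is realized by the indices in the order `i, k` or `k, i`, hence four
    -- bounds.
    have e1 := le_ciSup hb1 i
    have e2 := le_ciSup hb2 k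
    have e3 := le_ciSup hb1 k
    have e4 := le_ciSup hb2 i
    simp only [hflip] at e2 e4 ⊢
    rw [signSum_update ε (w i)] at e1 ⊢
    rw [signSum_update ε (w k)] at e3
    have h := huv i k
    rcases Int.units_eq_one_or (ε m) with h1 | h1 <;> simp only [h1, Units.val_one, Units.val_neg,
      Int.cast_one, Int.cast_neg, one_mul, neg_mul] at e1 e2 e3 e4 ⊢ <;>
    rcases le_total (v i - v k) 0 with h2 | h2 <;>
    [rw [abs_of_nonpos h2] at h; rw [abs_of_nonneg h2] at h;
     rw [abs_of_nonpos h2] at h; rw [abs_of_nonneg h2] at h] <;>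
    linarith [le_abs_self (u i - u k), neg_abs_le (u i - u k)]
  have h5 : ∀ k, (⨆ i, signSum ε (Function.update (w i) m (u i)))
      ≤ (⨆ i, signSum ε (Function.update (w i) m (v i)))
        + (⨆ i, signSum (δ * ε) (Function.update (w i) m (v i)))
        - signSum (δ * ε) (Function.update (w k) m (u k)) :=
    fun k => ciSup_le fun i => by linarith [hpair i k]
  have h6 : (⨆ i, signSum (δ * ε) (Function.update (w i) m (u i)))
      ≤ (⨆ i, signSum ε (Function.update (w i) m (v i)))
        + (⨆ i, signSum (δ * ε) (Function.update (w i) m (v i)))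
        - ⨆ i, signSum ε (Function.update (w i) m (u i)) :=
    ciSup_le fun k => by linarith [h5 k]
  linarith

/-- The comparison (contraction) principle for Rademacher averages. -/
theorem rademacherAverage_le_of_increments {ι : Type*} [Nonempty ι] {u v : ι → Fin n → ℝ} {B : ℝ}
    (hu : ∀ i j, |u i j| ≤ B) (hv : ∀ i j, |v i j| ≤ B)
    (huv : ∀ i k j, |u i j - u k j| ≤ |v i j - v k j|) :
    rademacherAverage u ≤ rademacherAverage v := by
  -- The coordinates are replaced one at a time; `s` is the set of those already replaced.
  have key : ∀ s : Finset (Fin n), rademacherAverage u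
      ≤ rademacherAverage (fun i j => if j ∈ s then v i j else u i j) := by
    intro s
    induction s using Finset.induction_on with
    | empty => simp
    | insert m s hm ih =>
      refine ih.trans ?_
      have h1 := rademacherAverage_update_le (w := fun i j => if j ∈ s then v i j else u i j)
        (u := fun i => u i m) (v := fun i => v i m) (B := B)
        (fun i j => by split_ifs <;> simp [hu, hv]) (fun i => hv i m) m
        (fun i k => huv i k m)
      have e1 : (fun i j => if j ∈ s then v i j else u i j)
          = fun i => Function.update (fun j => if j ∈ s then v i j else u i j) m (u i m) := by
        funext i j
        by_cases h : j = m
        · subst h; simp [hm]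
        · simp [h]
      have e2 : (fun i j => if j ∈ insert m s then v i j else u i j)
          = fun i => Function.update (fun j => if j ∈ s then v i j else u i j) m (v i m) := by
        funext i j
        by_cases h : j = m
        · subst h; simp
        · simp [h]
      rw [e2]
      exact (congrArg rademacherAverage e1).le.trans h1
  simpa using key Finset.univ

/-- Signed sums are sub-Gaussian. -/
theorem signAverage_exp_signSum_le (a : Fin n → ℝ) :
    signAverage (fun ε => Real.exp (signSum ε a)) ≤ Real.exp ((∑ j, a j ^ 2) / 2) := by
  have h1 : ∑ ε : Fin n → ℤˣ, Real.exp (signSum ε a)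
      = ∏ j, ∑ u : ℤˣ, Real.exp (((u : ℤ) : ℝ) * a j) := by
    rw [Finset.prod_univ_sum]
    simp only [signSum, Real.exp_sum, Fintype.piFinset_univ]
  have h2 : ∀ x : ℝ, ∑ u : ℤˣ, Real.exp (((u : ℤ) : ℝ) * x) = 2 * Real.cosh x := by
    intro x
    rw [show (Finset.univ : Finset ℤˣ) = {1, -1} from rfl, Finset.sum_pair (by decide),
      Real.cosh_eq]
    simp only [Units.val_one, Int.cast_one, one_mul, Units.val_neg, Int.cast_neg, neg_mul]
    ring
  rw [signAverage, h1]
  simp only [h2, Finset.prod_mul_distrib, Finset.prod_const, Finset.card_univ, Fintype.card_fin]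
  rw [← mul_assoc, inv_mul_cancel₀ (by positivity), one_mul, Finset.sum_div, Real.exp_sum]
  exact Finset.prod_le_prod (fun j _ => (Real.cosh_pos _).le)
    fun j _ => Real.cosh_le_exp_half_sq (a j)

/-- The maximal inequality for finitely many signed sums. -/
theorem signAverage_sup'_le (C : Finset (Fin n → ℝ)) (hC : C.Nonempty) {τ N : ℝ} (hτ : 0 ≤ τ)
    (hCτ : ∀ c ∈ C, ∑ j, c j ^ 2 ≤ τ ^ 2) (hN : (C.card : ℝ) ≤ N) :
    signAverage (fun ε => C.sup' hC fun c => signSum ε c) ≤ τ * √(2 * Real.log N) := by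
  have hcard : (1 : ℝ) ≤ C.card := by exact_mod_cast hC.card_pos
  have hN1 : 1 ≤ N := hcard.trans hN
  have hlog : 0 ≤ Real.log N := Real.log_nonneg hN1
  -- Exponential moments: Jensen, a maximum of exponentials bounded by their sum, and the
  -- sub-Gaussian bound for each signed sum. The optimization over `t` is left to
  -- `le_two_mul_sqrt_of_forall_le`.
  have key : ∀ t, 0 < t → signAverage (fun ε => C.sup' hC fun c => signSum ε c)
      ≤ Real.log N / t + t * (τ ^ 2 / 2) := by
    intro t ht
    have hjensen : Real.exp (signAverage fun ε => t * C.sup' hC fun c => signSum ε c)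
        ≤ signAverage fun ε => Real.exp (t * C.sup' hC fun c => signSum ε c) := by
      have := convexOn_exp.map_sum_le (t := (Finset.univ : Finset (Fin n → ℤˣ)))
        (w := fun _ => ((2 : ℝ) ^ n)⁻¹) (p := fun ε => t * C.sup' hC fun c => signSum ε c)
        (fun _ _ => by positivity) (by simp) (fun _ _ => mem_univ _)
      simpa [signAverage, Finset.mul_sum] using this
    have hle : (signAverage fun ε => Real.exp (t * C.sup' hC fun c => signSum ε c))
        ≤ N * Real.exp (t ^ 2 * τ ^ 2 / 2) := by
      calc _ ≤ signAverage fun ε => ∑ c ∈ C, Real.exp (signSum ε fun j => t * c j) := by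
            refine signAverage_mono fun ε => ?_
            obtain ⟨c, hc, hmax⟩ := Finset.exists_mem_eq_sup' hC (fun c => signSum ε c)
            rw [hmax]
            have : t * signSum ε c = signSum ε fun j => t * c j := by
              rw [signSum, signSum, Finset.mul_sum]
              exact Finset.sum_congr rfl fun j _ => by ring
            rw [this]
            exact Finset.single_le_sum
              (f := fun c : Fin n → ℝ => Real.exp (signSum ε fun j => t * c j))
              (fun c _ => (Real.exp_pos _).le) hc
        _ = ∑ c ∈ C, signAverage fun ε => Real.exp (signSum ε fun j => t * c j) :=
            signAverage_sum _ _
        _ ≤ ∑ _c ∈ C, Real.exp (t ^ 2 * τ ^ 2 / 2) := by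
            refine Finset.sum_le_sum fun c hc => (signAverage_exp_signSum_le _).trans ?_
            rw [Real.exp_le_exp]
            simp only [mul_pow, ← Finset.mul_sum]
            have := mul_le_mul_of_nonneg_left (hCτ c hc) (sq_nonneg t)
            linarith
        _ = C.card * Real.exp (t ^ 2 * τ ^ 2 / 2) := by simp
        _ ≤ _ := by gcongr
    have h3 := hjensen.trans hle
    rw [← Real.exp_log (show 0 < N by linarith), ← Real.exp_add, Real.exp_le_exp,
      signAverage_const_mul] at h3
    have h4 : Real.log N / t + t * (τ ^ 2 / 2) = (Real.log N + t ^ 2 * τ ^ 2 / 2) / t := by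
      field_simp
    rw [h4, le_div_iff₀ ht]
    linarith
  refine (le_two_mul_sqrt_of_forall_le hlog (by positivity) key).trans (le_of_eq ?_)
  rw [show Real.log N * (τ ^ 2 / 2) = (τ / 2) ^ 2 * (2 * Real.log N) by ring,
    Real.sqrt_mul (by positivity), Real.sqrt_sq (by positivity)]
  ring

end signAverage

/-! ### Chaining -/

/-- Chaining along covers at the scales `e 0, e 1, …`; the first link is bounded through the radius
`σ` of the class. -/
theorem rademacherAverage_le_chain {n : ℕ} {ι : Type*} [Nonempty ι] (a : ι → Fin n → ℝ)
    {σ : ℝ} (hσ0 : 0 ≤ σ) (hσ : ∀ i, ∑ j, a i j ^ 2 ≤ n * σ ^ 2) (e : ℕ → ℝ) (he : ∀ k, 0 ≤ e k)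
    (N : ℕ → ℝ) (C : ℕ → Finset (Fin n → ℝ)) (hN : ∀ k, ((C k).card : ℝ) ≤ N k)
    (hC : ∀ k i, ∃ c ∈ C k, ∀ j, |a i j - c j| ≤ e k) (K : ℕ) :
    rademacherAverage a ≤ √n * ((e 0 + σ) * √(2 * Real.log (N 0))
      + ∑ k ∈ Finset.range K, (e k + e (k + 1)) * √(2 * Real.log (N k * N (k + 1))))
      + n * e K := by
  classical
  choose c hcC hc using hC
  -- Some centres may be far from the class, and two arbitrary centres far from each other. The
  -- filters keep the vectors short enough for the maximal inequality, and lose none of the links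
  -- that occur.
  set L0 : Finset (Fin n → ℝ) := (C 0).filter fun v => ∑ j, v j ^ 2 ≤ (√n * (e 0 + σ)) ^ 2 with hL0
  set L : ℕ → Finset (Fin n → ℝ) := fun k => ((C k ×ˢ C (k + 1)).image fun p => p.2 - p.1).filter
    fun v => ∑ j, v j ^ 2 ≤ (√n * (e k + e (k + 1))) ^ 2 with hL
  have hc0 : ∀ i, c 0 i ∈ L0 := by
    intro i
    refine Finset.mem_filter.2 ⟨hcC 0 i, ?_⟩
    rw [mul_pow, Real.sq_sqrt (by positivity)]
    have h1 : ∑ j, (c 0 i j - a i j) ^ 2 ≤ n * e 0 ^ 2 := by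
      calc _ ≤ ∑ _j : Fin n, e 0 ^ 2 := Finset.sum_le_sum fun j _ => by
            have h := abs_le.1 (hc 0 i j)
            exact sq_le_sq' (by linarith) (by linarith)
        _ = _ := by simp
    have h2 : (∑ j, a i j * (c 0 i j - a i j)) ≤ n * (σ * e 0) := by
      have he0 := he 0
      refine (le_abs_self _).trans (abs_le_of_sq_le_sq ?_ (by positivity))
      calc _ ≤ (∑ j, a i j ^ 2) * ∑ j, (c 0 i j - a i j) ^ 2 := Finset.sum_mul_sq_le_sq_mul_sq _ _ _
        _ ≤ (n * σ ^ 2) * (n * e 0 ^ 2) := by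
            exact mul_le_mul (hσ i) h1 (Finset.sum_nonneg fun j _ => sq_nonneg _) (by positivity)
        _ = _ := by ring
    calc ∑ j, c 0 i j ^ 2 = ∑ j, a i j ^ 2 + 2 * ∑ j, a i j * (c 0 i j - a i j)
          + ∑ j, (c 0 i j - a i j) ^ 2 := by
          rw [Finset.mul_sum, ← Finset.sum_add_distrib, ← Finset.sum_add_distrib]
          exact Finset.sum_congr rfl fun j _ => by ring
      _ ≤ n * σ ^ 2 + 2 * (n * (σ * e 0)) + n * e 0 ^ 2 := by
          have := hσ i
          linarith
      _ = _ := by ring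
  have hck : ∀ k i, c (k + 1) i - c k i ∈ L k := by
    intro k i
    refine Finset.mem_filter.2 ⟨Finset.mem_image.2
      ⟨(c k i, c (k + 1) i), Finset.mem_product.2 ⟨hcC k i, hcC (k + 1) i⟩, rfl⟩, ?_⟩
    rw [mul_pow, Real.sq_sqrt (by positivity)]
    calc _ ≤ ∑ _j : Fin n, (e k + e (k + 1)) ^ 2 := Finset.sum_le_sum fun j _ => by
          rw [sq_le_sq, abs_of_nonneg (add_nonneg (he k) (he (k + 1)))]
          have h1 := abs_le.1 (hc k i j)
          have h2 := abs_le.1 (hc (k + 1) i j)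
          rw [Pi.sub_apply, abs_le]
          constructor <;> linarith
      _ = _ := by simp
  obtain ⟨i₀⟩ := ‹Nonempty ι›
  have : Nonempty ι := ⟨i₀⟩
  have hL0ne : L0.Nonempty := ⟨_, hc0 i₀⟩
  have hLne : ∀ k, (L k).Nonempty := fun k => ⟨_, hck k i₀⟩
  have hN0 : ∀ k, 0 ≤ N k := fun k => le_trans (by positivity) (hN k)
  have hsub : ∀ (ε : Fin n → ℤˣ) (x y : Fin n → ℝ), signSum ε (x - y) = signSum ε x - signSum ε y := by
    intro ε x y
    simp [signSum, mul_sub, Finset.sum_sub_distrib]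
  have hpoint : ∀ ε : Fin n → ℤˣ, (⨆ i, signSum ε (a i))
      ≤ (L0.sup' hL0ne fun v => signSum ε v)
        + ∑ k ∈ Finset.range K, ((L k).sup' (hLne k) fun v => signSum ε v) + n * e K := by
    intro ε
    refine ciSup_le fun i => ?_
    have h1 : signSum ε (a i) = signSum ε (c 0 i)
        + ∑ k ∈ Finset.range K, signSum ε (c (k + 1) i - c k i) + signSum ε (a i - c K i) := by
      simp only [hsub, Finset.sum_range_sub (fun k => signSum ε (c k i))]
      ring
    rw [h1]
    refine add_le_add (add_le_add ?_ ?_) ?_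
    · exact Finset.le_sup' (fun v => signSum ε v) (hc0 i)
    · exact Finset.sum_le_sum fun k _ => Finset.le_sup' (fun v => signSum ε v) (hck k i)
    · exact (le_abs_self _).trans (signSum_le ε (hc K i))
  refine (signAverage_mono hpoint).trans ?_
  rw [signAverage_add, signAverage_add, signAverage_const, signAverage_sum, mul_add]
  refine add_le_add (add_le_add ?_ ?_) le_rfl
  · rw [← mul_assoc]
    refine signAverage_sup'_le L0 hL0ne (by have := he 0; positivity)
      (fun v hv => (Finset.mem_filter.1 hv).2) (le_trans ?_ (hN 0))
    exact_mod_cast Finset.card_filter_le _ _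
  · rw [Finset.mul_sum]
    refine Finset.sum_le_sum fun k _ => ?_
    rw [← mul_assoc]
    refine signAverage_sup'_le (L k) (hLne k)
      (by have := he k; have := he (k + 1); positivity)
      (fun v hv => (Finset.mem_filter.1 hv).2) ?_
    calc ((L k).card : ℝ) ≤ ((C k).card * (C (k + 1)).card : ℕ) := by
          exact_mod_cast (Finset.card_filter_le _ _).trans
            (Finset.card_image_le.trans (Finset.card_product _ _).le)
      _ ≤ N k * N (k + 1) := by
          push_cast
          exact mul_le_mul (hN k) (hN (k + 1)) (by positivity) (hN0 k)

/-! ### Symmetrization -/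

section Symmetrization

variable {Z : Type*} [MeasurableSpace Z]

theorem measurable_iSup_signSum {ι : Type*} [Countable ι] {n : ℕ} {f : ι → Z → ℝ}
    (hf : ∀ i, Measurable (f i)) (ε : Fin n → ℤˣ) :
    Measurable fun z : Fin n → Z => ⨆ i, signSum ε fun j => f i (z j) := by
  refine Measurable.iSup fun i => ?_
  unfold signSum
  exact Finset.measurable_sum _ fun j _ =>
    ((hf i).comp (measurable_pi_apply j)).const_mul _

theorem measurable_rademacherAverage {ι : Type*} [Countable ι] {n : ℕ} {f : ι → Z → ℝ}
    (hf : ∀ i, Measurable (f i)) :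
    Measurable fun z : Fin n → Z => rademacherAverage fun i j => f i (z j) := by
  unfold rademacherAverage signAverage
  exact (Finset.measurable_sum _ fun ε _ => measurable_iSup_signSum hf ε).const_mul _

theorem abs_iSup_le {ι : Type*} [Nonempty ι] {x : ι → ℝ} {B : ℝ} (h : ∀ i, |x i| ≤ B) :
    |⨆ i, x i| ≤ B := by
  obtain ⟨i₀⟩ := ‹Nonempty ι›
  have : Nonempty ι := ⟨i₀⟩
  have hb : BddAbove (range x) := ⟨B, by rintro _ ⟨i, rfl⟩; exact (abs_le.1 (h i)).2⟩
  rw [abs_le]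
  exact ⟨(abs_le.1 (h i₀)).1.trans (le_ciSup hb i₀), ciSup_le fun i => (abs_le.1 (h i)).2⟩

theorem abs_signAverage_le {n : ℕ} {F : (Fin n → ℤˣ) → ℝ} {B : ℝ} (h : ∀ ε, |F ε| ≤ B) :
    |signAverage F| ≤ B := by
  rw [abs_le]
  constructor
  · rw [← signAverage_const (n := n) (-B)]
    exact signAverage_mono fun ε => (abs_le.1 (h ε)).1
  · rw [← signAverage_const (n := n) B]
    exact signAverage_mono fun ε => (abs_le.1 (h ε)).2

theorem abs_rademacherAverage_le {ι : Type*} [Nonempty ι] {n : ℕ} {a : ι → Fin n → ℝ} {B : ℝ}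
    (h : ∀ i j, |a i j| ≤ B) : |rademacherAverage a| ≤ n * B :=
  abs_signAverage_le fun ε => abs_iSup_le fun i => signSum_le ε (h i)

theorem integrable_of_measurable_of_abs_le {μ : Measure Z} [IsFiniteMeasure μ] {f : Z → ℝ}
    (hf : Measurable f) {B : ℝ} (h : ∀ z, |f z| ≤ B) : Integrable f μ :=
  Integrable.of_bound hf.aestronglyMeasurable B (Filter.Eventually.of_forall h)

theorem integral_signAverage {μ : Measure Z} {n : ℕ} {F : (Fin n → ℤˣ) → Z → ℝ}
    (hF : ∀ ε, Integrable (F ε) μ) :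
    ∫ z, signAverage (fun ε => F ε z) ∂μ = signAverage fun ε => ∫ z, F ε z ∂μ := by
  simp only [signAverage]
  rw [integral_const_mul, integral_finsetSum _ fun ε _ => hF ε]

theorem integrable_rademacherAverage {ι : Type*} [Nonempty ι] [Countable ι] {n : ℕ}
    {f : ι → Z → ℝ} (hf : ∀ i, Measurable (f i)) {B : ℝ} (hB : ∀ i z, |f i z| ≤ B)
    (P : Measure Z) [IsProbabilityMeasure P] :
    Integrable (fun z : Fin n → Z => rademacherAverage fun i j => f i (z j))
      (Measure.pi fun _ : Fin n => P) :=
  integrable_of_measurable_of_abs_le (measurable_rademacherAverage hf) (B := n * B)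
    fun z => abs_rademacherAverage_le fun i j => hB i (z j)

theorem abs_empiricalProcess_le (P : Measure Z) [IsProbabilityMeasure P] {n : ℕ} (hn : 0 < n)
    {f : Z → ℝ} {B : ℝ} (hB : ∀ z, |f z| ≤ B) (z : Fin n → Z) :
    |(empiricalProcess P n f z)| ≤ 2 * B := by
  have h1 : |∫ w, f w ∂P| ≤ B := by
    have := norm_integral_le_of_norm_le_const (μ := P) (f := f) (C := B)
      (Filter.Eventually.of_forall hB)
    simpa using this
  have h2 : |(n : ℝ)⁻¹ * ∑ i, f (z i)| ≤ B := by
    rw [abs_mul, abs_of_nonneg (by positivity : (0 : ℝ) ≤ (n : ℝ)⁻¹)]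
    have h3 : |∑ i, f (z i)| ≤ n * B := by
      calc |∑ i, f (z i)| ≤ ∑ i, |f (z i)| := Finset.abs_sum_le_sum_abs _ _
        _ ≤ ∑ _i : Fin n, B := Finset.sum_le_sum fun i _ => hB _
        _ = n * B := by simp
    calc _ ≤ (n : ℝ)⁻¹ * (n * B) := by gcongr
      _ = B := by field_simp
  unfold empiricalProcess
  exact (abs_sub _ _).trans (by linarith)

theorem measurable_empiricalProcess (P : Measure Z) {n : ℕ} {f : Z → ℝ} (hf : Measurable f) :
    Measurable (empiricalProcess P n f) := by
  unfold empiricalProcess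
  exact ((Finset.measurable_sum _ fun j _ =>
    hf.comp (measurable_pi_apply j)).const_mul _).const_sub _

/-- Symmetrization: the expected supremum of the empirical process is at most twice the expected
Rademacher average. -/
theorem integral_iSup_empiricalProcess_le (P : Measure Z) [IsProbabilityMeasure P] {ι : Type*}
    [Nonempty ι] [Countable ι] {n : ℕ} (hn : 0 < n) {f : ι → Z → ℝ} (hf : ∀ i, Measurable (f i))
    {B : ℝ} (hB : ∀ i z, |f i z| ≤ B) :
    ∫ z, (⨆ i, empiricalProcess P n (f i) z) ∂(Measure.pi fun _ : Fin n => P)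
      ≤ 2 / n * ∫ z, rademacherAverage (fun i j => f i (z j)) ∂(Measure.pi fun _ : Fin n => P) := by
  set Q : Measure (Fin n → Z) := Measure.pi fun _ : Fin n => P with hQ
  set QQ : Measure (Fin n → Z × Z) := Measure.pi fun _ : Fin n => P.prod P with hQQ
  have hB0 : 0 ≤ B := by
    obtain ⟨i⟩ := ‹Nonempty ι›
    obtain ⟨z⟩ := nonempty_of_isProbabilityMeasure P
    exact (abs_nonneg _).trans (hB i z)
  -- the symmetrized differences
  set g : ι → Z × Z → ℝ := fun i p => f i p.2 - f i p.1 with hg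
  have hgm : ∀ i, Measurable (g i) := fun i =>
    ((hf i).comp measurable_snd).sub ((hf i).comp measurable_fst)
  have hgB : ∀ i p, |g i p| ≤ 2 * B := fun i p =>
    (abs_sub _ _).trans (by linarith [hB i p.1, hB i p.2])
  have hGint : ∀ ε : Fin n → ℤˣ, Integrable
      (fun w : Fin n → Z × Z => ⨆ i, signSum ε fun j => g i (w j)) QQ := fun ε =>
    integrable_of_measurable_of_abs_le (measurable_iSup_signSum hgm ε) (B := n * (2 * B))
      fun w => abs_iSup_le fun i => signSum_le ε fun j => hgB i _
  -- the desymmetrized process is dominated by the difference of two samples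
  have h_desymm : ∫ z, (⨆ i, empiricalProcess P n (f i) z) ∂Q
      ≤ (n : ℝ)⁻¹ * ∫ w, (⨆ i, signSum 1 fun j => g i (w j)) ∂QQ := by
    have hmp := measurePreserving_arrowProdEquivProdArrow Z Z (Fin n) (fun _ => P) (fun _ => P)
    set G : (Fin n → Z) × (Fin n → Z) → ℝ := fun p => ⨆ i, signSum 1 fun j => g i (p.1 j, p.2 j)
      with hG
    have hGm : Measurable G := by
      refine Measurable.iSup fun i => ?_
      unfold signSum
      refine Finset.measurable_sum _ fun j _ => Measurable.const_mul ?_ _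
      exact (hgm i).comp (((measurable_pi_apply j).comp measurable_fst).prodMk
        ((measurable_pi_apply j).comp measurable_snd))
    have hGB : ∀ p, |G p| ≤ n * (2 * B) := fun p =>
      abs_iSup_le fun i => signSum_le 1 fun j => hgB i _
    have hGi : Integrable G (Q.prod Q) := integrable_of_measurable_of_abs_le hGm hGB
    have h1 : ∫ w, (⨆ i, signSum 1 fun j => g i (w j)) ∂QQ = ∫ p, G p ∂(Q.prod Q) := by
      rw [← hmp.integral_comp (MeasurableEquiv.measurableEmbedding _)]
      rfl
    rw [h1, integral_prod _ hGi, ← integral_const_mul]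
    refine integral_mono ?_ ?_ fun z => ?_
    · exact integrable_of_measurable_of_abs_le
        (Measurable.iSup fun i => measurable_empiricalProcess P (hf i)) (B := 2 * B)
        fun z => abs_iSup_le fun i => abs_empiricalProcess_le P hn (hB i) z
    · exact hGi.integral_prod_left.const_mul _
    · refine ciSup_le fun i => ?_
      have hint : ∀ j, Integrable (fun z' : Fin n → Z => f i (z' j)) Q := fun j =>
        integrable_of_measurable_of_abs_le ((hf i).comp (measurable_pi_apply j)) fun z' => hB i _
      have hj : ∀ j, ∫ z' : Fin n → Z, f i (z' j) ∂Q = ∫ w, f i w ∂P := fun j => by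
        have h2 := measurePreserving_eval (fun _ : Fin n => P) j
        rw [← h2.map_eq, integral_map h2.measurable.aemeasurable
          (hf i).aestronglyMeasurable]
      have h3 : empiricalProcess P n (f i) z
          = (n : ℝ)⁻¹ * ∫ z', (signSum 1 fun j => g i (z j, z' j)) ∂Q := by
        simp only [signSum, hg, Pi.one_apply, Units.val_one, Int.cast_one, one_mul]
        rw [integral_finsetSum (f := fun j (z' : Fin n → Z) => f i (z' j) - f i (z j)) _
          fun j _ => (hint j).sub (integrable_const _)]
        simp only [integral_sub (hint _) (integrable_const _), hj, integral_const, probReal_univ,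
          one_smul, Finset.sum_sub_distrib, Finset.sum_const, Finset.card_univ, Fintype.card_fin,
          empiricalProcess, nsmul_eq_mul]
        field_simp
      rw [h3]
      refine mul_le_mul_of_nonneg_left (integral_mono ?_ ?_ fun z' => ?_) (by positivity)
      · refine integrable_of_measurable_of_abs_le ?_ (B := n * (2 * B))
          fun z' => signSum_le 1 fun j => hgB i _
        unfold signSum
        exact Finset.measurable_sum _ fun j _ => Measurable.const_mul
          ((hgm i).comp (measurable_const.prodMk (measurable_pi_apply j))) _
      · exact integrable_of_measurable_of_abs_le (hGm.comp measurable_prodMk_left)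
          fun z' => hGB (z, z')
      · exact le_ciSup (f := fun i => signSum 1 fun j => g i (z j, z' j))
          (bddAbove_range_signSum 1 (B := 2 * B) fun i j => hgB i _) i
  -- signs may be inserted
  have h_signs : ∀ ε : Fin n → ℤˣ, ∫ w, (⨆ i, signSum ε fun j => g i (w j)) ∂QQ
      = ∫ w, (⨆ i, signSum 1 fun j => g i (w j)) ∂QQ := by
    intro ε
    -- Exchanging the two points of the pair `j` preserves the law and changes the sign of the
    -- `j`-th difference.
    have hmp : MeasurePreserving (fun (w : Fin n → Z × Z) j => if ε j = 1 then w j else (w j).swap)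
        QQ QQ := by
      refine measurePreserving_pi (fun _ : Fin n => P.prod P) (fun _ => P.prod P)
        (f := fun j p => if ε j = 1 then p else p.swap) fun j => ?_
      by_cases h : ε j = 1
      · simp only [h, if_true]
        exact MeasurePreserving.id _
      · simp only [h, if_false]
        exact Measure.measurePreserving_swap
    have h1 : ∫ w, (⨆ i, signSum 1 fun j => g i (w j)) ∂QQ
        = ∫ w : Fin n → Z × Z, (⨆ i, signSum 1 fun j =>
            g i (if ε j = 1 then w j else (w j).swap)) ∂QQ := by
      conv_lhs => rw [← hmp.map_eq]
      rw [integral_map hmp.measurable.aemeasurable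
        (measurable_iSup_signSum hgm 1).aestronglyMeasurable]
    rw [h1]
    congr 1
    funext w
    congr 1
    funext i
    refine Finset.sum_congr rfl fun j _ => ?_
    rcases Int.units_eq_one_or (ε j) with h | h <;> simp [h, hg]
  have hmp1 : MeasurePreserving (fun (w : Fin n → Z × Z) j => (w j).1) QQ Q :=
    measurePreserving_pi (fun _ : Fin n => P.prod P) (fun _ => P) (f := fun _ p => p.1)
      fun j => measurePreserving_fst
  have hmp2 : MeasurePreserving (fun (w : Fin n → Z × Z) j => (w j).2) QQ Q :=
    measurePreserving_pi (fun _ : Fin n => P.prod P) (fun _ => P) (f := fun _ p => p.2)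
      fun j => measurePreserving_snd
  set Rd : (Fin n → Z) → ℝ := fun z => rademacherAverage fun i j => f i (z j) with hRd
  have hRdm : Measurable Rd := measurable_rademacherAverage hf
  have hRdi : Integrable Rd Q := integrable_rademacherAverage hf hB P
  have h_average : ∫ w, (⨆ i, signSum 1 fun j => g i (w j)) ∂QQ ≤ 2 * ∫ z, Rd z ∂Q := by
    calc ∫ w, (⨆ i, signSum 1 fun j => g i (w j)) ∂QQ
        = signAverage fun ε : Fin n → ℤˣ => ∫ w, (⨆ i, signSum ε fun j => g i (w j)) ∂QQ := by
          simp only [h_signs, signAverage_const]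
      _ = ∫ w, signAverage (fun ε => ⨆ i, signSum ε fun j => g i (w j)) ∂QQ :=
          (integral_signAverage hGint).symm
      _ ≤ ∫ w, (Rd (fun j => (w j).2) + Rd fun j => (w j).1) ∂QQ := by
          refine integral_mono ?_ ?_ fun w => ?_
          · exact integrable_rademacherAverage (ι := ι) hgm hgB (P.prod P)
          · exact (hmp2.integrable_comp hRdi.aestronglyMeasurable |>.2 hRdi).add
              (hmp1.integrable_comp hRdi.aestronglyMeasurable |>.2 hRdi)
          -- The first sample enters with reversed signs, which does not change its Rademacher
          -- average.
          · have h1 : Rd (fun j => (w j).1)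
                = signAverage fun ε => ⨆ i, signSum ((-1) * ε) fun j => f i (w j).1 :=
              (signAverage_mul_left (-1) _).symm
            rw [h1]
            simp only [hRd, rademacherAverage]
            rw [← signAverage_add]
            refine signAverage_mono fun ε => ciSup_le fun i => ?_
            have h2 : (signSum ε fun j => g i (w j))
                = (signSum ε fun j => f i (w j).2) + signSum ((-1) * ε) fun j => f i (w j).1 := by
              simp only [signSum, hg]
              rw [← Finset.sum_add_distrib]
              refine Finset.sum_congr rfl fun j _ => ?_
              simp
              ring
            rw [h2]
            exact add_le_add
              (le_ciSup (bddAbove_range_signSum ε (B := B) fun i j => hB i (w j).2) i)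
              (le_ciSup (bddAbove_range_signSum ((-1) * ε) (B := B) fun i j => hB i (w j).1) i)
      _ = 2 * ∫ z, Rd z ∂Q := by
          rw [integral_add (f := fun w : Fin n → Z × Z => Rd fun j => (w j).2)
            (g := fun w : Fin n → Z × Z => Rd fun j => (w j).1)
            (hmp2.integrable_comp hRdi.aestronglyMeasurable |>.2 hRdi)
            (hmp1.integrable_comp hRdi.aestronglyMeasurable |>.2 hRdi)]
          have e1 : ∫ w : Fin n → Z × Z, Rd (fun j => (w j).1) ∂QQ = ∫ z, Rd z ∂Q := by
            conv_rhs => rw [← hmp1.map_eq]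
            rw [integral_map hmp1.measurable.aemeasurable hRdm.aestronglyMeasurable]
          have e2 : ∫ w : Fin n → Z × Z, Rd (fun j => (w j).2) ∂QQ = ∫ z, Rd z ∂Q := by
            conv_rhs => rw [← hmp2.map_eq]
            rw [integral_map hmp2.measurable.aemeasurable hRdm.aestronglyMeasurable]
          rw [e1, e2]
          ring
  calc _ ≤ _ := h_desymm
    _ ≤ (n : ℝ)⁻¹ * (2 * ∫ z, Rd z ∂Q) := by gcongr
    _ = _ := by ring

end Symmetrization

/-! ### The entropy integral bound -/

/-- A dyadic Riemann sum of a nonincreasing function is at most twice its integral. -/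
theorem sum_dyadic_le_integral {q : ℝ → ℝ} (hq : AntitoneOn q (Ioi 0)) (hq0 : ∀ x, 0 < x → 0 ≤ q x)
    (hint : ∀ x, 0 < x → IntervalIntegrable q volume 0 x) (K : ℕ) {x : ℝ} (hx : 0 < x) :
    ∑ k ∈ Finset.range K, x / 2 ^ k * q (x / 2 ^ k) ≤ 2 * ∫ t in (0 : ℝ)..x, q t := by
  induction K generalizing x with
  | zero =>
    simp only [Finset.range_zero, Finset.sum_empty]
    have : 0 ≤ ∫ t in (0 : ℝ)..x, q t := by
      refine intervalIntegral.integral_nonneg_of_ae_restrict hx.le ?_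
      have h1 : ∀ᵐ t ∂(volume.restrict (Icc 0 x)), t ≠ 0 :=
        ae_restrict_of_ae (by simp [ae_iff])
      filter_upwards [h1, ae_restrict_mem measurableSet_Icc] with t ht ht2
      exact hq0 t (lt_of_le_of_ne ht2.1 (Ne.symm ht))
    positivity
  | succ K ih =>
    have h2 : 0 < x / 2 := by positivity
    -- The leading term is compared with twice the integral over `[x / 2, x]`; the other terms are
    -- the same sum started at `x / 2`.
    have hi1 := hint (x / 2) h2
    have hi2 : IntervalIntegrable q volume (x / 2) x := hi1.symm.trans (hint x hx)
    have h3 : x / 2 * q x ≤ ∫ t in (x / 2)..x, q t := by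
      have h4 : ∫ _t in (x / 2)..x, q x = x / 2 * q x := by
        rw [intervalIntegral.integral_const, smul_eq_mul]
        ring
      rw [← h4]
      refine intervalIntegral.integral_mono_on (by linarith) (by simp) hi2 fun t ht => ?_
      exact hq (mem_Ioi.2 (h2.trans_le ht.1)) (mem_Ioi.2 hx) ht.2
    rw [Finset.sum_range_succ', ← intervalIntegral.integral_add_adjacent_intervals hi1 hi2]
    have h5 := ih h2
    have h6 : ∀ k : ℕ, x / 2 ^ (k + 1) = x / 2 / 2 ^ k := fun k => by rw [pow_succ']; field_simp
    simp only [h6, pow_zero, div_one]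
    linarith

section EntropyBound

variable {Z : Type*} [MeasurableSpace Z]

/-- Dudley's bound for the expected Rademacher average of a class that is covered in the supremum
norm, with the radius of the class measured in mean square. -/
theorem integral_rademacherAverage_le_entropyIntegral (P : Measure Z) [IsProbabilityMeasure P]
    {ι : Type*} [Nonempty ι] [Countable ι] {n : ℕ} (hn : 0 < n) {f : ι → Z → ℝ}
    (hf : ∀ i, Measurable (f i)) {B : ℝ} (hB : ∀ i z, |f i z| ≤ B)
    {V : ℝ → ℝ} (hV : AntitoneOn V (Ioi 0))
    (hcov : ∀ ε, 0 < ε → ∃ C : Finset (Z → ℝ), Real.log C.card ≤ V ε ∧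
      ∀ i, ∃ c ∈ C, ∀ z, |f i z - c z| ≤ ε)
    (hint : ∀ x, 0 < x → IntervalIntegrable (fun ε => √(V ε)) volume 0 x)
    {s : ℝ} (hs : 0 < s)
    (hrad : ∫ z, (⨆ i, (n : ℝ)⁻¹ * ∑ j, f i (z j) ^ 2) ∂(Measure.pi fun _ : Fin n => P) ≤ s ^ 2) :
    ∫ z, rademacherAverage (fun i j => f i (z j)) ∂(Measure.pi fun _ : Fin n => P)
      ≤ 12 * √n * ∫ ε in (0 : ℝ)..(s / 2), √(V ε) := by
  set Q : Measure (Fin n → Z) := Measure.pi fun _ : Fin n => P with hQ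
  have hnR : (0 : ℝ) < n := by exact_mod_cast hn
  choose! C hCV hC using hcov
  have hs2 : 0 < s / 2 := by positivity
  set e : ℕ → ℝ := fun k => s / 2 / 2 ^ k with he
  have he0 : ∀ k, 0 < e k := fun k => by simp only [he]; positivity
  have hesucc : ∀ k, e k = 2 * e (k + 1) := fun k => by
    simp only [he, pow_succ]
    field_simp
  have hcard : ∀ k, 1 ≤ ((C (e k)).card : ℝ) := by
    intro k
    obtain ⟨i⟩ := ‹Nonempty ι›
    obtain ⟨c, hc, -⟩ := hC (e k) (he0 k) i
    exact_mod_cast Finset.card_pos.2 ⟨c, hc⟩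
  have hV0 : ∀ k, 0 ≤ V (e k) := fun k => (Real.log_nonneg (hcard k)).trans (hCV _ (he0 k))
  have hB2 : ∀ i z, |f i z ^ 2| ≤ B ^ 2 := fun i z => by
    rw [abs_pow]
    exact pow_le_pow_left₀ (abs_nonneg _) (hB i z) 2
  have hqB : ∀ i (z : Fin n → Z), |(n : ℝ)⁻¹ * ∑ j, f i (z j) ^ 2| ≤ B ^ 2 := by
    intro i z
    rw [abs_mul, abs_of_nonneg (by positivity : (0 : ℝ) ≤ (n : ℝ)⁻¹)]
    have h3 : |∑ j, f i (z j) ^ 2| ≤ n * B ^ 2 := by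
      calc |∑ j, f i (z j) ^ 2| ≤ ∑ j, |f i (z j) ^ 2| := Finset.abs_sum_le_sum_abs _ _
        _ ≤ ∑ _j : Fin n, B ^ 2 := Finset.sum_le_sum fun j _ => hB2 _ _
        _ = n * B ^ 2 := by simp
    calc _ ≤ (n : ℝ)⁻¹ * (n * B ^ 2) := by gcongr
      _ = B ^ 2 := by field_simp
  set q : (Fin n → Z) → ℝ := fun z => ⨆ i, (n : ℝ)⁻¹ * ∑ j, f i (z j) ^ 2 with hq
  have hqm : Measurable q := Measurable.iSup fun i => (Finset.measurable_sum _ fun j _ =>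
    ((hf i).comp (measurable_pi_apply j)).pow_const 2).const_mul _
  have hqle : ∀ z i, (n : ℝ)⁻¹ * ∑ j, f i (z j) ^ 2 ≤ q z := fun z i =>
    le_ciSup (f := fun i => (n : ℝ)⁻¹ * ∑ j, f i (z j) ^ 2)
      ⟨B ^ 2, by rintro _ ⟨i, rfl⟩; exact (abs_le.1 (hqB i z)).2⟩ i
  have hq0 : ∀ z, 0 ≤ q z := fun z => Real.iSup_nonneg fun i => by positivity
  have hqi : Integrable q Q :=
    integrable_of_measurable_of_abs_le hqm fun z => abs_iSup_le fun i => hqB i z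
  have hσi : Integrable (fun z => √(q z)) Q := by
    refine integrable_of_measurable_of_abs_le hqm.sqrt (B := √(B ^ 2)) fun z => ?_
    rw [abs_of_nonneg (Real.sqrt_nonneg _)]
    exact Real.sqrt_le_sqrt ((le_abs_self _).trans (abs_iSup_le fun i => hqB i z))
  have hσs : ∫ z, √(q z) ∂Q ≤ s := by
    -- The arithmetic-geometric mean inequality, linear in `q`, takes the place of Jensen for the
    -- square root.
    have h1 : ∀ z, √(q z) ≤ q z / (2 * s) + s / 2 := by
      intro z
      have h2 := Real.sq_sqrt (hq0 z)
      have h3 : q z / (2 * s) + s / 2 - √(q z) = (√(q z) - s) ^ 2 / (2 * s) := by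
        field_simp
        linear_combination -h2
      have h4 : 0 ≤ (√(q z) - s) ^ 2 / (2 * s) := by positivity
      linarith
    calc ∫ z, √(q z) ∂Q ≤ ∫ z, (q z / (2 * s) + s / 2) ∂Q :=
          integral_mono hσi ((hqi.div_const _).add (integrable_const _)) h1
      _ = (∫ z, q z ∂Q) / (2 * s) + s / 2 := by
          rw [integral_add (hqi.div_const _) (integrable_const _), integral_div]
          simp
      _ ≤ s ^ 2 / (2 * s) + s / 2 := by gcongr
      _ = s := by field_simp; ring
  -- The factor 6 arises as `e k + e (k + 1) = 3 e (k + 1)` times 2, because both logarithms are at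
  -- most `V (e (k + 1))`.
  set D : ℕ → ℝ := fun K => ∑ k ∈ Finset.range K, 6 * (e (k + 1) * √(V (e (k + 1)))) with hD
  have hpoint : ∀ K z, rademacherAverage (fun i j => f i (z j))
      ≤ √n * ((e 0 + √(q z)) * √(2 * V (e 0)) + D K) + n * e K := by
    intro K z
    classical
    have hσ : ∀ i, ∑ j, f i (z j) ^ 2 ≤ n * √(q z) ^ 2 := by
      intro i
      rw [Real.sq_sqrt (hq0 z)]
      have h := hqle z i
      rw [inv_mul_le_iff₀ hnR] at h
      exact h
    refine (rademacherAverage_le_chain (fun i j => f i (z j)) (Real.sqrt_nonneg _) hσ e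
      (fun k => (he0 k).le) (fun k => (C (e k)).card)
      (fun k => (C (e k)).image fun c j => c (z j))
      (fun k => by exact_mod_cast Finset.card_image_le) ?_ K).trans ?_
    · intro k i
      obtain ⟨c, hc, hci⟩ := hC (e k) (he0 k) i
      exact ⟨_, Finset.mem_image_of_mem _ hc, fun j => hci (z j)⟩
    · have he00 := he0 0
      simp only [hD]
      refine add_le_add (mul_le_mul_of_nonneg_left (add_le_add ?_
        (Finset.sum_le_sum fun k _ => ?_)) (Real.sqrt_nonneg _)) le_rfl
      · have := hCV _ (he0 0)
        gcongr
      · have hk0 := hcard k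
        have hk1 := hcard (k + 1)
        have h1 : 2 * Real.log ((C (e k)).card * (C (e (k + 1))).card) ≤ 2 ^ 2 * V (e (k + 1)) := by
          rw [Real.log_mul (zero_lt_one.trans_le hk0).ne' (zero_lt_one.trans_le hk1).ne']
          have h2 := hCV _ (he0 k)
          have h3 := hCV _ (he0 (k + 1))
          have h4 : V (e k) ≤ V (e (k + 1)) :=
            hV (he0 (k + 1)) (he0 k) (by rw [hesucc k]; linarith [he0 (k + 1)])
          linarith
        have h5 := Real.sqrt_le_sqrt h1
        rw [Real.sqrt_mul (by norm_num : (0 : ℝ) ≤ 2 ^ 2), Real.sqrt_sq (by norm_num)] at h5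
        calc _ ≤ (e k + e (k + 1)) * (2 * √(V (e (k + 1)))) := by
              have := he0 k; have := he0 (k + 1); gcongr
          _ = _ := by rw [hesucc k]; ring
  have hK : ∀ K, ∫ z, rademacherAverage (fun i j => f i (z j)) ∂Q
      ≤ 12 * √n * (∫ ε in (0 : ℝ)..(s / 2), √(V ε)) + n * e K := by
    intro K
    have hi : Integrable (fun z => √n * ((e 0 + √(q z)) * √(2 * V (e 0)) + D K) + n * e K) Q :=
      (((((integrable_const _).add hσi).mul_const _).add (integrable_const _)).const_mul _).add
        (integrable_const _)
    refine (integral_mono (integrable_rademacherAverage hf hB P) hi (hpoint K)).trans ?_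
    have h1 : ∫ z, (√n * ((e 0 + √(q z)) * √(2 * V (e 0)) + D K) + n * e K) ∂Q
        = √n * ((e 0 + ∫ z, √(q z) ∂Q) * √(2 * V (e 0)) + D K) + n * e K := by
      have h0 : ∀ z, √n * ((e 0 + √(q z)) * √(2 * V (e 0)) + D K) + n * e K
          = √n * √(2 * V (e 0)) * √(q z) + (√n * (e 0 * √(2 * V (e 0)) + D K) + n * e K) :=
        fun z => by ring
      simp only [h0]
      rw [integral_add (hσi.const_mul _) (integrable_const _), integral_const_mul, integral_const]
      simp only [probReal_univ, one_smul]
      ring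
    rw [h1]
    -- Starting at `e 0 = s / 2` bounds the first link by `3 e 0`, so it has the same form `6 e
    -- √V(e)` as the later ones and all of them make up one dyadic sum.
    have h2 : (e 0 + ∫ z, √(q z) ∂Q) * √(2 * V (e 0)) ≤ 6 * (e 0 * √(V (e 0))) := by
      have hse : s = 2 * e 0 := by simp [he]; ring
      have h3 : √(2 * V (e 0)) ≤ 2 * √(V (e 0)) := by
        rw [show (2 : ℝ) * √(V (e 0)) = √(2 ^ 2 * V (e 0)) by
          rw [Real.sqrt_mul (by norm_num), Real.sqrt_sq (by norm_num)]]
        exact Real.sqrt_le_sqrt (by linarith [hV0 0])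
      have := he0 0
      calc _ ≤ (e 0 + 2 * e 0) * (2 * √(V (e 0))) := by rw [← hse]; gcongr
        _ = _ := by ring
    have h4 : 6 * (e 0 * √(V (e 0))) + D K
        = 6 * ∑ k ∈ Finset.range (K + 1), s / 2 / 2 ^ k * √(V (s / 2 / 2 ^ k)) := by
      rw [Finset.sum_range_succ', mul_add, Finset.mul_sum]
      simp only [hD, he, pow_zero, div_one]
      ring
    have h5 := sum_dyadic_le_integral (q := fun ε => √(V ε))
      (fun x hx y hy hxy => Real.sqrt_le_sqrt (hV hx hy hxy)) (fun x _ => Real.sqrt_nonneg _)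
      hint (K + 1) hs2
    calc _ ≤ √n * (6 * (e 0 * √(V (e 0))) + D K) + n * e K := by gcongr
      _ ≤ √n * (6 * (2 * ∫ ε in (0 : ℝ)..(s / 2), √(V ε))) + n * e K := by
          rw [h4]
          gcongr
      _ = _ := by ring
  -- The error `n e K` of stopping the chain after `K` links vanishes in the limit, while the rest
  -- of the bound does not depend on `K`.
  have hlim : Filter.Tendsto (fun K : ℕ => 12 * √n * (∫ ε in (0 : ℝ)..(s / 2), √(V ε)) + n * e K)
      Filter.atTop (nhds (12 * √n * (∫ ε in (0 : ℝ)..(s / 2), √(V ε)) + n * 0)) := by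
    refine tendsto_const_nhds.add (tendsto_const_nhds.mul ?_)
    exact tendsto_const_nhds.div_atTop (tendsto_pow_atTop_atTop_of_one_lt one_lt_two)
  have := ge_of_tendsto' hlim hK
  simpa using this

/-- The local bound on the expected supremum of the empirical process for a class that is covered in
the supremum norm. -/
theorem integral_iSup_empiricalProcess_le_of_entropy (P : Measure Z) [IsProbabilityMeasure P]
    {ι : Type*} [Nonempty ι] [Countable ι] {n : ℕ} (hn : 0 < n) {f : ι → Z → ℝ}
    (hf : ∀ i, Measurable (f i)) {M R r x₀ : ℝ} (hM : 0 < M) (hR : 0 < R)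
    (hB : ∀ i z, |f i z| ≤ 2 * (M * R)) (hzero : ∃ i, ∀ z, f i z = 0)
    (hr : ∀ i, ∫ z, f i z ^ 2 ∂P ≤ r) (hr0 : 0 ≤ r)
    {V : ℝ → ℝ} (hV : AntitoneOn V (Ioi 0))
    (hcov : ∀ ε, 0 < ε → ∃ C : Finset (Z → ℝ), Real.log C.card ≤ V (ε / R) ∧
      ∀ i, ∃ c ∈ C, ∀ z, |f i z - c z| ≤ ε)
    (hint : ∀ x, 0 < x → IntervalIntegrable (fun ε => √(V ε)) volume 0 x)
    (hx₀ : 0 ≤ x₀)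
    (hξ : ∀ x, 0 < x → x₀ ≤ x → ∫ ε in (0 : ℝ)..x, √(V ε) ≤ M⁻¹ * √n * x₀ * x)
    (hrx : 50 * R * x₀ ≤ √r) :
    ∫ z, (⨆ i, empiricalProcess P n (f i) z) ∂(Measure.pi fun _ : Fin n => P)
      ≤ 50 * (x₀ / M) * √r := by
  set Q : Measure (Fin n → Z) := Measure.pi fun _ : Fin n => P with hQ
  have hnR : (0 : ℝ) < n := by exact_mod_cast hn
  have hsn : 0 < √(n : ℝ) := Real.sqrt_pos.2 hnR
  have hMR : 0 < M * R := by positivity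
  set I : ℝ := ∫ z, rademacherAverage (fun i j => f i (z j)) ∂Q with hI
  set A : ℝ := I / n with hA
  have hIA : I = n * A := by rw [hA]; field_simp
  have hA0 : 0 ≤ A := by
    refine div_nonneg (integral_nonneg fun z => signAverage_nonneg fun ε => ?_) hnR.le
    obtain ⟨i, hi⟩ := hzero
    have h1 := le_ciSup (bddAbove_range_signSum ε (a := fun i j => f i (z j)) fun i j => hB i (z j)) i
    simpa [signSum, hi] using h1
  have hmain := integral_iSup_empiricalProcess_le P hn hf hB
  rw [← hI, hIA, show 2 / (n : ℝ) * (n * A) = 2 * A by field_simp] at hmain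
  refine hmain.trans ?_
  suffices h : A ≤ 25 * (x₀ / M) * √r by linarith
  -- the mean square radius of the class
  have hf2m : ∀ i, Measurable fun z => -f i z ^ 2 := fun i => ((hf i).pow_const 2).neg
  have hf2B : ∀ i z, |-f i z ^ 2| ≤ (2 * (M * R)) ^ 2 := fun i z => by
    rw [abs_neg, abs_pow]
    exact pow_le_pow_left₀ (abs_nonneg _) (hB i z) 2
  -- The empirical second moments exceed the true ones by an empirical process of squares, which
  -- symmetrization and contraction bring back to `A`.
  have hrad : ∫ z, (⨆ i, (n : ℝ)⁻¹ * ∑ j, f i (z j) ^ 2) ∂Q ≤ r + 8 * (M * R) * A := by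
    have h1 := integral_iSup_empiricalProcess_le P hn hf2m hf2B
    have h2 : ∀ z : Fin n → Z, rademacherAverage (fun i j => -f i (z j) ^ 2)
        ≤ 4 * (M * R) * rademacherAverage (fun i j => f i (z j)) := by
      intro z
      -- The values lie in `[-2 M R, 2 M R]`, where the square is Lipschitz with constant `4 M R`.
      rw [← rademacherAverage_const_mul (by positivity)]
      refine rademacherAverage_le_of_increments (B := max ((2 * (M * R)) ^ 2)
        (4 * (M * R) * (2 * (M * R)))) (fun i j => (hf2B i _).trans (le_max_left _ _))
        (fun i j => ?_) fun i k j => ?_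
      · rw [abs_mul, abs_of_nonneg (by positivity : (0 : ℝ) ≤ 4 * (M * R))]
        exact (mul_le_mul_of_nonneg_left (hB i _) (by positivity)).trans (le_max_right _ _)
      · rw [← mul_sub, abs_mul, abs_of_nonneg (by positivity : (0 : ℝ) ≤ 4 * (M * R)),
          show -f i (z j) ^ 2 - -f k (z j) ^ 2
            = -(f i (z j) + f k (z j)) * (f i (z j) - f k (z j)) by ring, abs_mul, abs_neg]
        refine mul_le_mul_of_nonneg_right ((abs_add_le _ _).trans ?_) (abs_nonneg _)
        linarith [hB i (z j), hB k (z j)]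
    have h3 : ∫ z, rademacherAverage (fun i j => -f i (z j) ^ 2) ∂Q ≤ 4 * (M * R) * I := by
      rw [hI, ← integral_const_mul]
      exact integral_mono (integrable_rademacherAverage hf2m hf2B P)
        ((integrable_rademacherAverage hf hB P).const_mul _) h2
    have hEi : Integrable (fun z => ⨆ i, empiricalProcess P n (fun w => -f i w ^ 2) z) Q :=
      integrable_of_measurable_of_abs_le
        (Measurable.iSup fun i => measurable_empiricalProcess P (hf2m i))
        fun z => abs_iSup_le fun i => abs_empiricalProcess_le P hn (hf2B i) z
    -- `(P - Pₙ)(-f²) = Pₙ f² - P f²`: the minus sign turns the one-sided process around, to bound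
    -- empirical moments from above.
    have h4 : ∀ (i) (z : Fin n → Z), (n : ℝ)⁻¹ * ∑ j, f i (z j) ^ 2
        = ∫ w, f i w ^ 2 ∂P + empiricalProcess P n (fun w => -f i w ^ 2) z := by
      intro i z
      simp only [empiricalProcess, integral_neg, Finset.sum_neg_distrib]
      ring
    have h5 : ∀ z : Fin n → Z, (⨆ i, (n : ℝ)⁻¹ * ∑ j, f i (z j) ^ 2)
        ≤ r + ⨆ i, empiricalProcess P n (fun w => -f i w ^ 2) z := by
      intro z
      refine ciSup_le fun i => ?_
      rw [h4]
      refine add_le_add (hr i) (le_ciSup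
        (f := fun i => empiricalProcess P n (fun w => -f i w ^ 2) z) ?_ i)
      exact ⟨_, by rintro _ ⟨i, rfl⟩; exact (abs_le.1 (abs_empiricalProcess_le P hn (hf2B i) z)).2⟩
    have h6 : ∫ z, (⨆ i, (n : ℝ)⁻¹ * ∑ j, f i (z j) ^ 2) ∂Q
        ≤ ∫ z, (r + ⨆ i, empiricalProcess P n (fun w => -f i w ^ 2) z) ∂Q :=
      integral_mono_of_nonneg (Filter.Eventually.of_forall fun z =>
        Real.iSup_nonneg fun i => by positivity) ((integrable_const _).add hEi)
        (Filter.Eventually.of_forall h5)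
    rw [integral_add (integrable_const _) hEi] at h6
    simp only [integral_const, probReal_univ, one_smul] at h6
    have h7 : 2 / (n : ℝ) * ∫ z, rademacherAverage (fun i j => -f i (z j) ^ 2) ∂Q
        ≤ 2 / n * (4 * (M * R) * I) := by gcongr
    rw [hIA, show 2 / (n : ℝ) * (4 * (M * R) * (n * A)) = 8 * (M * R) * A by field_simp; ring] at h7
    linarith
  set y : ℝ := r + 8 * (M * R) * A with hy
  have hy0 : 0 ≤ y := by positivity
  rcases hy0.eq_or_lt with hy1 | hy1
  · have : A = 0 := by
      by_contra h
      have : 0 < 8 * (M * R) * A := by positivity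
      linarith
    rw [this]
    positivity
  set s : ℝ := √y with hs
  have hs0 : 0 < s := Real.sqrt_pos.2 hy1
  have hs2 : s ^ 2 = y := Real.sq_sqrt hy0
  have hchain := integral_rademacherAverage_le_entropyIntegral P hn hf hB
    (V := fun ε => V (ε / R))
    (fun a ha b hb hab => hV (div_pos ha hR) (div_pos hb hR) (by gcongr)) hcov
    (fun x hx => by
      have := (hint (x / R) (by positivity)).comp_mul_left (c := R⁻¹)
      simpa [div_eq_inv_mul, hR.ne'] using this) hs0 (hrad.trans hs2.ge)
  rw [← hI, intervalIntegral.integral_comp_div (fun ε => √(V ε)) hR.ne', zero_div, smul_eq_mul,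
    hIA] at hchain
  have hsr : √r ≤ s := Real.sqrt_le_sqrt (by rw [hy]; nlinarith)
  -- The upper limit of the rescaled entropy integral is beyond `x₀`, where `ξ` has the linear
  -- bound.
  have hx1 : x₀ ≤ s / 2 / R := by
    rw [div_div, le_div_iff₀ (by positivity)]
    nlinarith [mul_nonneg hR.le hx₀]
  have hξs := hξ (s / 2 / R) (by positivity) hx1
  have hAs : A ≤ 6 * (x₀ / M) * s := by
    have h1 : n * A ≤ 12 * √n * (R * (M⁻¹ * √n * x₀ * (s / 2 / R))) :=
      hchain.trans (by gcongr)
    have h2 : 12 * √(n : ℝ) * (R * (M⁻¹ * √n * x₀ * (s / 2 / R))) = n * (6 * (x₀ / M) * s) := by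
      calc _ = (√(n : ℝ) * √n) * (6 * (x₀ / M) * s) := by field_simp; ring
        _ = _ := by rw [Real.mul_self_sqrt hnR.le]
    rw [h2] at h1
    exact le_of_mul_le_mul_left h1 hnR
  set p : ℝ := x₀ / M with hp
  set t : ℝ := √r with ht
  have hp0 : 0 ≤ p := by positivity
  have ht0 : 0 ≤ t := Real.sqrt_nonneg _
  have ht2 : t ^ 2 = r := Real.sq_sqrt hr0
  have hMp : 50 * (M * R * p) ≤ t := by
    refine le_trans (le_of_eq ?_) hrx
    rw [hp]
    field_simp
  -- If `A > 25 p t`, the two terms of `36 p² (t² + 8 M R A)` are at most `36 / 625 · A²` and `288 /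
  -- 1250 · A²`, the second by `50 M R p ≤ t`; their sum is less than `A²`.
  by_contra! hcon
  have hpt : 0 ≤ p * t := by positivity
  have h1 : A ^ 2 ≤ 36 * p ^ 2 * (t ^ 2 + 8 * (M * R) * A) := by
    calc A ^ 2 ≤ (6 * p * s) ^ 2 := pow_le_pow_left₀ hA0 hAs 2
      _ = 36 * p ^ 2 * s ^ 2 := by ring
      _ = _ := by rw [hs2, hy, ht2]
  have h2 : p * A * (50 * (M * R * p)) ≤ p * A * t := by gcongr
  have h3 : 0 < A := by linarith
  have h4 : (25 * (p * t)) * A ≤ A * A := by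
    refine mul_le_mul_of_nonneg_right ?_ hA0
    linarith
  have h5 : (25 * (p * t)) * (25 * (p * t)) ≤ A * A :=
    mul_le_mul (by linarith) (by linarith) (by positivity) hA0
  nlinarith [mul_pos h3 h3]

end EntropyBound

/-! ### Supremum norm covers of the unit ball of an RKHS -/

section Entropy

variable {X : Type*} [TopologicalSpace X] {H : Type*} [NormedAddCommGroup H]
  [InnerProductSpace ℝ H] [RKHS ℝ H X ℝ]

theorem externalCoveringNumber_ne_top_of_hasCompactInclusion (hH : HasCompactInclusion H) {ε : ℝ}
    (hε : 0 < ε) : Metric.externalCoveringNumber ε.toNNReal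
      {f : X →ᵇ ℝ | ∃ h : H, ‖h‖ ≤ 1 ∧ ⇑h = ⇑f} ≠ ⊤ := by
  obtain ⟨T, hT, hTh⟩ := hH
  have hc : IsCompact (closure (T '' Metric.closedBall 0 1)) :=
    hT.isCompact_closure_image_closedBall 1
  obtain ⟨C, -, hCfin, hC⟩ := Metric.exists_finite_isCover_of_isCompact_closure
    (ε := ε.toNNReal) (by simpa using hε) hc
  have hsub : {f : X →ᵇ ℝ | ∃ h : H, ‖h‖ ≤ 1 ∧ ⇑h = ⇑f} ⊆ T '' Metric.closedBall 0 1 := by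
    rintro f ⟨h, hh, hf⟩
    refine ⟨h, by simpa using hh, ?_⟩
    ext x
    rw [hTh, hf]
  have h1 := (Metric.externalCoveringNumber_mono_set (ε := ε.toNNReal) hsub).trans
    hC.externalCoveringNumber_le_encard
  exact ne_top_of_le_ne_top (by simpa using hCfin) h1

/-- The covering number of the unit ball is attained. -/
theorem exists_cover_card_eq (hH : HasCompactInclusion H) {ε : ℝ} (hε : 0 < ε) :
    ∃ C : Finset (X →ᵇ ℝ), Real.log C.card = supEntropy H ε ∧ C.Nonempty ∧
      ∀ h : H, ‖h‖ ≤ 1 → ∃ c ∈ C, ∀ x, |h x - c x| ≤ ε := by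
  have htop := externalCoveringNumber_ne_top_of_hasCompactInclusion hH hε
  set U : Set (X →ᵇ ℝ) := {f | ∃ h : H, ‖h‖ ≤ 1 ∧ ⇑h = ⇑f} with hU
  obtain ⟨C, hCcov, hCcard⟩ : ∃ C : Set (X →ᵇ ℝ), Metric.IsCover ε.toNNReal U C ∧
      C.encard = Metric.externalCoveringNumber ε.toNNReal U := by
    have : Nonempty {C : Set (X →ᵇ ℝ) // Metric.IsCover ε.toNNReal U C} := ⟨⟨U, .rfl⟩⟩
    obtain ⟨C, hC⟩ := ENat.exists_eq_iInf
      (fun C : {C : Set (X →ᵇ ℝ) // Metric.IsCover ε.toNNReal U C} => (C : Set (X →ᵇ ℝ)).encard)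
    exact ⟨C, C.2, by rw [hC, Metric.externalCoveringNumber, iInf_subtype]⟩
  have hfin : C.Finite := by
    rw [← Set.encard_ne_top_iff, hCcard]
    exact htop
  obtain ⟨T, hT, hTh⟩ := id hH
  have hcov : ∀ h : H, ‖h‖ ≤ 1 → ∃ c ∈ C, ∀ x, |h x - c x| ≤ ε := by
    intro h hh
    obtain ⟨c, hcC, hc⟩ := hCcov (show T h ∈ U from ⟨h, hh, (hTh h).symm⟩)
    refine ⟨c, hcC, fun x => ?_⟩
    have h1 : edist (T h) c ≤ ε.toNNReal := hc
    have h2 : dist (T h) c ≤ ε := by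
      rw [edist_dist] at h1
      have := (ENNReal.ofReal_le_ofReal_iff hε.le).1 (h1.trans_eq rfl)
      exact this
    have h3 := (BoundedContinuousFunction.dist_coe_le_dist x).trans h2
    rwa [Real.dist_eq, hTh] at h3
  refine ⟨hfin.toFinset, ?_, ?_, ?_⟩
  · rw [supEntropy, ← hCcard, hfin.encard_eq_coe_toFinset_card]
    simp
  · obtain ⟨c, hc, -⟩ := hcov 0 (by simp)
    exact ⟨c, by simpa using hc⟩
  · simpa using hcov

theorem supEntropy_antitoneOn (hH : HasCompactInclusion H) :
    AntitoneOn (supEntropy H) (Ioi 0) := by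
  intro ε hε δ hδ h
  obtain ⟨C, hC, hne, -⟩ := exists_cover_card_eq hH hδ
  have h1 := ENat.toNat_le_toNat (Metric.externalCoveringNumber_anti
    (A := {f : X →ᵇ ℝ | ∃ h : H, ‖h‖ ≤ 1 ∧ ⇑h = ⇑f}) (Real.toNNReal_le_toNNReal h))
    (externalCoveringNumber_ne_top_of_hasCompactInclusion hH hε)
  unfold supEntropy
  -- A covering number 0 needs no exclusion: `Real.log 0 = 0`, and the logarithm of a natural number
  -- is nonnegative.
  rcases Nat.eq_zero_or_pos (Metric.externalCoveringNumber δ.toNNReal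
    {f : X →ᵇ ℝ | ∃ h : H, ‖h‖ ≤ 1 ∧ ⇑h = ⇑f}).toNat with h2 | h2
  · rw [h2]
    simpa using Real.log_natCast_nonneg _
  · exact Real.log_le_log (by exact_mod_cast h2) (by exact_mod_cast h1)

/-- Concavity of the entropy integral, in the form `y ξ(x) ≥ x ξ(y)` for `x ≤ y`. -/
theorem mul_integral_le_of_antitoneOn {q : ℝ → ℝ} (hq : AntitoneOn q (Ioi 0))
    (hint : ∀ x, 0 < x → IntervalIntegrable q volume 0 x) {x y : ℝ} (hx : 0 < x) (hxy : x ≤ y) :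
    x * ∫ t in (0 : ℝ)..y, q t ≤ y * ∫ t in (0 : ℝ)..x, q t := by
  have hi2 : IntervalIntegrable q volume x y := (hint x hx).symm.trans (hint y (hx.trans_le hxy))
  -- The mean of `q` over `[x, y]` is at most `q x`, which is at most its mean over `[0, x]`.
  have h1 : ∫ t in x..y, q t ≤ (y - x) * q x := by
    have h4 : ∫ _t in x..y, q x = (y - x) * q x := by
      rw [intervalIntegral.integral_const, smul_eq_mul]
    rw [← h4]
    exact intervalIntegral.integral_mono_on hxy hi2 (by simp) fun t ht =>
      hq (mem_Ioi.2 hx) (mem_Ioi.2 (hx.trans_le ht.1)) ht.1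
  have h2 : x * q x ≤ ∫ t in (0 : ℝ)..x, q t := by
    have h4 : ∫ _t in (0 : ℝ)..x, q x = x * q x := by
      rw [intervalIntegral.integral_const, smul_eq_mul, sub_zero]
    rw [← h4]
    exact intervalIntegral.integral_mono_on_of_le_Ioo hx.le (by simp) (hint x hx) fun t ht =>
      hq (mem_Ioi.2 ht.1) (mem_Ioi.2 hx) ht.2.le
  rw [← intervalIntegral.integral_add_adjacent_intervals (hint x hx) hi2]
  nlinarith [sub_nonneg.2 hxy]

/-- Beyond the greatest solution `x₀` of `ξ(x) = c x²`, the concave function `ξ` is at most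
`c x₀ x`. -/
theorem integral_le_of_isGreatest {q : ℝ → ℝ} (hq : AntitoneOn q (Ioi 0))
    (hint : ∀ x, 0 < x → IntervalIntegrable q volume 0 x) {c x₀ : ℝ} (hc : 0 < c)
    (hx₀ : IsGreatest {x : ℝ | 0 ≤ x ∧ ∫ t in (0 : ℝ)..x, q t = c * x ^ 2} x₀)
    {x : ℝ} (hx : 0 < x) (hxx : x₀ ≤ x) : ∫ t in (0 : ℝ)..x, q t ≤ c * x₀ * x := by
  rcases hx₀.1.1.eq_or_lt with h0 | h0
  · rw [← h0, mul_zero, zero_mul]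
    -- If `ξ` is positive at `x`, concavity puts it above `c u²` at the small point `a` and below it
    -- at the large point `b`. A crossing in between would be a positive solution, against `x₀ = 0`.
    by_contra! hpos
    set F : ℝ → ℝ := fun x => ∫ t in (0 : ℝ)..x, q t with hF
    change 0 < F x at hpos
    have hcont : ContinuousOn F (Ioi 0) := by
      intro u hu
      have hu' : (0 : ℝ) < u := hu
      have h1 := intervalIntegral.continuousOn_primitive_interval
        (μ := volume) (f := q) (a := 0) (b := 2 * u)
        ((hint (2 * u) (by positivity)).1.mono_set_ae (by
          rw [uIcc_of_le (by positivity)]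
          exact (Ioc_ae_eq_Icc (μ := volume)).symm.le))
      refine (h1.continuousAt ?_).continuousWithinAt
      rw [uIcc_of_le (by positivity)]
      exact Icc_mem_nhds hu' (by linarith)
    -- below and above the positive solution
    set a : ℝ := min x (F x / (2 * c * x)) with ha
    set b : ℝ := max x (2 * F x / (c * x)) with hb
    have ha0 : 0 < a := lt_min hx (by positivity)
    have hax : a ≤ x := min_le_left _ _
    have hxb : x ≤ b := le_max_left _ _
    have h1 : c * a ^ 2 ≤ F a := by
      have h2 := mul_integral_le_of_antitoneOn hq hint ha0 hax
      change a * F x ≤ x * F a at h2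
      have h3 : a ≤ F x / (2 * c * x) := min_le_right _ _
      rw [le_div_iff₀ (by positivity)] at h3
      have h4 : x * (c * a ^ 2) ≤ x * F a := by nlinarith
      exact le_of_mul_le_mul_left h4 hx
    have h5 : F b ≤ c * b ^ 2 := by
      have h2 := mul_integral_le_of_antitoneOn hq hint hx hxb
      change x * F b ≤ b * F x at h2
      have h3 : 2 * F x / (c * x) ≤ b := le_max_right _ _
      rw [div_le_iff₀ (by positivity)] at h3
      have hb0 : 0 < b := hx.trans_le hxb
      have h4 : x * F b ≤ x * (c * b ^ 2) := by nlinarith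
      exact le_of_mul_le_mul_left h4 hx
    have hIVT : (0 : ℝ) ∈ (fun u => c * u ^ 2 - F u) '' Icc a b := by
      refine intermediate_value_Icc (hax.trans hxb) ?_ ⟨by simpa using h1, by simpa using h5⟩
      exact (by fun_prop : ContinuousOn (fun u : ℝ => c * u ^ 2) (Icc a b)).sub
        (hcont.mono fun u hu => ha0.trans_le hu.1)
    obtain ⟨u, hu, hu0⟩ := hIVT
    have h6 := hx₀.2 ⟨ha0.le.trans hu.1, (sub_eq_zero.1 hu0).symm⟩
    linarith [ha0.trans_le hu.1]
  · have h1 := mul_integral_le_of_antitoneOn hq hint h0 hxx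
    rw [hx₀.1.2] at h1
    have h2 : x₀ * ∫ t in (0 : ℝ)..x, q t ≤ x₀ * (c * x₀ * x) := by linarith
    exact le_of_mul_le_mul_left h2 h0

end Entropy

/-! ### The `L²` pseudo-distance -/

section L2Dist

variable {Ω : Type*} [MeasurableSpace Ω] {μ : Measure Ω}

/-- The `L²(μ)` pseudo-distance of two functions. -/
def l2Dist (μ : Measure Ω) (f g : Ω → ℝ) : ℝ := (eLpNorm (f - g) 2 μ).toReal

theorem l2Dist_sq {f g : Ω → ℝ} (hf : MemLp f 2 μ) (hg : MemLp g 2 μ) :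
    l2Dist μ f g ^ 2 = ∫ x, (f x - g x) ^ 2 ∂μ := by
  have h := hf.sub hg
  rw [l2Dist, h.eLpNorm_eq_integral_rpow_norm (by norm_num) (by norm_num),
    ENNReal.toReal_ofReal (by positivity)]
  have h1 : 0 ≤ ∫ x, (f x - g x) ^ 2 ∂μ := integral_nonneg fun x => sq_nonneg _
  simp only [ENNReal.toReal_ofNat, Real.rpow_ofNat, Real.norm_eq_abs, sq_abs, Pi.sub_apply]
  rw [← Real.rpow_natCast, ← Real.rpow_mul h1]
  norm_num

theorem isPseudoDistanceOn_l2Dist {F : Type*} {𝔊 : Set F} {ℓ : F → Ω → ℝ}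
    (h : ∀ g ∈ 𝔊, MemLp (ℓ g) 2 μ) :
    IsPseudoDistanceOn (fun g g' => l2Dist μ (ℓ g) (ℓ g')) 𝔊 where
  nonneg _ _ _ _ := ENNReal.toReal_nonneg
  self _ _ := by simp [l2Dist]
  symm g _ g' _ := by
    simp only [l2Dist]
    rw [← eLpNorm_neg, neg_sub]
  triangle g hg g' hg' g'' hg'' := by
    simp only [l2Dist]
    rw [← ENNReal.toReal_add ((h g hg).sub (h g' hg')).eLpNorm_ne_top
      ((h g' hg').sub (h g'' hg'')).eLpNorm_ne_top]
    refine ENNReal.toReal_mono (ENNReal.add_ne_top.2 ⟨((h g hg).sub (h g' hg')).eLpNorm_ne_top,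
      ((h g' hg').sub (h g'' hg'')).eLpNorm_ne_top⟩) ?_
    rw [show ℓ g - ℓ g'' = (ℓ g - ℓ g') + (ℓ g' - ℓ g'') by abel]
    exact eLpNorm_add_le ((h g hg).sub (h g' hg')).1 ((h g' hg').sub (h g'' hg'')).1 (by norm_num)

end L2Dist

/-! ### The hinge loss -/

section Hinge

variable {X : Type*}

theorem Label.eq_or_eq (y : Label) : (y : ℝ) = -1 ∨ (y : ℝ) = 1 := by
  rcases y.2 with h | h
  · exact Or.inl h
  · exact Or.inr h

theorem Label.abs_coe (y : Label) : |(y : ℝ)| = 1 := by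
  rcases y.eq_or_eq with h | h <;> simp [h]

theorem hingeLoss_nonneg (g : X → ℝ) (z : X × Label) : 0 ≤ hingeLoss g z := le_max_right _ _

theorem hingeLoss_le (g : X → ℝ) (z : X × Label) : hingeLoss g z ≤ 1 + |g z.1| := by
  refine max_le ?_ (by positivity)
  have h1 := neg_abs_le ((z.2 : ℝ) * g z.1)
  rw [abs_mul, Label.abs_coe, one_mul] at h1
  linarith

theorem abs_hingeLoss_sub_le (g g' : X → ℝ) (z : X × Label) :
    |hingeLoss g z - hingeLoss g' z| ≤ |g z.1 - g' z.1| := by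
  refine (abs_max_sub_max_le_abs _ _ _).trans (le_of_eq ?_)
  rw [show 1 - (z.2 : ℝ) * g z.1 - (1 - (z.2 : ℝ) * g' z.1) = -((z.2 : ℝ) * (g z.1 - g' z.1)) by ring,
    abs_neg, abs_mul, Label.abs_coe, one_mul]

/-- The excess hinge risk at a point where the label `1` has probability `p` and the prediction is
`t`, relative to the prediction `s`. -/
def excessRisk (p t s : ℝ) : ℝ :=
  (p * max (1 - t) 0 + (1 - p) * max (1 + t) 0) - (p * max (1 - s) 0 + (1 - p) * max (1 + s) 0)

/-- Exchanging the labels and negating the predictions changes nothing. This reduces all pointwise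
inequalities to the Bayes prediction `1`. -/
theorem excessRisk_neg (p t s : ℝ) : excessRisk (1 - p) (-t) (-s) = excessRisk p t s := by
  simp only [excessRisk, sub_neg_eq_add, ← sub_eq_add_neg, sub_sub_cancel]
  ring

theorem excessRisk_one (p t : ℝ) :
    excessRisk p t 1 = p * max (1 - t) 0 + (1 - p) * max (1 + t) 0 - (1 - p) * 2 := by
  simp only [excessRisk]
  norm_num

/-- One of the three linear pieces: the slopes change at `t = -1` and `t = 1`, and the margin
inequalities are proved piece by piece. -/
theorem excessRisk_one_of_abs_le {p t : ℝ} (h1 : -1 ≤ t) (h2 : t ≤ 1) :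
    excessRisk p t 1 = (2 * p - 1) * (1 - t) := by
  rw [excessRisk_one, max_eq_left (by linarith), max_eq_left (by linarith)]
  ring

theorem excessRisk_one_of_one_le {p t : ℝ} (h : 1 ≤ t) :
    excessRisk p t 1 = (1 - p) * (t - 1) := by
  rw [excessRisk_one, max_eq_right (by linarith), max_eq_left (by linarith)]
  ring

theorem excessRisk_one_of_le_neg_one {p t : ℝ} (h : t ≤ -1) :
    excessRisk p t 1 = p * (3 - t) - 2 := by
  rw [excessRisk_one, max_eq_left (by linarith), max_eq_right (by linarith)]
  ring

theorem excessRisk_one_nonneg {p t : ℝ} (hp : 1 / 2 ≤ p) (hp1 : p ≤ 1) : 0 ≤ excessRisk p t 1 := by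
  rcases le_total t (-1) with h | h
  · rw [excessRisk_one_of_le_neg_one h]
    nlinarith
  rcases le_total t 1 with h' | h'
  · rw [excessRisk_one_of_abs_le h h']
    exact mul_nonneg (by linarith) (by linarith)
  · rw [excessRisk_one_of_one_le h']
    exact mul_nonneg (by linarith) (by linarith)

/-- The margin inequality for the squared distance of the predictions. -/
theorem sq_sub_one_le_excessRisk {p t B η₀ η₁ : ℝ} (hη₀ : 0 < η₀) (hη₁ : 0 < η₁)
    (hp : 1 / 2 + η₀ ≤ p) (hp1 : p ≤ 1 - η₁) (ht : |t| ≤ B) :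
    (t - 1) ^ 2 ≤ 2 * (B / η₁ + 1 / η₀) * excessRisk p t 1 := by
  have hB : 0 ≤ B := (abs_nonneg _).trans ht
  have hE := excessRisk_one_nonneg (p := p) (t := t) (by linarith) (by linarith)
  have hBE : 0 ≤ B / η₁ * excessRisk p t 1 := by positivity
  have hηE : 0 ≤ 1 / η₀ * excessRisk p t 1 := by positivity
  have hb : 1 / η₀ * η₀ = 1 := by field_simp
  have hb0 : 0 < 1 / η₀ := by positivity
  rw [abs_le] at ht
  rcases le_total t (-1) with h | h
  · have h1 : η₀ * (3 - t) + (-t - 1) / 2 ≤ excessRisk p t 1 := by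
      rw [excessRisk_one_of_le_neg_one h]
      nlinarith
    -- Here `2 η₁ ≤ 1`, as `η₁ ≤ 1 - p ≤ 1 / 2`.
    have h2 : 2 * (-t) ≤ B / η₁ := by
      rw [le_div_iff₀ hη₁]
      nlinarith
    have h3 : 3 - t ≤ 1 / η₀ * excessRisk p t 1 := by
      have := mul_le_mul_of_nonneg_left h1 hb0.le
      nlinarith
    have h4 : 2 * (-t) * ((-t - 1) / 2) ≤ B / η₁ * excessRisk p t 1 :=
      mul_le_mul h2 (by nlinarith) (by linarith) (by positivity)
    nlinarith
  rcases le_total t 1 with h' | h'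
  · have h1 : 2 * η₀ * (1 - t) ≤ excessRisk p t 1 := by
      rw [excessRisk_one_of_abs_le h h']
      nlinarith
    have h3 : 2 * (1 - t) ≤ 1 / η₀ * excessRisk p t 1 := by
      have := mul_le_mul_of_nonneg_left h1 hb0.le
      nlinarith
    nlinarith
  · have h1 : η₁ * (t - 1) ≤ excessRisk p t 1 := by
      rw [excessRisk_one_of_one_le h']
      nlinarith
    have h2 : B / η₁ * (η₁ * (t - 1)) ≤ B / η₁ * excessRisk p t 1 := by gcongr
    have h3 : B / η₁ * (η₁ * (t - 1)) = B * (t - 1) := by field_simp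
    nlinarith

/-- The margin inequality for the squared distance of the losses. -/
theorem loss_sq_le_excessRisk_one {p t B η₀ : ℝ} (hη₀ : 0 < η₀)
    (hp : 1 / 2 + η₀ ≤ p) (hp1 : p ≤ 1) (ht : |t| ≤ B) :
    p * (max (1 - t) 0 - max (1 - 1) 0) ^ 2 + (1 - p) * (max (1 + t) 0 - max (1 + 1) 0) ^ 2
      ≤ (B + 1 / η₀) * excessRisk p t 1 := by
  have hB : 0 ≤ B := (abs_nonneg _).trans ht
  have hE := excessRisk_one_nonneg (p := p) (t := t) (by linarith) hp1
  have hBE : 0 ≤ B * excessRisk p t 1 := by positivity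
  have hηE : 0 ≤ 1 / η₀ * excessRisk p t 1 := by positivity
  have hb : 1 / η₀ * η₀ = 1 := by field_simp
  have hb0 : 0 < 1 / η₀ := by positivity
  have e1 : max ((1 : ℝ) - 1) 0 = 0 := by norm_num
  have e2 : max ((1 : ℝ) + 1) 0 = 2 := by norm_num
  rw [e1, e2]
  rw [abs_le] at ht
  rcases le_total t (-1) with h | h
  · rw [max_eq_left (by linarith : (0 : ℝ) ≤ 1 - t), max_eq_right (by linarith : 1 + t ≤ 0)]
    have h1 : 2 * (t + 1) * (t + 1) ≥ 0 := by nlinarith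
    have h2 : 2 ≤ 1 / η₀ := by
      rw [le_div_iff₀ hη₀]
      linarith
    have h3 : 3 - t + (-t - 1) ≤ 1 / η₀ * excessRisk p t 1 := by
      have h4 : η₀ * (3 - t) + (-t - 1) / 2 ≤ excessRisk p t 1 := by
        rw [excessRisk_one_of_le_neg_one h]
        nlinarith
      have := mul_le_mul_of_nonneg_left h4 hb0.le
      nlinarith
    -- Adding `h3` and `h5` bounds the squared loss distance with the excess risk `p (3 - t) - 2`
    -- itself to spare.
    have h5 : (-t) * (p * (3 - t) - 2) ≤ B * excessRisk p t 1 := by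
      rw [excessRisk_one_of_le_neg_one h] at hE ⊢
      exact mul_le_mul_of_nonneg_right (by linarith) hE
    nlinarith
  rcases le_total t 1 with h' | h'
  · rw [max_eq_left (by linarith : (0 : ℝ) ≤ 1 - t), max_eq_left (by linarith : 0 ≤ 1 + t)]
    have h1 : 2 * η₀ * (1 - t) ≤ excessRisk p t 1 := by
      rw [excessRisk_one_of_abs_le h h']
      nlinarith
    have h3 : 2 * (1 - t) ≤ 1 / η₀ * excessRisk p t 1 := by
      have := mul_le_mul_of_nonneg_left h1 hb0.le
      nlinarith
    nlinarith
  · rw [max_eq_right (by linarith : 1 - t ≤ 0), max_eq_left (by linarith : 0 ≤ 1 + t)]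
    rw [excessRisk_one_of_one_le h'] at hηE ⊢
    have h4 : 0 ≤ (1 - p) * (t - 1) := mul_nonneg (by linarith) (by linarith)
    nlinarith

/-- The Bayes classifier is `1` and `η ≥ 1/2`, or it is `-1` and `η ≤ 1/2`. -/
theorem bayesClassifier_cases (η : X → ℝ) (x : X) :
    (bayesClassifier η x = 1 ∧ 1 / 2 ≤ η x) ∨ (bayesClassifier η x = -1 ∧ η x ≤ 1 / 2) := by
  unfold bayesClassifier
  split_ifs with h
  · exact Or.inl ⟨rfl, h⟩
  · exact Or.inr ⟨rfl, (not_le.1 h).le⟩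

theorem abs_bayesClassifier (η : X → ℝ) (x : X) : |bayesClassifier η x| = 1 := by
  rcases bayesClassifier_cases η x with h | h <;> simp [h.1]

theorem excessRisk_nonneg {η : X → ℝ} {x : X} (h0 : 0 ≤ η x) (h1 : η x ≤ 1) (t : ℝ) :
    0 ≤ excessRisk (η x) t (bayesClassifier η x) := by
  rcases bayesClassifier_cases η x with ⟨hs, h⟩ | ⟨hs, h⟩ <;> rw [hs]
  · exact excessRisk_one_nonneg h h1
  · rw [← excessRisk_neg, neg_neg]
    exact excessRisk_one_nonneg (by linarith) (by linarith)

theorem sq_sub_bayesClassifier_le {η : X → ℝ} {x : X} {η₀ η₁ B t : ℝ} (hη₀ : 0 < η₀) (hη₁ : 0 < η₁)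
    (hA2 : η₀ ≤ |η x - 1 / 2|) (hA3 : η₁ ≤ min (η x) (1 - η x)) (ht : |t| ≤ B) :
    (t - bayesClassifier η x) ^ 2
      ≤ 2 * (B / η₁ + 1 / η₀) * excessRisk (η x) t (bayesClassifier η x) := by
  rw [le_min_iff] at hA3
  rcases bayesClassifier_cases η x with ⟨hs, h⟩ | ⟨hs, h⟩ <;> rw [hs]
  · rw [abs_of_nonneg (by linarith)] at hA2
    exact sq_sub_one_le_excessRisk hη₀ hη₁ (by linarith) (by linarith) ht
  · rw [abs_of_nonpos (by linarith)] at hA2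
    rw [← excessRisk_neg, neg_neg]
    refine (le_of_eq ?_).trans (sq_sub_one_le_excessRisk (p := 1 - η x) (t := -t) hη₀ hη₁
      (by linarith) (by linarith) (by rwa [abs_neg]))
    ring

theorem loss_sq_le_excessRisk {η : X → ℝ} {x : X} {η₀ B t : ℝ} (hη₀ : 0 < η₀)
    (hA2 : η₀ ≤ |η x - 1 / 2|) (h0 : 0 ≤ η x) (h1 : η x ≤ 1) (ht : |t| ≤ B) :
    η x * (max (1 - t) 0 - max (1 - bayesClassifier η x) 0) ^ 2
        + (1 - η x) * (max (1 + t) 0 - max (1 + bayesClassifier η x) 0) ^ 2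
      ≤ (B + 1 / η₀) * excessRisk (η x) t (bayesClassifier η x) := by
  rcases bayesClassifier_cases η x with ⟨hs, h⟩ | ⟨hs, h⟩ <;> rw [hs]
  · rw [abs_of_nonneg (by linarith)] at hA2
    exact loss_sq_le_excessRisk_one hη₀ (by linarith) h1 ht
  · rw [abs_of_nonpos (by linarith)] at hA2
    rw [← excessRisk_neg, neg_neg]
    refine (le_of_eq ?_).trans (loss_sq_le_excessRisk_one (p := 1 - η x) (t := -t) hη₀
      (by linarith) (by linarith) (by rwa [abs_neg]))
    norm_num
    ring_nf

/-! ### Conditioning on `x`, and risks under `P` -/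

variable [MeasurableSpace X] {P : Measure (X × Label)} {η : X → ℝ}

theorem measurable_hingeLoss {g : X → ℝ} (hg : Measurable g) : Measurable (hingeLoss g) := by
  unfold hingeLoss
  exact (measurable_const.sub ((measurable_subtype_coe.comp measurable_snd).mul
    (hg.comp measurable_fst))).max measurable_const

theorem measurePreserving_fst_self (P : Measure (X × Label)) :
    MeasurePreserving Prod.fst P P.fst := ⟨measurable_fst, rfl⟩

theorem memLp_hingeLoss [IsProbabilityMeasure P] {g : X → ℝ} (hg : MemLp g 2 P.fst) :
    MemLp (hingeLoss g) 2 P := by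
  have h1 : MemLp (fun z : X × Label => g z.1) 2 P :=
    hg.comp_measurePreserving (measurePreserving_fst_self P)
  have h2 : MemLp (fun z : X × Label => (z.2 : ℝ) * g z.1) 2 P := by
    refine h1.mono ?_ (Filter.Eventually.of_forall fun z => ?_)
    · exact (measurable_subtype_coe.comp measurable_snd).aestronglyMeasurable.mul h1.1
    · rw [norm_mul, Real.norm_eq_abs, Label.abs_coe, one_mul]
  have h3 : MemLp (fun z : X × Label => 1 - (z.2 : ℝ) * g z.1) 2 P := (memLp_const (1 : ℝ)).sub h2
  exact h3.pos_part

/-- Integration of a function of `(x, y)` by conditioning on `x`. -/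
theorem IsRegressionFunction.integral_ite [IsProbabilityMeasure P] (hη : IsRegressionFunction P η)
    {u v : X → ℝ} (hu : Integrable u P.fst) (hv : Integrable v P.fst) {F : X × Label → ℝ}
    (hF1 : ∀ z, (z.2 : ℝ) = 1 → F z = u z.1) (hF2 : ∀ z, (z.2 : ℝ) = -1 → F z = v z.1) :
    ∫ z, F z ∂P = ∫ x, (η x * u x + (1 - η x) * v x) ∂P.fst := by
  set S : Set (X × Label) := {z | (z.2 : ℝ) = 1} with hS
  have hSm : MeasurableSet S :=
    (measurable_subtype_coe.comp measurable_snd) (measurableSet_singleton (1 : ℝ))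
  have hmle : MeasurableSpace.comap Prod.fst inferInstance
    ≤ (Prod.instMeasurableSpace : MeasurableSpace (X × Label)) := measurable_fst.comap_le
  have hmp := measurePreserving_fst_self P
  have key : ∀ w : X → ℝ, Integrable w P.fst →
      Integrable (fun x => η x * w x) P.fst ∧ Integrable (S.indicator fun z => w z.1) P ∧
      ∫ z, S.indicator (fun z => w z.1) z ∂P = ∫ x, η x * w x ∂P.fst := by
    intro w hw
    have hwP : Integrable (fun z : X × Label => w z.1) P := hmp.integrable_comp hw.1 |>.2 hw
    -- A function of `x` alone is measurable for the conditioning σ-algebra and can be pulled out of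
    -- the conditional expectation; `w` is replaced by a measurable version.
    have hwm : AEStronglyMeasurable[MeasurableSpace.comap Prod.fst inferInstance] (fun z : X × Label => w z.1) P := by
      refine ⟨fun z => hw.1.mk w z.1, ?_, ?_⟩
      · exact hw.1.stronglyMeasurable_mk.comp_measurable (comap_measurable _)
      · exact hmp.quasiMeasurePreserving.ae_eq_comp hw.1.ae_eq_mk
    have h1 : S.indicator (fun z : X × Label => w z.1)
        = (fun z : X × Label => w z.1) * S.indicator fun _ => (1 : ℝ) := by
      funext z
      by_cases h : z ∈ S <;> simp [h]
    have hi : Integrable (S.indicator fun z : X × Label => w z.1) P := hwP.indicator hSm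
    have h2 := condExp_mul_of_aestronglyMeasurable_left hwm (h1 ▸ hi)
      ((integrable_const (1 : ℝ)).indicator hSm)
    have h3 : P[S.indicator (fun z : X × Label => w z.1) |
        MeasurableSpace.comap Prod.fst inferInstance] =ᵐ[P] fun z => η z.1 * w z.1 := by
      rw [h1]
      filter_upwards [h2, hη.ae_eq] with z hz1 hz2
      rw [hz1, Pi.mul_apply, hz2, mul_comm]
    have h4 : Integrable (fun z : X × Label => η z.1 * w z.1) P := integrable_condExp.congr h3
    have hηw : AEStronglyMeasurable (fun x => η x * w x) P.fst :=
      hη.measurable.aestronglyMeasurable.mul hw.1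
    refine ⟨(hmp.integrable_comp hηw).1 h4, hi, ?_⟩
    rw [← integral_condExp hmle, integral_congr_ae h3]
    conv_rhs => rw [← hmp.map_eq]
    rw [integral_map hmp.measurable.aemeasurable (by rw [hmp.map_eq]; exact hηw)]
  obtain ⟨ku1, ku2, ku3⟩ := key u hu
  obtain ⟨kv1, kv2, kv3⟩ := key v hv
  have hvP : Integrable (fun z : X × Label => v z.1) P := hmp.integrable_comp hv.1 |>.2 hv
  have hFe : ∀ z, F z = S.indicator (fun z => u z.1) z
      + (v z.1 - S.indicator (fun z => v z.1) z) := by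
    intro z
    rcases z.2.eq_or_eq with h | h
    · have : z ∉ S := by simp only [hS, mem_ofPred_eq, h]; norm_num
      simp [this, hF2 z h]
    · have : z ∈ S := h
      simp [this, hF1 z h]
  have hv2 : ∫ z : X × Label, v z.1 ∂P = ∫ x, v x ∂P.fst := by
    conv_rhs => rw [← hmp.map_eq]
    rw [integral_map hmp.measurable.aemeasurable (by rw [hmp.map_eq]; exact hv.1)]
  simp only [hFe]
  rw [integral_add (g := fun z => v z.1 - S.indicator (fun z => v z.1) z) ku2 (hvP.sub kv2),
    integral_sub hvP kv2, ku3, kv3, hv2]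
  have h5 : ∀ x, η x * u x + (1 - η x) * v x = η x * u x + (v x - η x * v x) := fun x => by ring
  simp only [h5]
  rw [integral_add (g := fun x => v x - η x * v x) ku1 (hv.sub kv1), integral_sub hv kv1]

/-- `η` agrees with a conditional probability only almost everywhere. Without (A3) this is the only
source of the bounds `0 ≤ η ≤ 1`. -/
theorem IsRegressionFunction.ae_mem_Icc [IsProbabilityMeasure P] (hη : IsRegressionFunction P η) :
    ∀ᵐ x ∂P.fst, 0 ≤ η x ∧ η x ≤ 1 := by
  have hSm : MeasurableSet {z : X × Label | (z.2 : ℝ) = 1} :=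
    (measurable_subtype_coe.comp measurable_snd) (measurableSet_singleton (1 : ℝ))
  have hmle : MeasurableSpace.comap Prod.fst inferInstance
    ≤ (Prod.instMeasurableSpace : MeasurableSpace (X × Label)) := measurable_fst.comap_le
  have hi : Integrable ({z : X × Label | (z.2 : ℝ) = 1}.indicator fun _ => (1 : ℝ)) P :=
    (integrable_const (1 : ℝ)).indicator hSm
  have h0 : 0 ≤ᵐ[P] P⟦{z : X × Label | (z.2 : ℝ) = 1} | MeasurableSpace.comap Prod.fst inferInstance⟧ :=
    condExp_nonneg (Filter.Eventually.of_forall fun z => indicator_nonneg (by simp) z)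
  have h1 : P⟦{z : X × Label | (z.2 : ℝ) = 1} | MeasurableSpace.comap Prod.fst inferInstance⟧
      ≤ᵐ[P] P[fun _ => (1 : ℝ) | MeasurableSpace.comap Prod.fst inferInstance] :=
    condExp_mono hi (integrable_const _)
      (Filter.Eventually.of_forall fun z => indicator_le_self' (by simp) z)
  rw [condExp_const hmle] at h1
  have h2 : ∀ᵐ z ∂P, 0 ≤ η z.1 ∧ η z.1 ≤ 1 := by
    filter_upwards [h0, h1, hη.ae_eq] with z hz0 hz1 hz2
    rw [hz2]
    exact ⟨hz0, hz1⟩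
  have hms : MeasurableSet {x | 0 ≤ η x ∧ η x ≤ 1} :=
    (measurableSet_le measurable_const hη.measurable).inter
      (measurableSet_le hη.measurable measurable_const)
  rw [Measure.fst, ae_map_iff measurable_fst.aemeasurable hms]
  exact h2

theorem measurable_bayesClassifier (hη : Measurable η) : Measurable (bayesClassifier η) := by
  unfold bayesClassifier
  exact Measurable.ite (measurableSet_le measurable_const hη) measurable_const measurable_const

theorem bayesClassifier_memLp [IsProbabilityMeasure P] (hη : Measurable η) :
    MemLp (bayesClassifier η) 2 P.fst :=
  MemLp.of_bound (measurable_bayesClassifier hη).aestronglyMeasurable 1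
    (Filter.Eventually.of_forall fun x => (abs_bayesClassifier η x).le)

theorem integrable_pos_part_hinge [IsProbabilityMeasure P] {g : X → ℝ} (hg : MemLp g 2 P.fst) :
    Integrable (fun x => max (1 - g x) 0) P.fst ∧ Integrable (fun x => max (1 + g x) 0) P.fst := by
  have h := hg.integrable (by norm_num)
  exact ⟨((integrable_const _).sub h).sup (integrable_const _),
    ((integrable_const _).add h).sup (integrable_const _)⟩

/-- The relative hinge risk is the integral of the pointwise excess risk. -/
theorem integral_hingeLoss_sub [IsProbabilityMeasure P] (hη : IsRegressionFunction P η)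
    {g s : X → ℝ} (hg : MemLp g 2 P.fst) (hs : MemLp s 2 P.fst) :
    ∫ z, (hingeLoss g z - hingeLoss s z) ∂P = ∫ x, excessRisk (η x) (g x) (s x) ∂P.fst := by
  obtain ⟨hg1, hg2⟩ := integrable_pos_part_hinge hg
  obtain ⟨hs1, hs2⟩ := integrable_pos_part_hinge hs
  rw [hη.integral_ite (hg1.sub hs1) (hg2.sub hs2)]
  · refine integral_congr_ae (Filter.Eventually.of_forall fun x => ?_)
    simp only [excessRisk, Pi.sub_apply]
    ring
  · intro z hz
    simp [hingeLoss, hz]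
  · intro z hz
    simp [hingeLoss, hz]

theorem integrable_excessRisk [IsProbabilityMeasure P] (hη : IsRegressionFunction P η)
    {g s : X → ℝ} (hg : MemLp g 2 P.fst) (hs : MemLp s 2 P.fst) :
    Integrable (fun x => excessRisk (η x) (g x) (s x)) P.fst := by
  obtain ⟨hg1, hg2⟩ := integrable_pos_part_hinge hg
  obtain ⟨hs1, hs2⟩ := integrable_pos_part_hinge hs
  have hb : ∀ᵐ x ∂P.fst, ‖η x‖ ≤ 1 := by
    filter_upwards [hη.ae_mem_Icc] with x hx
    rw [Real.norm_eq_abs, abs_of_nonneg hx.1]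
    exact hx.2
  have hb' : ∀ᵐ x ∂P.fst, ‖1 - η x‖ ≤ 1 := by
    filter_upwards [hη.ae_mem_Icc] with x hx
    rw [Real.norm_eq_abs, abs_of_nonneg (by linarith [hx.2])]
    linarith [hx.1]
  have hm : AEStronglyMeasurable η P.fst := hη.measurable.aestronglyMeasurable
  have hm' : AEStronglyMeasurable (fun x => 1 - η x) P.fst :=
    (hη.measurable.const_sub 1).aestronglyMeasurable
  exact ((hg1.bdd_mul hm hb).add (hg2.bdd_mul hm' hb')).sub
    ((hs1.bdd_mul hm hb).add (hs2.bdd_mul hm' hb'))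

/-- The Bayes classifier minimizes the hinge risk. -/
theorem integral_hingeLoss_bayesClassifier_le [IsProbabilityMeasure P]
    (hη : IsRegressionFunction P η) {g : X → ℝ} (hg : MemLp g 2 P.fst) :
    ∫ z, hingeLoss (bayesClassifier η) z ∂P ≤ ∫ z, hingeLoss g z ∂P := by
  have hs := bayesClassifier_memLp (P := P) hη.measurable
  rw [← sub_nonneg, ← integral_sub ((memLp_hingeLoss hg).integrable (by norm_num))
    ((memLp_hingeLoss hs).integrable (by norm_num)), integral_hingeLoss_sub hη hg hs]
  refine integral_nonneg_of_ae ?_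
  filter_upwards [hη.ae_mem_Icc] with x hx
  exact excessRisk_nonneg hx.1 hx.2 _

/-- (H3) in the first setting: integration of the margin inequality for predictions, which holds at
every point. -/
theorem l2Dist_bayesClassifier_sq_le [IsProbabilityMeasure P] (hη : IsRegressionFunction P η)
    {η₀ η₁ B : ℝ} (hη₀ : 0 < η₀) (hη₁ : 0 < η₁) (hA2 : ∀ x, η₀ ≤ |η x - 1 / 2|)
    (hA3 : ∀ x, η₁ ≤ min (η x) (1 - η x)) {g : X → ℝ} (hg : MemLp g 2 P.fst)
    (hB : ∀ x, |g x| ≤ B) :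
    l2Dist P.fst g (bayesClassifier η) ^ 2 ≤ 2 * (B / η₁ + 1 / η₀) *
      ∫ z, (hingeLoss g z - hingeLoss (bayesClassifier η) z) ∂P := by
  have hs := bayesClassifier_memLp (P := P) hη.measurable
  rw [l2Dist_sq hg hs, integral_hingeLoss_sub hη hg hs, ← integral_const_mul]
  exact integral_mono (hg.sub hs).integrable_sq
    ((integrable_excessRisk hη hg hs).const_mul _)
    fun x => sq_sub_bayesClassifier_le hη₀ hη₁ (hA2 x) (hA3 x) (hB x)

/-- (H3) in the second setting. The squared distance of the losses depends on the label, so it too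
is conditioned on `x` before the pointwise inequality is integrated. -/
theorem l2Dist_hingeLoss_bayesClassifier_sq_le [IsProbabilityMeasure P]
    (hη : IsRegressionFunction P η) {η₀ B : ℝ} (hη₀ : 0 < η₀) (hA2 : ∀ x, η₀ ≤ |η x - 1 / 2|)
    {g : X → ℝ} (hg : MemLp g 2 P.fst) (hB : ∀ x, |g x| ≤ B) :
    l2Dist P (hingeLoss g) (hingeLoss (bayesClassifier η)) ^ 2 ≤ (B + 1 / η₀) *
      ∫ z, (hingeLoss g z - hingeLoss (bayesClassifier η) z) ∂P := by
  have hs := bayesClassifier_memLp (P := P) hη.measurable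
  have hpos : ∀ {f : X → ℝ}, MemLp f 2 P.fst → MemLp (fun x => max (1 - f x) 0) 2 P.fst ∧
      MemLp (fun x => max (1 + f x) 0) 2 P.fst := by
    intro f hf
    have h1 : MemLp (fun x => 1 - f x) 2 P.fst := (memLp_const (1 : ℝ)).sub hf
    have h2 : MemLp (fun x => 1 + f x) 2 P.fst := (memLp_const (1 : ℝ)).add hf
    exact ⟨h1.pos_part, h2.pos_part⟩
  obtain ⟨hg1, hg2⟩ := hpos hg
  obtain ⟨hs1, hs2⟩ := hpos hs
  rw [l2Dist_sq (memLp_hingeLoss hg) (memLp_hingeLoss hs), integral_hingeLoss_sub hη hg hs,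
    ← integral_const_mul, hη.integral_ite (hg1.sub hs1).integrable_sq (hg2.sub hs2).integrable_sq
      (fun z hz => by simp [hingeLoss, hz]) (fun z hz => by simp [hingeLoss, hz])]
  refine integral_mono_of_nonneg ?_ ((integrable_excessRisk hη hg hs).const_mul _) ?_
  · filter_upwards [hη.ae_mem_Icc] with x hx
    have h1 : 0 ≤ 1 - η x := by linarith [hx.2]
    have h0 := hx.1
    simp only [Pi.zero_apply]
    positivity
  · filter_upwards [hη.ae_mem_Icc] with x hx
    exact loss_sq_le_excessRisk hη₀ (hA2 x) hx.1 hx.2 (hB x)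

end Hinge

/-! ### Measurability and boundedness in an RKHS -/

section DenseSpan

variable {H : Type*} [NormedAddCommGroup H] [InnerProductSpace ℝ H]
  [TopologicalSpace.SeparableSpace H]

variable (H) in
/-- The span of the first `N` vectors of a dense sequence. -/
def denseSpan (N : ℕ) : Submodule ℝ H :=
  Submodule.span ℝ (TopologicalSpace.denseSeq H '' Iio N)

instance (N : ℕ) : FiniteDimensional ℝ (denseSpan H N) :=
  FiniteDimensional.span_of_finite ℝ ((finite_Iio N).image _)

theorem tendsto_starProjection_denseSpan (h : H) :
    Filter.Tendsto (fun N => (denseSpan H N).starProjection h) Filter.atTop (nhds h) := by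
  refine Submodule.starProjection_tendsto_self (denseSpan H)
    (fun a b hab => Submodule.span_mono (image_mono (Iio_subset_Iio hab))) h ?_
  intro y _
  rw [← SetLike.mem_coe, Submodule.topologicalClosure_coe]
  refine closure_mono ?_ (TopologicalSpace.denseRange_denseSeq H y)
  rintro _ ⟨m, rfl⟩
  -- The vector with index `m` belongs to the span of the first `m + 1` vectors.
  refine Submodule.mem_iSup_of_mem (m + 1) (Submodule.subset_span ⟨m, ?_, rfl⟩)
  simp

end DenseSpan

section RKHSBasics

variable {X : Type*} {H : Type*} [NormedAddCommGroup H] [InnerProductSpace ℝ H] [CompleteSpace H]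
  [RKHS ℝ H X ℝ]

variable (H) in
/-- The representer of the evaluation at `x`. -/
def kerVec (x : X) : H := RKHS.kerFun H x 1

theorem inner_kerVec (x : X) (h : H) : inner ℝ (kerVec H x) h = h x := by
  rw [kerVec, RKHS.kerFun_inner]
  simp

theorem kerVec_apply (x y : X) : kerVec H y x = rkhsKernel H x y := RKHS.kerFun_apply H y 1 x

theorem rkhsKernel_eq_inner (x y : X) :
    rkhsKernel H x y = inner ℝ (kerVec H x) (kerVec H y) := by
  rw [inner_kerVec, kerVec_apply]

theorem norm_kerVec_sq (x : X) : ‖kerVec H x‖ ^ 2 = rkhsKernel H x x := by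
  rw [rkhsKernel_eq_inner, real_inner_self_eq_norm_sq]

theorem norm_kerVec_le {M : ℝ} (hM : 0 < M) (hk : ∀ x : X, rkhsKernel H x x ≤ M ^ 2) (x : X) :
    ‖kerVec H x‖ ≤ M := by
  refine abs_le_of_sq_le_sq' ?_ hM.le |>.2
  rw [norm_kerVec_sq]
  exact hk x

theorem abs_apply_le_mul_norm {M : ℝ} (hM : 0 < M) (hk : ∀ x : X, rkhsKernel H x x ≤ M ^ 2) (h : H)
    (x : X) : |h x| ≤ M * ‖h‖ := by
  rw [← inner_kerVec]
  exact (abs_real_inner_le_norm _ _).trans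
    (mul_le_mul_of_nonneg_right (norm_kerVec_le hM hk x) (norm_nonneg _))

variable [MeasurableSpace X]

/-- The measurable elements form a subspace that contains the kernel sections, hence a dense one,
and norm convergence in an RKHS implies pointwise convergence. -/
theorem measurable_coe_rkhs (hk : ∀ x : X, Measurable (rkhsKernel H x)) (h : H) :
    Measurable (h : X → ℝ) := by
  let V : Submodule ℝ H :=
    { carrier := {h | Measurable (h : X → ℝ)}
      add_mem' := fun {a b} ha hb => by
        simp only [mem_ofPred_eq, RKHS.coe_add] at *
        exact ha.add hb
      zero_mem' := by
        simp only [mem_ofPred_eq, RKHS.coe_zero]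
        exact measurable_zero
      smul_mem' := fun c a ha => by
        simp only [mem_ofPred_eq, RKHS.coe_smul] at *
        exact ha.const_smul c }
  have h1 : Submodule.span ℝ {RKHS.kerFun H x v | (x) (v)} ≤ V := by
    refine Submodule.span_le.2 ?_
    rintro _ ⟨x, v, rfl⟩
    have h2 : RKHS.kerFun H x v = v • kerVec H x := by
      rw [kerVec, ← map_smul, smul_eq_mul, mul_one]
    rw [h2]
    refine V.smul_mem _ ?_
    have h3 : (kerVec H x : X → ℝ) = rkhsKernel H x := by
      funext y
      rw [← inner_kerVec, ← rkhsKernel_eq_inner, rkhsKernel_eq_inner, real_inner_comm,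
        ← rkhsKernel_eq_inner]
    change Measurable (kerVec H x : X → ℝ)
    rw [h3]
    exact hk x
  have h4 : h ∈ (Submodule.span ℝ {RKHS.kerFun H x v | (x) (v)}).topologicalClosure := by
    rw [RKHS.kerFun_dense]
    trivial
  rw [← SetLike.mem_coe, Submodule.topologicalClosure_coe, mem_closure_iff_seq_limit] at h4
  obtain ⟨u, hu, hlim⟩ := h4
  refine measurable_of_tendsto_metrizable (fun m => h1 (hu m)) ?_
  rw [tendsto_pi_nhds]
  exact fun x => ((RKHS.continuous_eval x).tendsto h).comp hlim

variable [TopologicalSpace.SeparableSpace H]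

/-- In an orthonormal basis `b` of the finite-dimensional span, the coordinates of the projected
representer are the functions `b i`, which are measurable as elements of the RKHS. -/
theorem stronglyMeasurable_starProjection_kerVec (hk : ∀ x : X, Measurable (rkhsKernel H x))
    (N : ℕ) : StronglyMeasurable fun x : X => (denseSpan H N).starProjection (kerVec H x) := by
  set b := stdOrthonormalBasis ℝ (denseSpan H N)
  have h1 : ∀ x : X, (denseSpan H N).starProjection (kerVec H x)
      = ∑ i, ((b i : H) : X → ℝ) x • (b i : H) := by
    intro x
    rw [b.starProjection_eq_sum_rankOne]
    simp only [sum_apply, InnerProductSpace.rankOne_apply]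
    refine Finset.sum_congr rfl fun i _ => ?_
    rw [real_inner_comm, inner_kerVec]
  simp only [h1]
  exact Finset.stronglyMeasurable_fun_sum _ fun i _ =>
    (measurable_coe_rkhs hk _).stronglyMeasurable.smul_const _

theorem stronglyMeasurable_kerVec (hk : ∀ x : X, Measurable (rkhsKernel H x)) :
    StronglyMeasurable (kerVec H : X → H) := by
  refine stronglyMeasurable_of_tendsto Filter.atTop
    (stronglyMeasurable_starProjection_kerVec hk) ?_
  rw [tendsto_pi_nhds]
  exact fun x => tendsto_starProjection_denseSpan _

/-- Joint measurability follows from that of the sections, because the kernel is the inner product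
of two strongly measurable representers; separability enters through them. -/
theorem measurable_uncurry_rkhsKernel (hk : ∀ x : X, Measurable (rkhsKernel H x)) :
    Measurable (Function.uncurry (rkhsKernel H : X → X → ℝ)) := by
  have h1 : Function.uncurry (rkhsKernel H : X → X → ℝ)
      = fun p : X × X => inner ℝ (kerVec H p.1) (kerVec H p.2) := by
    funext p
    exact rkhsKernel_eq_inner _ _
  rw [h1]
  exact (((stronglyMeasurable_kerVec hk).comp_measurable measurable_fst).inner
    ((stronglyMeasurable_kerVec hk).comp_measurable measurable_snd)).measurable

end RKHSBasics

/-! ### The inclusion of an RKHS into `L²` -/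

section Inclusion

variable {X : Type*} [MeasurableSpace X] {H : Type*} [NormedAddCommGroup H]
  [InnerProductSpace ℝ H] [CompleteSpace H] [RKHS ℝ H X ℝ]

theorem memLp_coe_rkhs (μ : Measure X) [IsProbabilityMeasure μ]
    (hk : ∀ x : X, Measurable (rkhsKernel H x)) {M : ℝ} (hM : 0 < M)
    (hkM : ∀ x : X, rkhsKernel H x x ≤ M ^ 2) (h : H) : MemLp (h : X → ℝ) 2 μ :=
  MemLp.of_bound (measurable_coe_rkhs hk h).aestronglyMeasurable (M * ‖h‖)
    (Filter.Eventually.of_forall fun x => abs_apply_le_mul_norm hM hkM h x)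

/-- Evaluations are bounded by `M ‖h‖`, and `μ` is a probability measure, so that `M` bounds the
`L²` inclusion. -/
theorem exists_inclusion (μ : Measure X) [IsProbabilityMeasure μ]
    (hk : ∀ x : X, Measurable (rkhsKernel H x)) {M : ℝ} (hM : 0 < M)
    (hkM : ∀ x : X, rkhsKernel H x x ≤ M ^ 2) :
    ∃ S : H →L[ℝ] Lp ℝ 2 μ, ∀ h : H, (S h : X → ℝ) =ᵐ[μ] h := by
  have hmem := memLp_coe_rkhs (H := H) μ hk hM hkM
  let A : H →ₗ[ℝ] Lp ℝ 2 μ :=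
    { toFun := fun h => (hmem h).toLp
      map_add' := fun a b => by
        rw [← MemLp.toLp_add]
        exact (MemLp.toLp_eq_toLp_iff _ _).2 (by rw [RKHS.coe_add])
      map_smul' := fun c a => by
        rw [RingHom.id_apply, ← MemLp.toLp_const_smul]
        exact (MemLp.toLp_eq_toLp_iff _ _).2 (by rw [RKHS.coe_smul]) }
  refine ⟨A.mkContinuous M fun h => ?_, fun h => (hmem h).coeFn_toLp⟩
  refine (Lp.norm_le_of_ae_bound (f := A h) (C := M * ‖h‖) (by positivity) ?_).trans
    (by simp [measureUnivNNReal])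
  filter_upwards [(hmem h).coeFn_toLp] with x hx
  change ‖((hmem h).toLp : X → ℝ) x‖ ≤ _
  rw [hx]
  exact abs_apply_le_mul_norm hM hkM h x

variable {μ : Measure X} {S : H →L[ℝ] Lp ℝ 2 μ}

theorem inner_inclusion {H : Type*} [NormedAddCommGroup H] [InnerProductSpace ℝ H]
    [RKHS ℝ H X ℝ] {S : H →L[ℝ] Lp ℝ 2 μ} (hS : ∀ h : H, (S h : X → ℝ) =ᵐ[μ] h) (h : H) (f : Lp ℝ 2 μ) :
    inner ℝ (S h) f = ∫ x, h x * f x ∂μ := by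
  rw [L2.inner_def]
  refine integral_congr_ae ?_
  filter_upwards [hS h] with x hx
  rw [hx, RCLike.inner_apply, conj_trivial, mul_comm]

theorem norm_inclusion_sq {H : Type*} [NormedAddCommGroup H] [InnerProductSpace ℝ H]
    [RKHS ℝ H X ℝ] {S : H →L[ℝ] Lp ℝ 2 μ} (hS : ∀ h : H, (S h : X → ℝ) =ᵐ[μ] h) (h : H) :
    ‖S h‖ ^ 2 = ∫ x, h x ^ 2 ∂μ := by
  rw [← real_inner_self_eq_norm_sq, inner_inclusion hS]
  refine integral_congr_ae ?_
  filter_upwards [hS h] with x hx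
  rw [hx, sq]

/-- Evaluation at `x` is pairing with the representer, which the adjoint moves to `L²`. The formula
holds at every `x`, not just almost everywhere. -/
theorem adjoint_inclusion_apply (hS : ∀ h : H, (S h : X → ℝ) =ᵐ[μ] h) (f : Lp ℝ 2 μ) (x : X) :
    S.adjoint f x = ∫ y, rkhsKernel H x y * f y ∂μ := by
  rw [← inner_kerVec, ContinuousLinearMap.adjoint_inner_right, inner_inclusion hS]
  congr 1
  funext y
  rw [kerVec_apply, rkhsKernel_eq_inner, real_inner_comm, ← rkhsKernel_eq_inner]

variable [IsProbabilityMeasure μ] [TopologicalSpace.SeparableSpace H]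

/-- The kernel integral operator is `S S*`. -/
theorem kernelIntegralOperator_eq (hk : ∀ x : X, Measurable (rkhsKernel H x)) {M : ℝ} (hM : 0 < M)
    (hkM : ∀ x : X, rkhsKernel H x x ≤ M ^ 2) (hS : ∀ h : H, (S h : X → ℝ) =ᵐ[μ] h) :
    kernelIntegralOperator (rkhsKernel H) μ = S ∘L S.adjoint := by
  have h1 := isKernelIntegralOperator_kernelIntegralOperator (μ := μ)
    (measurable_uncurry_rkhsKernel hk) (B := M * M) fun x y => by
      rw [rkhsKernel_eq_inner]
      exact (abs_real_inner_le_norm _ _).trans (mul_le_mul (norm_kerVec_le hM hkM x)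
        (norm_kerVec_le hM hkM y) (norm_nonneg _) hM.le)
  ext f
  refine (h1 f).trans ?_
  filter_upwards [hS (S.adjoint f)] with x hx
  rw [ContinuousLinearMap.comp_apply, hx, adjoint_inclusion_apply hS]

/-- The inclusion of the RKHS into `L²` is compact. -/
theorem isCompactOperator_inclusion (hk : ∀ x : X, Measurable (rkhsKernel H x)) {M : ℝ}
    (hM : 0 < M) (hkM : ∀ x : X, rkhsKernel H x x ≤ M ^ 2)
    (hS : ∀ h : H, (S h : X → ℝ) =ᵐ[μ] h) : IsCompactOperator S := by
  set Pr : ℕ → H →L[ℝ] H := fun N => (denseSpan H N).starProjection with hPr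
  set a : ℕ → ℝ := fun N => ∫ x, ‖kerVec H x - Pr N (kerVec H x)‖ ^ 2 ∂μ with ha
  have hsm : ∀ N, StronglyMeasurable fun x : X => ‖kerVec H x - Pr N (kerVec H x)‖ ^ 2 := fun N =>
    ((stronglyMeasurable_kerVec hk).sub (stronglyMeasurable_starProjection_kerVec hk N)).norm.pow 2
  have hbd : ∀ N (x : X), ‖kerVec H x - Pr N (kerVec H x)‖ ^ 2 ≤ (2 * M) ^ 2 := by
    intro N x
    refine pow_le_pow_left₀ (norm_nonneg _) ((norm_sub_le _ _).trans ?_) 2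
    have h1 := norm_kerVec_le hM hkM x
    have h2 := (denseSpan H N).norm_starProjection_apply_le (kerVec H x)
    linarith
  have ha0 : Filter.Tendsto a Filter.atTop (nhds 0) := by
    have h1 : Filter.Tendsto a Filter.atTop (nhds (∫ _x : X, (0 : ℝ) ∂μ)) := by
      refine tendsto_integral_of_dominated_convergence (fun _ => (2 * M) ^ 2)
        (fun N => (hsm N).aestronglyMeasurable) (integrable_const _) (fun N => ?_) ?_
      · refine Filter.Eventually.of_forall fun x => ?_
        rw [Real.norm_eq_abs, abs_of_nonneg (by positivity)]
        exact hbd N x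
      · refine Filter.Eventually.of_forall fun x => ?_
        have h2 := (tendsto_const_nhds (x := kerVec H x)).sub
          (tendsto_starProjection_denseSpan (kerVec H x))
        rw [sub_self] at h2
        simpa using (h2.norm.pow 2)
    simpa using h1
  -- `(Pr h - h)(x)` is the inner product of `h` with `Pr k_x - k_x`; Cauchy–Schwarz and integration
  -- bound the operator norm by a Hilbert–Schmidt type integral, which tends to zero. So `S` is a
  -- norm limit of finite-rank operators.
  have hle : ∀ N, ‖S ∘L Pr N - S‖ ≤ √(a N) := by
    intro N
    refine ContinuousLinearMap.opNorm_le_bound _ (Real.sqrt_nonneg _) fun h => ?_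
    have h1 : (S ∘L Pr N - S) h = S (Pr N h - h) := by simp
    rw [h1]
    refine abs_le_of_sq_le_sq' ?_ (by positivity) |>.2
    have haN : 0 ≤ a N := integral_nonneg fun x => by positivity
    rw [norm_inclusion_sq hS, mul_pow, Real.sq_sqrt haN, ha, ← integral_mul_const]
    refine integral_mono_of_nonneg (Filter.Eventually.of_forall fun x => sq_nonneg _)
      ((integrable_of_measurable_of_abs_le (hsm N).measurable (B := (2 * M) ^ 2) fun x => by
        rw [abs_of_nonneg (by positivity)]; exact hbd N x).mul_const _)
      (Filter.Eventually.of_forall fun x => ?_)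
    have h2 : (Pr N h - h) x = inner ℝ (Pr N (kerVec H x) - kerVec H x) h := by
      rw [← inner_kerVec, inner_sub_left, inner_sub_right,
        Submodule.inner_starProjection_left_eq_right]
    dsimp only
    rw [h2, ← mul_pow, norm_sub_rev]
    exact sq_le_sq.2 ((abs_real_inner_le_norm _ _).trans (le_abs_self _))
  refine isCompactOperator_of_tendsto (l := Filter.atTop) (F := fun N => S ∘L Pr N) ?_
    (Filter.Eventually.of_forall fun N => ?_)
  · rw [tendsto_iff_norm_sub_tendsto_zero]
    refine squeeze_zero (fun N => norm_nonneg _) hle ?_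
    have h1 := (Real.continuous_sqrt.tendsto 0).comp ha0
    rwa [Real.sqrt_zero] at h1
  · have := FiniteDimensional.proper ℝ (denseSpan H N)
    have h1 : IsCompactOperator (denseSpan H N).orthogonalProjectionOnto :=
      isCompactOperator_of_locallyCompactSpace_dom _
    exact h1.clm_comp (S ∘L (denseSpan H N).subtypeL)

end Inclusion

/-! ### Eigenvectors of compact operators of the form `S S*` -/

section Spectral

variable {G : Type*} [NormedAddCommGroup G] [InnerProductSpace ℝ G]

/-- A finite-dimensional space has an orthonormal basis indexed by any finite set of natural numbers
of the right cardinality. -/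
theorem exists_orthonormal_indexed (E : Submodule ℝ G) [FiniteDimensional ℝ E] {J : Set ℕ}
    (hJ : J.Finite) (hcard : J.ncard = Module.finrank ℝ E) :
    ∃ g : ℕ → G, (∀ j ∈ J, g j ∈ E) ∧
      (∀ i ∈ J, ∀ j ∈ J, inner ℝ (g i) (g j) = if i = j then (1 : ℝ) else 0) ∧
      ∀ u : G, (∀ j ∈ J, inner ℝ (g j) u = 0) → ∀ w ∈ E, inner ℝ w u = 0 := by
  classical
  have : Fintype J := hJ.fintype
  have hc : Fintype.card J = Fintype.card (Fin (Module.finrank ℝ E)) := by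
    rw [Fintype.card_fin, ← hcard, Set.ncard_eq_toFinset_card', Set.toFinset_card]
  set eq := Fintype.equivOfCardEq hc
  set b := (stdOrthonormalBasis ℝ E).reindex eq.symm
  refine ⟨fun j => if h : j ∈ J then (b ⟨j, h⟩ : G) else 0, ?_, ?_, ?_⟩
  · intro j hj
    simp [hj]
  · intro i hi j hj
    simp only [hi, hj, dif_pos]
    have := orthonormal_iff_ite.1 b.orthonormal ⟨i, hi⟩ ⟨j, hj⟩
    simpa using this
  · intro u hu w hw
    have h1 : w = ∑ j, inner ℝ (b j) (⟨w, hw⟩ : E) • (b j : G) := by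
      have := congrArg (Subtype.val : E → G) (b.sum_repr' ⟨w, hw⟩)
      simpa using this.symm
    rw [h1, sum_inner]
    refine Finset.sum_eq_zero fun j _ => ?_
    have := hu j j.2
    simp only [j.2, dif_pos] at this
    rw [real_inner_smul_left, this, mul_zero]

variable [CompleteSpace G]

/-- Orthonormal eigenvectors for the nonzero eigenvalues of a compact self-adjoint operator. -/
theorem exists_eigenvectors {T : G →L[ℝ] G} (hT : IsCompactOperator T)
    (hsymm : (T : G →ₗ[ℝ] G).IsSymmetric) {lam : ℕ → ℝ} (hlam : IsEigenvalueSequence T lam) :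
    ∃ f : ℕ → G, (∀ i j, lam i ≠ 0 → lam j ≠ 0 →
        inner ℝ (f i) (f j) = if i = j then (1 : ℝ) else 0) ∧
      (∀ j, lam j ≠ 0 → T (f j) = lam j • f j) ∧
      ∀ u, (∀ j, lam j ≠ 0 → inner ℝ (f j) u = 0) → T u = 0 := by
  have h1 : ∀ μ : ℝ, ∃ g : ℕ → G, μ ≠ 0 →
      (∀ j ∈ {j | lam j = μ}, g j ∈ Module.End.eigenspace (T : G →ₗ[ℝ] G) μ) ∧
      (∀ i ∈ {j | lam j = μ}, ∀ j ∈ {j | lam j = μ},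
        inner ℝ (g i) (g j) = if i = j then (1 : ℝ) else 0) ∧
      ∀ u : G, (∀ j ∈ {j | lam j = μ}, inner ℝ (g j) u = 0) →
        ∀ w ∈ Module.End.eigenspace (T : G →ₗ[ℝ] G) μ, inner ℝ w u = 0 := by
    intro μ
    by_cases hμ : μ = 0
    · exact ⟨0, fun h => absurd hμ h⟩
    · obtain ⟨hfd, hfin, hcard⟩ := hlam.multiplicity μ hμ
      obtain ⟨g, hg⟩ := exists_orthonormal_indexed _ hfin hcard
      exact ⟨g, fun _ => hg⟩
  choose g hg using h1
  have hmem : ∀ j, lam j ≠ 0 → g (lam j) j ∈ Module.End.eigenspace (T : G →ₗ[ℝ] G) (lam j) :=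
    fun j hj => (hg _ hj).1 j rfl
  refine ⟨fun j => g (lam j) j, ?_, ?_, ?_⟩
  · intro i j hi hj
    by_cases hij : lam i = lam j
    · dsimp only
      rw [hij]
      exact (hg _ hj).2.1 i hij j rfl
    · have hne : i ≠ j := fun h => hij (by rw [h])
      rw [if_neg hne]
      exact hsymm.orthogonalFamily_eigenspaces hij ⟨_, hmem i hi⟩ ⟨_, hmem j hj⟩
  · intro j hj
    exact Module.End.mem_eigenspace_iff.1 (hmem j hj)
  · intro u hu
    -- `T u` is orthogonal to the kernel by symmetry, and to the other eigenspaces since `u` is. The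
    -- eigenspaces of a compact symmetric operator leave no room for anything else.
    have h2 : T u ∈ (⨆ μ, Module.End.eigenspace (T : Module.End ℝ G) μ)ᗮ := by
      rw [← Submodule.iInf_orthogonal, Submodule.mem_iInf]
      intro μ
      rw [Submodule.mem_orthogonal]
      intro w hw
      have h3 : T w = μ • w := Module.End.mem_eigenspace_iff.1 hw
      have h4 : inner ℝ w (T u) = inner ℝ (T w) u := (hsymm w u).symm
      rw [h4, h3, real_inner_smul_left]
      by_cases hμ : μ = 0
      · rw [hμ, zero_mul]
      · rw [(hg μ hμ).2.2 u (fun j hj => ?_) w hw, mul_zero]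
        have hj' : lam j = μ := hj
        have h5 : inner ℝ (g (lam j) j) u = 0 := hu j (by rw [hj']; exact hμ)
        rwa [hj'] at h5
    rw [ContinuousLinearMap.orthogonalComplement_iSup_eigenspaces_eq_bot hT hsymm] at h2
    simpa using h2

variable {H : Type*} [NormedAddCommGroup H] [InnerProductSpace ℝ H] [CompleteSpace H]

/-- The singular vectors of a compact operator `S`: an orthonormal system `v`, padded by zeros, with
`‖S h‖² ≥ ∑ λⱼ ⟨vⱼ, h⟩²` for all `h` and `S h = 0` for `h` orthogonal to the system. -/
theorem exists_singularVectors {S : H →L[ℝ] G} (hS : IsCompactOperator S) {lam : ℕ → ℝ}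
    (hlam : IsEigenvalueSequence (S ∘L S.adjoint) lam) :
    ∃ v : ℕ → H, (∀ i j, inner ℝ (v i) (v j) = if i = j ∧ lam j ≠ 0 then (1 : ℝ) else 0) ∧
      (∀ j, ‖S (v j)‖ ^ 2 = lam j) ∧
      (∀ h D, ∑ j ∈ Finset.range D, lam j * inner ℝ (v j) h ^ 2 ≤ ‖S h‖ ^ 2) ∧
      ∀ h, (∀ j, inner ℝ (v j) h = 0) → S h = 0 := by
  classical
  have hT : IsCompactOperator (S ∘L S.adjoint) := hS.comp_clm S.adjoint
  have hsymm : ((S ∘L S.adjoint : G →L[ℝ] G) : G →ₗ[ℝ] G).IsSymmetric := by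
    intro x y
    change inner ℝ (S (S.adjoint x)) y = inner ℝ x (S (S.adjoint y))
    exact (ContinuousLinearMap.adjoint_inner_right S _ _).symm.trans
      (ContinuousLinearMap.adjoint_inner_left S _ _)
  obtain ⟨f, hf1, hf2, hf3⟩ := exists_eigenvectors hT hsymm hlam
  have hsq : ∀ j, √(lam j) * √(lam j) = lam j := fun j => Real.mul_self_sqrt (hlam.nonneg j)
  have hs0 : ∀ j, lam j ≠ 0 → √(lam j) ≠ 0 := fun j hj =>
    (Real.sqrt_pos.2 (lt_of_le_of_ne (hlam.nonneg j) (Ne.symm hj))).ne'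
  -- The usual passage from left to right singular vectors, `vⱼ = λⱼ^(-1/2) S* fⱼ`, with zero
  -- vectors where `λⱼ = 0`.
  set v : ℕ → H := fun j => if lam j = 0 then 0 else (√(lam j))⁻¹ • S.adjoint (f j) with hv
  have hv0 : ∀ j, lam j = 0 → v j = 0 := fun j hj => by simp [hv, hj]
  have hv1 : ∀ j, lam j ≠ 0 → v j = (√(lam j))⁻¹ • S.adjoint (f j) := fun j hj => by simp [hv, hj]
  have hSv : ∀ j, lam j ≠ 0 → S (v j) = √(lam j) • f j := by
    intro j hj
    rw [hv1 j hj, map_smul]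
    have : S (S.adjoint (f j)) = lam j • f j := hf2 j hj
    rw [this, smul_smul]
    congr 1
    have := hs0 j hj
    rw [inv_mul_eq_iff_eq_mul₀ this, hsq]
  have hvinner : ∀ j, lam j ≠ 0 → ∀ h, inner ℝ (v j) h = (√(lam j))⁻¹ * inner ℝ (f j) (S h) := by
    intro j hj h
    rw [hv1 j hj, real_inner_smul_left, ContinuousLinearMap.adjoint_inner_left]
  refine ⟨v, ?_, ?_, ?_, ?_⟩
  · intro i j
    by_cases hj : lam j = 0
    · simp [hv0 j hj, hj]
    by_cases hi : lam i = 0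
    · have : i ≠ j := fun h => hj (h ▸ hi)
      simp [hv0 i hi, this]
    rw [hvinner i hi, hSv j hj, real_inner_smul_right, hf1 i j hi hj]
    by_cases hij : i = j
    · subst hij
      simp [hj, hs0 i hi]
    · simp [hij]
  · intro j
    by_cases hj : lam j = 0
    · simp [hv0 j hj, hj]
    · rw [hSv j hj, norm_smul, mul_pow, Real.norm_eq_abs, sq_abs, ← real_inner_self_eq_norm_sq,
        hf1 j j hj hj, if_pos rfl, mul_one, sq, hsq]
  · intro h D
    set J := (Finset.range D).filter fun j => lam j ≠ 0
    have hon : Orthonormal ℝ fun j : {j // lam j ≠ 0} => f j := by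
      rw [orthonormal_iff_ite]
      rintro ⟨i, hi⟩ ⟨j, hj⟩
      rw [hf1 i j hi hj]
      simp [Subtype.ext_iff]
    have h1 := hon.sum_inner_products_le (S h)
      (s := (Finset.range D).subtype fun j => lam j ≠ 0)
    refine le_trans (le_of_eq ?_) h1
    have h2 : ∀ j ∈ Finset.range D, lam j * inner ℝ (v j) h ^ 2
        = if lam j ≠ 0 then ‖(inner ℝ (f j) (S h) : ℝ)‖ ^ 2 else 0 := by
      intro j _
      by_cases hj : lam j = 0
      · simp [hj]
      · rw [if_pos hj, hvinner j hj, mul_pow, Real.norm_eq_abs, sq_abs, inv_pow, sq, hsq,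
          ← mul_assoc, mul_inv_cancel₀ hj, one_mul]
    rw [Finset.sum_congr rfl h2, ← Finset.sum_filter]
    rw [Finset.sum_subtype_eq_sum_filter (f := fun j => ‖(inner ℝ (f j) (S h) : ℝ)‖ ^ 2)]
  · intro h hh
    -- From `S S* S h = 0`, first `‖S* S h‖² = 0` and then `‖S h‖² = 0`.
    have h1 : (S ∘L S.adjoint) (S h) = 0 := hf3 _ fun j hj => by
      have := hh j
      rw [hvinner j hj] at this
      exact (mul_eq_zero.1 this).resolve_left (inv_ne_zero (hs0 j hj))
    have h2 : S.adjoint (S h) = 0 := by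
      rw [← inner_self_eq_zero (𝕜 := ℝ), ContinuousLinearMap.adjoint_inner_left]
      change inner ℝ (S h) ((S ∘L S.adjoint) (S h)) = 0
      rw [h1, inner_zero_right]
    rw [← inner_self_eq_zero (𝕜 := ℝ), ← ContinuousLinearMap.adjoint_inner_left, h2,
      inner_zero_left]

end Spectral

/-! ### Residuals after projection onto a padded orthonormal system -/

section Residual

variable {H : Type*} [NormedAddCommGroup H] [InnerProductSpace ℝ H]

/-- The residual of `u` after projection onto the first `D` vectors of an orthonormal system. -/
def systemResidual (v : ℕ → H) (D : ℕ) (u : H) : H :=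
  u - ∑ j ∈ Finset.range D, (inner ℝ (v j) u : ℝ) • v j

variable {v : ℕ → H} {q : ℕ → Prop} [DecidablePred q]

/-- Pythagoras; the padding vectors, those with `q j` false, are zero and contribute nothing. -/
theorem norm_systemResidual_sq
    (hv : ∀ i j, inner ℝ (v i) (v j) = if i = j ∧ q j then (1 : ℝ) else 0) (D : ℕ) (u : H) :
    ‖systemResidual v D u‖ ^ 2 = ‖u‖ ^ 2 - ∑ j ∈ Finset.range D, inner ℝ (v j) u ^ 2 := by
  have h0 : ∀ j, ¬ q j → v j = 0 := fun j hj => by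
    rw [← inner_self_eq_zero (𝕜 := ℝ), hv]
    simp [hj]
  set p : H := ∑ j ∈ Finset.range D, (inner ℝ (v j) u : ℝ) • v j with hp
  have h1 : ∀ j ∈ Finset.range D, inner ℝ (v j) p = inner ℝ (v j) u := by
    intro j hj
    by_cases hq : q j
    · rw [hp, inner_sum, Finset.sum_eq_single j]
      · rw [real_inner_smul_right, hv]
        simp [hq]
      · intro i _ hij
        rw [real_inner_smul_right, hv, if_neg (fun h => hij h.1.symm), mul_zero]
      · exact fun h => absurd hj h
    · simp [h0 j hq]
  have h2 : ∀ w : H, inner ℝ p w = ∑ j ∈ Finset.range D, inner ℝ (v j) u * inner ℝ (v j) w := by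
    intro w
    rw [hp, sum_inner]
    exact Finset.sum_congr rfl fun j _ => real_inner_smul_left _ _ _
  have h3 : inner ℝ p p = ∑ j ∈ Finset.range D, inner ℝ (v j) u ^ 2 := by
    rw [h2]
    exact Finset.sum_congr rfl fun j hj => by rw [h1 j hj, sq]
  have h4 : inner ℝ p u = ∑ j ∈ Finset.range D, inner ℝ (v j) u ^ 2 := by
    rw [h2]
    exact Finset.sum_congr rfl fun j hj => by rw [sq]
  have h5 : systemResidual v D u = u - p := rfl
  rw [h5, norm_sub_sq_real, real_inner_comm, h4, ← real_inner_self_eq_norm_sq p, h3]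
  ring

theorem norm_systemResidual_le
    (hv : ∀ i j, inner ℝ (v i) (v j) = if i = j ∧ q j then (1 : ℝ) else 0) (D : ℕ) (u : H) :
    ‖systemResidual v D u‖ ≤ ‖u‖ := by
  refine abs_le_of_sq_le_sq' ?_ (norm_nonneg _) |>.2
  rw [norm_systemResidual_sq hv]
  have : 0 ≤ ∑ j ∈ Finset.range D, inner ℝ (v j) u ^ 2 := Finset.sum_nonneg fun j _ => sq_nonneg _
  linarith

theorem systemResidual_add (D : ℕ) (u w : H) :
    systemResidual v D (u + w) = systemResidual v D u + systemResidual v D w := by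
  simp only [systemResidual, inner_add_right, add_smul, Finset.sum_add_distrib]
  abel

theorem systemResidual_smul (D : ℕ) (c : ℝ) (u : H) :
    systemResidual v D (c • u) = c • systemResidual v D u := by
  simp only [systemResidual, real_inner_smul_right, smul_sub, Finset.smul_sum, smul_smul]

theorem systemResidual_self
    (hv : ∀ i j, inner ℝ (v i) (v j) = if i = j ∧ q j then (1 : ℝ) else 0) {D m : ℕ} (hm : m < D) :
    systemResidual v D (v m) = 0 := by
  have h1 := norm_systemResidual_sq hv D (v m)
  have h2 : ∑ j ∈ Finset.range D, inner ℝ (v j) (v m) ^ 2 = ‖v m‖ ^ 2 := by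
    rw [← real_inner_self_eq_norm_sq, Finset.sum_eq_single m]
    · rw [hv]
      split_ifs <;> simp
    · intro j _ hj
      rw [hv, if_neg (fun h => hj h.1)]
      simp
    · simp [hm]
  rw [h2, sub_self] at h1
  simpa using h1

/-- The residual maps are contractions, and each vector of the span is eventually mapped to zero; an
approximation argument extends this to the closure. -/
theorem tendsto_systemResidual
    (hv : ∀ i j, inner ℝ (v i) (v j) = if i = j ∧ q j then (1 : ℝ) else 0) {u : H}
    (hu : u ∈ (Submodule.span ℝ (range v)).topologicalClosure) :
    Filter.Tendsto (fun D => systemResidual v D u) Filter.atTop (nhds 0) := by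
  have hspan : ∀ y ∈ Submodule.span ℝ (range v),
      Filter.Tendsto (fun D => systemResidual v D y) Filter.atTop (nhds 0) := by
    intro y hy
    induction hy using Submodule.span_induction with
    | mem y hy =>
      obtain ⟨m, rfl⟩ := hy
      refine tendsto_const_nhds.congr' ?_
      filter_upwards [Filter.eventually_gt_atTop m] with D hD
      exact (systemResidual_self hv hD).symm
    | zero => simp [systemResidual]
    | add a b _ _ ha hb =>
      simp only [systemResidual_add]
      simpa using ha.add hb
    | smul c a _ ha =>
      simp only [systemResidual_smul]
      simpa using ha.const_smul c
  rw [Metric.tendsto_atTop]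
  intro ε hε
  rw [← SetLike.mem_coe, Submodule.topologicalClosure_coe, Metric.mem_closure_iff] at hu
  obtain ⟨y, hy, hyu⟩ := hu (ε / 2) (by positivity)
  obtain ⟨N, hN⟩ := Metric.tendsto_atTop.1 (hspan y hy) (ε / 2) (by positivity)
  refine ⟨N, fun D hD => ?_⟩
  have h1 := hN D hD
  rw [dist_zero_right] at h1 ⊢
  rw [dist_eq_norm] at hyu
  have h2 : systemResidual v D u = systemResidual v D (u - y) + systemResidual v D y := by
    rw [← systemResidual_add, sub_add_cancel]
  rw [h2]
  calc _ ≤ ‖systemResidual v D (u - y)‖ + ‖systemResidual v D y‖ := norm_add_le _ _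
    _ ≤ ‖u - y‖ + ‖systemResidual v D y‖ := by
        gcongr
        exact norm_systemResidual_le hv D _
    _ < ε := by linarith

end Residual

/-! ### The trace formula for the kernel -/

section Eigenfunctions

variable {X : Type*} [MeasurableSpace X] {H : Type*} [NormedAddCommGroup H]
  [InnerProductSpace ℝ H] [CompleteSpace H] [RKHS ℝ H X ℝ] [TopologicalSpace.SeparableSpace H]

theorem stronglyMeasurable_systemResidual_kerVec (hk : ∀ x : X, Measurable (rkhsKernel H x))
    (v : ℕ → H) (D : ℕ) : StronglyMeasurable fun x : X => systemResidual v D (kerVec H x) := by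
  unfold systemResidual
  refine (stronglyMeasurable_kerVec hk).sub (Finset.stronglyMeasurable_fun_sum _ fun j _ => ?_)
  refine StronglyMeasurable.smul_const ?_ _
  simp only [real_inner_comm (kerVec H _), inner_kerVec]
  exact (measurable_coe_rkhs hk _).stronglyMeasurable

/-- Eigenfunctions of the kernel integral operator as elements of the RKHS, and the trace formula
for the residual of the kernel. -/
theorem exists_eigenfunctions (μ : Measure X) [IsProbabilityMeasure μ]
    (hk : ∀ x : X, Measurable (rkhsKernel H x)) {M : ℝ} (hM : 0 < M)
    (hkM : ∀ x : X, rkhsKernel H x x ≤ M ^ 2) {lam : ℕ → ℝ}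
    (hlam : IsEigenvalueSequence (kernelIntegralOperator (rkhsKernel H) μ) lam) :
    Summable lam ∧ ∃ v : ℕ → H, (∀ j, lam j = 0 → v j = 0) ∧
      (∀ j, ∫ x, v j x ^ 2 ∂μ = lam j) ∧
      (∀ (h : H) (D : ℕ), ∑ j ∈ Finset.range D, lam j * inner ℝ (v j) h ^ 2
        ≤ ∫ x, h x ^ 2 ∂μ) ∧
      (∀ (D : ℕ) (x : X), ‖systemResidual v D (kerVec H x)‖ ≤ M) ∧
      ∀ D : ℕ, ∫ x, ‖systemResidual v D (kerVec H x)‖ ^ 2 ∂μ = ∑' j, lam (D + j) := by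
  classical
  obtain ⟨S, hS⟩ := exists_inclusion (H := H) μ hk hM hkM
  rw [kernelIntegralOperator_eq hk hM hkM hS] at hlam
  obtain ⟨v, hv, hSv, hbessel, hker⟩ :=
    exists_singularVectors (isCompactOperator_inclusion hk hM hkM hS) hlam
  have hv2 : ∀ j, ∫ x, v j x ^ 2 ∂μ = lam j := fun j => by rw [← norm_inclusion_sq hS, hSv]
  have hv0 : ∀ j, lam j = 0 → v j = 0 := fun j hj => by
    rw [← inner_self_eq_zero (𝕜 := ℝ), hv]
    simp [hj]
  have hinner : ∀ (h : H) (x : X), inner ℝ h (kerVec H x) = h x := fun h x => by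
    rw [real_inner_comm, inner_kerVec]
  -- almost every representer lies in the closed span of the system
  have hmem : ∀ᵐ x ∂μ, kerVec H x ∈ (Submodule.span ℝ (range v)).topologicalClosure := by
    set V := Submodule.span ℝ (range v)
    -- An element of `Vᗮ` is annihilated by `S`, so it vanishes almost everywhere as a function. A
    -- dense sequence in `Vᗮ` provides one null set for all of them; off it, `k_x` is orthogonal to
    -- `Vᗮ`.
    have h1 : ∀ᵐ x ∂μ, ∀ m, (TopologicalSpace.denseSeq Vᗮ m : H) x = 0 := by
      rw [ae_all_iff]
      intro m
      set w : H := (TopologicalSpace.denseSeq Vᗮ m : H)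
      have hw : S w = 0 := hker w fun j =>
        (TopologicalSpace.denseSeq Vᗮ m).2 (v j) (Submodule.subset_span ⟨j, rfl⟩)
      have h2 := hS w
      rw [hw] at h2
      filter_upwards [h2, Lp.coeFn_zero ℝ 2 μ] with x hx1 hx2
      rw [← hx1, hx2]
      rfl
    filter_upwards [h1] with x hx
    rw [← Submodule.orthogonal_orthogonal_eq_closure, Submodule.mem_orthogonal]
    intro w hw
    have h3 : Continuous fun y : Vᗮ => inner ℝ (y : H) (kerVec H x) := by fun_prop
    have h4 := (TopologicalSpace.denseRange_denseSeq Vᗮ).equalizer h3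
      (continuous_const (y := (0 : ℝ))) (by
        funext m
        simp only [Function.comp_apply, hinner, hx m])
    exact congrFun h4 ⟨w, hw⟩
  have hres : ∀ (D : ℕ) (x : X), ‖systemResidual v D (kerVec H x)‖ ≤ M := fun D x =>
    (norm_systemResidual_le hv D _).trans (norm_kerVec_le hM hkM x)
  have hresB : ∀ (D : ℕ) (x : X), ‖systemResidual v D (kerVec H x)‖ ^ 2 ≤ M ^ 2 := fun D x =>
    pow_le_pow_left₀ (norm_nonneg _) (hres D x) 2
  set a : ℕ → ℝ := fun D => ∫ x, ‖systemResidual v D (kerVec H x)‖ ^ 2 ∂μ with ha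
  have ham : ∀ D, StronglyMeasurable fun x : X => ‖systemResidual v D (kerVec H x)‖ ^ 2 :=
    fun D => (stronglyMeasurable_systemResidual_kerVec hk v D).norm.pow 2
  have ha0 : Filter.Tendsto a Filter.atTop (nhds 0) := by
    have h1 : Filter.Tendsto a Filter.atTop (nhds (∫ _x : X, (0 : ℝ) ∂μ)) := by
      refine tendsto_integral_of_dominated_convergence (fun _ => M ^ 2)
        (fun N => (ham N).aestronglyMeasurable) (integrable_const _) (fun N => ?_) ?_
      · refine Filter.Eventually.of_forall fun x => ?_
        rw [Real.norm_eq_abs, abs_of_nonneg (by positivity)]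
        exact hresB N x
      · filter_upwards [hmem] with x hx
        simpa using (tendsto_systemResidual hv hx).norm.pow 2
    simpa using h1
  set t : ℝ := ∫ x, ‖kerVec H x‖ ^ 2 ∂μ with ht
  -- Since `⟨vⱼ, k_x⟩ = vⱼ(x)` has second moment `λⱼ`, integrating Pythagoras for `k_x` gives the
  -- partial sums. The residual term tends to zero, so the eigenvalues sum to the trace `t`.
  have hsum : ∀ D, ∑ j ∈ Finset.range D, lam j = t - a D := by
    intro D
    have h1 : Integrable (fun x : X => ‖kerVec H x‖ ^ 2) μ := by
      refine integrable_of_measurable_of_abs_le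
        ((stronglyMeasurable_kerVec hk).norm.pow 2).measurable (B := M ^ 2) fun x => ?_
      rw [abs_of_nonneg (by positivity)]
      exact pow_le_pow_left₀ (norm_nonneg _) (norm_kerVec_le hM hkM x) 2
    have h2 : ∀ j ∈ Finset.range D, Integrable (fun x : X => v j x ^ 2) μ := fun j _ =>
      (memLp_coe_rkhs μ hk hM hkM (v j)).integrable_sq
    have h3 : a D = t - ∑ j ∈ Finset.range D, lam j := by
      simp only [ha, norm_systemResidual_sq hv, hinner]
      rw [integral_sub h1 (integrable_finsetSum _ h2), integral_finsetSum _ h2]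
      simp only [hv2, ht]
    rw [h3]
    ring
  have hhas : HasSum lam t := by
    rw [hasSum_iff_tendsto_nat_of_nonneg hlam.nonneg]
    simp only [hsum]
    simpa using (tendsto_const_nhds (x := t)).sub ha0
  refine ⟨hhas.summable, v, hv0, hv2, fun h D => ?_, hres, fun D => ?_⟩
  · rw [← norm_inclusion_sq hS]
    exact hbessel h D
  · have h1 := hhas.summable.sum_add_tsum_nat_add D
    rw [hhas.tsum_eq, hsum] at h1
    simp only [add_comm D]
    change a D = _
    linarith

end Eigenfunctions

/-! ### Rademacher averages of subsets of an RKHS -/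

/-- The signed sum of the `w j` is split into its first `D` components, paired with `u i` in the
norm weighted by `lam`, and its residual, paired by Cauchy–Schwarz. The free parameters `t` and `s`
replace square roots by quadratic expressions, whose averages over the signs are exact. -/
theorem rademacherAverage_inner_le {H : Type*} [NormedAddCommGroup H] [InnerProductSpace ℝ H]
    {ι : Type*} [Nonempty ι] {n : ℕ} {u : ι → H} {v : ℕ → H} {lam : ℕ → ℝ} {D : ℕ} {ρ r t s : ℝ}
    (hlam : ∀ k, 0 ≤ lam k) (hv0 : ∀ k, lam k = 0 → v k = 0) (hρ : 0 ≤ ρ) (hu : ∀ i, ‖u i‖ ≤ ρ)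
    (hr : ∀ i, ∑ k ∈ Finset.range D, lam k * inner ℝ (v k) (u i) ^ 2 ≤ r) (ht : 0 < t) (hs : 0 < s)
    (w : Fin n → H) :
    rademacherAverage (fun i j => inner ℝ (w j) (u i)) ≤
      (2 * t)⁻¹ * ∑ k ∈ Finset.range D, (lam k)⁻¹ * ∑ j, inner ℝ (v k) (w j) ^ 2 + t / 2 * r
        + ((2 * s)⁻¹ * ρ * ∑ j, ‖systemResidual v D (w j)‖ ^ 2 + s / 2 * ρ) := by
  have hS : ∀ (ε : Fin n → ℤˣ) (h : H),
      signSum ε (fun j => inner ℝ (w j) h) = inner ℝ (∑ j, ((ε j : ℤ) : ℝ) • w j) h := by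
    intro ε h
    rw [signSum, sum_inner]
    exact Finset.sum_congr rfl fun j _ => (real_inner_smul_left _ _ _).symm
  have hres : ∀ ε : Fin n → ℤˣ, systemResidual v D (∑ j, ((ε j : ℤ) : ℝ) • w j)
      = ∑ j, ((ε j : ℤ) : ℝ) • systemResidual v D (w j) := by
    intro ε
    let L : H →ₗ[ℝ] H :=
      { toFun := systemResidual v D
        map_add' := systemResidual_add D
        map_smul' := systemResidual_smul D }
    change L _ = ∑ j, ((ε j : ℤ) : ℝ) • L (w j)
    simp only [map_sum, map_smul]
  have hpt : ∀ (ε : Fin n → ℤˣ) (i : ι), signSum ε (fun j => inner ℝ (w j) (u i)) ≤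
      ((2 * t)⁻¹ * ∑ k ∈ Finset.range D, (lam k)⁻¹ * signSum ε (fun j => inner ℝ (v k) (w j)) ^ 2
        + t / 2 * r)
        + ((2 * s)⁻¹ * ρ * ‖∑ j, ((ε j : ℤ) : ℝ) • systemResidual v D (w j)‖ ^ 2
          + s / 2 * ρ) := by
    intro ε i
    have h0 : ∀ k, signSum ε (fun j => inner ℝ (v k) (w j))
        = inner ℝ (v k) (∑ j, ((ε j : ℤ) : ℝ) • w j) := by
      intro k
      rw [real_inner_comm, ← hS]
      simp only [real_inner_comm]
    simp only [h0]
    rw [hS, ← hres]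
    set W : H := ∑ j, ((ε j : ℤ) : ℝ) • w j
    clear_value W
    have h1 : inner ℝ W (u i) = ∑ k ∈ Finset.range D, inner ℝ (v k) W * inner ℝ (v k) (u i)
        + inner ℝ (systemResidual v D W) (u i) := by
      rw [systemResidual, inner_sub_left, sum_inner]
      simp only [real_inner_smul_left]
      ring
    rw [h1]
    refine add_le_add ?_ ?_
    · have h2 : ∀ k, inner ℝ (v k) W * inner ℝ (v k) (u i) ≤
          (2 * t)⁻¹ * ((lam k)⁻¹ * inner ℝ (v k) W ^ 2)
            + t / 2 * (lam k * inner ℝ (v k) (u i) ^ 2) := by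
        intro k
        -- For `λ_k = 0` the vector `v k` is zero and `0⁻¹ = 0`, so both sides vanish.
        rcases (hlam k).eq_or_lt with hk | hk
        · rw [hv0 k hk.symm, ← hk]
          simp
        · have h3 : (2 * t)⁻¹ * ((lam k)⁻¹ * inner ℝ (v k) W ^ 2)
              + t / 2 * (lam k * inner ℝ (v k) (u i) ^ 2)
              - inner ℝ (v k) W * inner ℝ (v k) (u i)
              = (2 * t * lam k)⁻¹ * (inner ℝ (v k) W - t * lam k * inner ℝ (v k) (u i)) ^ 2 := by
            field_simp
            ring
          have h4 : 0 ≤ (2 * t * lam k)⁻¹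
              * (inner ℝ (v k) W - t * lam k * inner ℝ (v k) (u i)) ^ 2 := by positivity
          linarith
      refine (Finset.sum_le_sum fun k _ => h2 k).trans ?_
      rw [Finset.sum_add_distrib, ← Finset.mul_sum, ← Finset.mul_sum]
      have := hr i
      gcongr
    · refine (real_inner_le_norm _ _).trans ?_
      have h2 : ‖systemResidual v D W‖ * ‖u i‖ ≤ ‖systemResidual v D W‖ * ρ :=
        mul_le_mul_of_nonneg_left (hu i) (norm_nonneg _)
      refine h2.trans ?_
      have h3 : (2 * s)⁻¹ * ρ * ‖systemResidual v D W‖ ^ 2 + s / 2 * ρ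
          - ‖systemResidual v D W‖ * ρ = (2 * s)⁻¹ * ρ * (‖systemResidual v D W‖ - s) ^ 2 := by
        field_simp
        ring
      have h4 : 0 ≤ (2 * s)⁻¹ * ρ * (‖systemResidual v D W‖ - s) ^ 2 := by positivity
      linarith
  refine (signAverage_mono fun ε => ciSup_le (hpt ε)).trans (le_of_eq ?_)
  simp only [signAverage_add, signAverage_const_mul, signAverage_const, signAverage_sum,
    signAverage_norm_sq, signAverage_signSum_sq]

/-! ### Mean Rademacher averages and the spectrum -/

section KernelSpectrum

theorem integral_sum_comp_fst {X : Type*} [MeasurableSpace X] (P : Measure (X × Label))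
    [IsProbabilityMeasure P] {n : ℕ} {f : X → ℝ} (hf : Measurable f) {B : ℝ}
    (hB : ∀ x, |f x| ≤ B) :
    ∫ z : Fin n → X × Label, (∑ j, f (z j).1) ∂(Measure.pi fun _ : Fin n => P)
      = n * ∫ x, f x ∂P.fst := by
  have h1 : ∀ j : Fin n, MeasurePreserving (fun z : Fin n → X × Label => (z j).1)
      (Measure.pi fun _ : Fin n => P) P.fst := fun j =>
    (measurePreserving_fst_self P).comp (measurePreserving_eval (fun _ : Fin n => P) j)
  rw [integral_finsetSum]
  · have h2 : ∀ j : Fin n, ∫ z : Fin n → X × Label, f (z j).1 ∂(Measure.pi fun _ : Fin n => P)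
        = ∫ x, f x ∂P.fst := fun j => by
      rw [← (h1 j).map_eq, integral_map (h1 j).measurable.aemeasurable
        hf.aestronglyMeasurable]
    simp only [h2, Finset.sum_const, Finset.card_univ, Fintype.card_fin, nsmul_eq_mul]
  · intro j _
    exact integrable_of_measurable_of_abs_le (hf.comp (h1 j).measurable) fun z => hB _

theorem integral_affine_add_affine {Ω : Type*} [MeasurableSpace Ω] {Q : Measure Ω}
    [IsProbabilityMeasure Q] {f g : Ω → ℝ} (hf : Integrable f Q) (hg : Integrable g Q)
    (a b c d : ℝ) :
    ∫ z, (a * f z + b + (c * g z + d)) ∂Q = a * (∫ z, f z ∂Q) + b + (c * (∫ z, g z ∂Q) + d) := by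
  have h1 : Integrable (fun z => a * f z + b) Q := (hf.const_mul a).add (integrable_const b)
  have h2 : Integrable (fun z => c * g z + d) Q := (hg.const_mul c).add (integrable_const d)
  rw [integral_add h1 h2, integral_add (hf.const_mul a) (integrable_const b),
    integral_add (hg.const_mul c) (integrable_const d), integral_const_mul, integral_const_mul]
  simp

variable {X : Type*} [MeasurableSpace X] {H : Type*} [NormedAddCommGroup H]
  [InnerProductSpace ℝ H] [CompleteSpace H] [RKHS ℝ H X ℝ] [TopologicalSpace.SeparableSpace H]

/-- The expected Rademacher average of a bounded subset of an RKHS, all of whose elements have a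
small `L²` norm, in terms of the spectrum of the kernel integral operator. -/
theorem integral_rademacherAverage_rkhs_le (P : Measure (X × Label)) [IsProbabilityMeasure P]
    (hk : ∀ x : X, Measurable (rkhsKernel H x)) {M : ℝ} (hM : 0 < M)
    (hkM : ∀ x : X, rkhsKernel H x x ≤ M ^ 2) {lam : ℕ → ℝ}
    (hlam : IsEigenvalueSequence (kernelIntegralOperator (rkhsKernel H) P.fst) lam)
    {ι : Type*} [Nonempty ι] [Countable ι] {u : ι → H} {ρ r : ℝ} (hρ : 0 ≤ ρ) (hr0 : 0 ≤ r)
    (hu : ∀ i, ‖u i‖ ≤ ρ) (hr : ∀ i, ∫ x, u i x ^ 2 ∂P.fst ≤ r) (n D : ℕ) :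
    ∫ z, rademacherAverage (fun i j => u i (z j).1) ∂(Measure.pi fun _ : Fin n => P)
      ≤ √(n * D * r) + ρ * √(n * ∑' j, lam (D + j)) := by
  obtain ⟨-, v, hv0, hv2, hbessel, hresM, hres⟩ := exists_eigenfunctions P.fst hk hM hkM hlam
  set Q : Measure (Fin n → X × Label) := Measure.pi fun _ : Fin n => P
  set τ : ℝ := ∑' j, lam (D + j) with hτ
  have hτ0 : 0 ≤ τ := tsum_nonneg fun j => hlam.nonneg _
  set A : ℝ := ∫ z, rademacherAverage (fun i j => u i (z j).1) ∂Q with hA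
  have hvm : ∀ k, Measurable fun x : X => v k x ^ 2 := fun k => (measurable_coe_rkhs hk _).pow_const 2
  have hvB : ∀ k (x : X), |v k x ^ 2| ≤ (M * ‖v k‖) ^ 2 := fun k x => by
    rw [abs_pow]
    exact pow_le_pow_left₀ (abs_nonneg _) (abs_apply_le_mul_norm hM hkM _ _) 2
  have hrm : Measurable fun x : X => ‖systemResidual v D (kerVec H x)‖ ^ 2 :=
    ((stronglyMeasurable_systemResidual_kerVec hk v D).norm.pow 2).measurable
  have hrB : ∀ x : X, |‖systemResidual v D (kerVec H x)‖ ^ 2| ≤ M ^ 2 := fun x => by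
    rw [abs_of_nonneg (by positivity)]
    exact pow_le_pow_left₀ (norm_nonneg _) (hresM D x) 2
  have hsumint : ∀ {f : X → ℝ} {B : ℝ}, Measurable f → (∀ x, |f x| ≤ B) →
      Integrable (fun z : Fin n → X × Label => ∑ j, f (z j).1) Q := by
    intro f B hf hB
    refine integrable_finsetSum _ fun j _ => integrable_of_measurable_of_abs_le
      (hf.comp (measurable_fst.comp (measurable_pi_apply j))) fun z => hB _
  have key : ∀ t > 0, ∀ s > 0, A ≤ n * D / 2 / t + t * (r / 2)
      + (ρ * (n * τ) / 2 / s + s * (ρ / 2)) := by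
    intro t ht s hs
    have h1 : ∀ z : Fin n → X × Label, rademacherAverage (fun i j => u i (z j).1) ≤
        (2 * t)⁻¹ * ∑ k ∈ Finset.range D, (lam k)⁻¹ * ∑ j, v k (z j).1 ^ 2 + t / 2 * r
        + ((2 * s)⁻¹ * ρ * ∑ j, ‖systemResidual v D (kerVec H (z j).1)‖ ^ 2 + s / 2 * ρ) := by
      intro z
      have h2 := rademacherAverage_inner_le hlam.nonneg hv0 hρ hu
        (fun i => (hbessel (u i) D).trans (hr i)) ht hs fun j => kerVec H (z j).1
      simpa only [real_inner_comm (kerVec H _) (v _), inner_kerVec] using h2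
    have h3 : Integrable (fun z : Fin n → X × Label =>
        ∑ k ∈ Finset.range D, (lam k)⁻¹ * ∑ j, v k (z j).1 ^ 2) Q :=
      integrable_finsetSum _ fun k _ => (hsumint (hvm k) (hvB k)).const_mul _
    have h4 := hsumint hrm hrB
    have h5 : ∫ z, (∑ k ∈ Finset.range D, (lam k)⁻¹ * ∑ j : Fin n, v k (z j).1 ^ 2) ∂Q
        ≤ n * D := by
      rw [integral_finsetSum _ fun k _ => (hsumint (hvm k) (hvB k)).const_mul _]
      calc _ ≤ ∑ k ∈ Finset.range D, (n : ℝ) := Finset.sum_le_sum fun k _ => by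
            rw [integral_const_mul, integral_sum_comp_fst P (hvm k) (hvB k), hv2]
            -- Each direction with `λ_k ≠ 0` contributes `λ_k⁻¹ · n λ_k = n`, the others nothing;
            -- hence the factor `D`.
            by_cases hk0 : lam k = 0
            · simp [hk0]
            · rw [mul_left_comm, inv_mul_cancel₀ hk0, mul_one]
        _ = n * D := by simp [mul_comm]
    have h6 : ∫ z, (∑ j : Fin n, ‖systemResidual v D (kerVec H (z j).1)‖ ^ 2) ∂Q = n * τ := by
      rw [integral_sum_comp_fst P hrm hrB, hres]
    have h7 := integral_mono (integrable_rademacherAverage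
      (fun i => (measurable_coe_rkhs hk (u i)).comp measurable_fst)
      (B := M * ρ) (fun i z => (abs_apply_le_mul_norm hM hkM (u i) z.1).trans
        (mul_le_mul_of_nonneg_left (hu i) hM.le)) P)
      (((h3.const_mul (2 * t)⁻¹).add (integrable_const (t / 2 * r))).add
        ((h4.const_mul ((2 * s)⁻¹ * ρ)).add (integrable_const (s / 2 * ρ)))) h1
    have h8 : ∫ z, (((2 * t)⁻¹ * ∑ k ∈ Finset.range D, (lam k)⁻¹ * ∑ j : Fin n, v k (z j).1 ^ 2)
        + t / 2 * r
        + ((2 * s)⁻¹ * ρ * ∑ j : Fin n, ‖systemResidual v D (kerVec H (z j).1)‖ ^ 2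
          + s / 2 * ρ)) ∂Q
        = (2 * t)⁻¹ * (∫ z, (∑ k ∈ Finset.range D, (lam k)⁻¹ * ∑ j : Fin n, v k (z j).1 ^ 2) ∂Q)
          + t / 2 * r + ((2 * s)⁻¹ * ρ * (n * τ) + s / 2 * ρ) := by
      rw [integral_affine_add_affine h3 h4, h6]
    have h9 : (2 * t)⁻¹ * (∫ z, (∑ k ∈ Finset.range D, (lam k)⁻¹ * ∑ j : Fin n, v k (z j).1 ^ 2) ∂Q)
        ≤ (2 * t)⁻¹ * (n * D) := mul_le_mul_of_nonneg_left h5 (by positivity)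
    have h10 : n * D / 2 / t + t * (r / 2) + (ρ * (n * τ) / 2 / s + s * (ρ / 2))
        = (2 * t)⁻¹ * (n * D) + t / 2 * r + ((2 * s)⁻¹ * ρ * (n * τ) + s / 2 * ρ) := by
      field_simp
    rw [h10]
    exact (h7.trans h8.le).trans (by gcongr)
  -- Only after integration are the parameters optimized, first `t` for fixed `s`, then `s`.
  have h1 : ∀ s > 0, A - √(n * D * r) ≤ ρ * (n * τ) / 2 / s + s * (ρ / 2) := by
    intro s hs
    have h2 := le_two_mul_sqrt_of_forall_le
      (A := A - (ρ * (n * τ) / 2 / s + s * (ρ / 2))) (p := n * D / 2) (q := r / 2)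
      (by positivity) (by positivity) fun t ht => by linarith [key t ht s hs]
    have h3 : 2 * √((n * D / 2) * (r / 2)) = √(n * D * r) := by
      rw [show (n * D / 2 : ℝ) * (r / 2) = n * D * r / 2 ^ 2 by ring,
        Real.sqrt_div' _ (by positivity), Real.sqrt_sq (by norm_num)]
      ring
    linarith
  have h2 := le_two_mul_sqrt_of_forall_le (by positivity) (by positivity) h1
  have h3 : 2 * √((ρ * (n * τ) / 2) * (ρ / 2)) = ρ * √(n * τ) := by
    rw [show (ρ * (n * τ) / 2 : ℝ) * (ρ / 2) = (ρ / 2) ^ 2 * (n * τ) by ring,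
      Real.sqrt_mul (by positivity), Real.sqrt_sq (by positivity)]
    ring
  linarith

end KernelSpectrum

/-! ### The empirical process over a ball of an RKHS -/

theorem iSup_comp_of_denseRange {I κ : Type*} [TopologicalSpace I] [Nonempty I] [Nonempty κ]
    {e : κ → I} (he : DenseRange e) {f : I → ℝ} (hf : Continuous f) {B : ℝ} (hB : ∀ i, f i ≤ B) :
    ⨆ i, f i = ⨆ m, f (e m) := by
  have h1 : BddAbove (range f) := ⟨B, by rintro _ ⟨i, rfl⟩; exact hB i⟩
  have h2 : BddAbove (range fun m => f (e m)) := ⟨B, by rintro _ ⟨i, rfl⟩; exact hB _⟩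
  refine le_antisymm (ciSup_le fun i => ?_) (ciSup_le fun m => le_ciSup h1 (e m))
  have h3 : IsClosed {i | f i ≤ ⨆ m, f (e m)} := isClosed_le hf continuous_const
  exact he.induction_on (p := fun i => f i ≤ ⨆ m, f (e m)) i h3 fun m => le_ciSup h2 m

section BallProcess

variable {X : Type*} {H : Type*} [NormedAddCommGroup H]
  [InnerProductSpace ℝ H] [CompleteSpace H] [RKHS ℝ H X ℝ]

theorem abs_hingeLoss_rkhs_sub_le {M : ℝ} (hM : 0 < M) (hkM : ∀ x : X, rkhsKernel H x x ≤ M ^ 2)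
    (h h' : H) (z : X × Label) : |hingeLoss h z - hingeLoss h' z| ≤ M * ‖h - h'‖ := by
  refine (abs_hingeLoss_sub_le _ _ z).trans ?_
  have h1 := abs_apply_le_mul_norm hM hkM (h - h') z.1
  rwa [RKHS.coe_sub] at h1

theorem abs_hingeLoss_rkhs_sub_le_of_mem_ball {M R : ℝ} (hM : 0 < M)
    (hkM : ∀ x : X, rkhsKernel H x x ≤ M ^ 2) {h h' : H} (hh : ‖h‖ ≤ R) (hh' : ‖h'‖ ≤ R)
    (z : X × Label) : |hingeLoss h z - hingeLoss h' z| ≤ 2 * (M * R) := by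
  refine (abs_hingeLoss_rkhs_sub_le hM hkM h h' z).trans ?_
  have h1 : ‖h - h'‖ ≤ 2 * R := (norm_sub_le _ _).trans (by linarith)
  calc M * ‖h - h'‖ ≤ M * (2 * R) := mul_le_mul_of_nonneg_left h1 hM.le
    _ = 2 * (M * R) := by ring

variable [MeasurableSpace X]

theorem measurable_hingeLoss_rkhs_sub (hk : ∀ x : X, Measurable (rkhsKernel H x)) (h h' : H) :
    Measurable fun z : X × Label => hingeLoss h z - hingeLoss h' z :=
  (measurable_hingeLoss (measurable_coe_rkhs hk h)).sub
    (measurable_hingeLoss (measurable_coe_rkhs hk h'))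

/-- A change of `h` moves the loss uniformly by at most `M` times its norm, and the process by at
most twice that. Continuity lets a dense sequence replace the whole local class. -/
theorem continuous_empiricalProcess_hingeLoss (P : Measure (X × Label)) [IsProbabilityMeasure P]
    (hk : ∀ x : X, Measurable (rkhsKernel H x)) {M : ℝ} (hM : 0 < M)
    (hkM : ∀ x : X, rkhsKernel H x x ≤ M ^ 2) {n : ℕ} (hn : 0 < n) (h₀ : H)
    (z : Fin n → X × Label) :
    Continuous fun h : H => empiricalProcess P n (fun w => hingeLoss h w - hingeLoss h₀ w) z := by
  refine (LipschitzWith.of_dist_le_mul (K := NNReal.mk (2 * M) (by positivity)) fun h h' => ?_).continuous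
  have hint : ∀ h h' : H, Integrable (fun w => hingeLoss h w - hingeLoss h' w) P := fun h h' =>
    integrable_of_measurable_of_abs_le (measurable_hingeLoss_rkhs_sub hk h h')
      (abs_hingeLoss_rkhs_sub_le hM hkM h h')
  have h1 : empiricalProcess P n (fun w => hingeLoss h w - hingeLoss h₀ w) z
      - empiricalProcess P n (fun w => hingeLoss h' w - hingeLoss h₀ w) z
      = empiricalProcess P n (fun w => hingeLoss h w - hingeLoss h' w) z := by
    have h2 : ∫ w, (hingeLoss h w - hingeLoss h' w) ∂P
        = (∫ w, (hingeLoss h w - hingeLoss h₀ w) ∂P)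
          - ∫ w, (hingeLoss h' w - hingeLoss h₀ w) ∂P := by
      rw [← integral_sub (hint h h₀) (hint h' h₀)]
      exact integral_congr_ae (Filter.Eventually.of_forall fun w => by ring)
    simp only [empiricalProcess]
    rw [h2]
    simp only [Finset.sum_sub_distrib]
    ring
  rw [Real.dist_eq, h1, dist_eq_norm, NNReal.coe_mk, mul_assoc]
  exact abs_empiricalProcess_le P hn (abs_hingeLoss_rkhs_sub_le hM hkM h h') z

/-- It suffices to bound the expected suprema of the empirical process over countable families. -/
theorem localizedSup_hingeLoss_rkhsBall [TopologicalSpace.SeparableSpace H]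
    (P : Measure (X × Label)) [IsProbabilityMeasure P]
    (hk : ∀ x : X, Measurable (rkhsKernel H x)) {M : ℝ} (hM : 0 < M)
    (hkM : ∀ x : X, rkhsKernel H x x ≤ M ^ 2) {n : ℕ} (hn : 0 < n) {R r B : ℝ}
    {d : (X → ℝ) → (X → ℝ) → ℝ} {h₀ : H} (hh₀ : ‖h₀‖ ≤ R) (hd₀ : d h₀ h₀ ^ 2 ≤ r)
    (hB : ∀ u : Option ℕ → H, u none = h₀ → (∀ i, ‖u i‖ ≤ R) → (∀ i, d (u i) h₀ ^ 2 ≤ r) →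
      ∫ z, (⨆ i, empiricalProcess P n (fun w => hingeLoss (u i) w - hingeLoss h₀ w) z)
        ∂(Measure.pi fun _ : Fin n => P) ≤ B) :
    (∀ z, BddAbove (range fun g : {g : X → ℝ // g ∈ rkhsBall H R ∧ d g h₀ ^ 2 ≤ r} =>
        empiricalProcess P n (fun w => hingeLoss (g : X → ℝ) w - hingeLoss h₀ w) z)) ∧
    Integrable (localizedSup P n hingeLoss (rkhsBall H R) d h₀ r)
      (Measure.pi fun _ : Fin n => P) ∧
    ∫ z, localizedSup P n hingeLoss (rkhsBall H R) d h₀ r z ∂(Measure.pi fun _ : Fin n => P)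
      ≤ B := by
  have hbd : ∀ h : H, ‖h‖ ≤ R → ∀ z : Fin n → X × Label,
      |(empiricalProcess P n (fun w => hingeLoss h w - hingeLoss h₀ w) z)| ≤ 2 * (2 * (M * R)) :=
    fun h hh z => abs_empiricalProcess_le P hn
      (abs_hingeLoss_rkhs_sub_le_of_mem_ball hM hkM hh hh₀) z
  set I := {h : H // ‖h‖ ≤ R ∧ d h h₀ ^ 2 ≤ r}
  let i₀ : I := ⟨h₀, hh₀, hd₀⟩
  have : Nonempty I := ⟨i₀⟩
  -- A dense sequence of the local class need not contain its centre; the index `none` adds it, so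
  -- that the family of loss differences contains zero.
  let e : Option ℕ → I := fun m => m.elim i₀ (TopologicalSpace.denseSeq I)
  have he : DenseRange e := by
    refine (TopologicalSpace.denseRange_denseSeq I).mono ?_
    rintro _ ⟨m, rfl⟩
    exact ⟨some m, rfl⟩
  let p : I → {g : X → ℝ // g ∈ rkhsBall H R ∧ d g h₀ ^ 2 ≤ r} :=
    fun i => ⟨i.1, ⟨i.1, i.2.1, rfl⟩, i.2.2⟩
  have hp : Function.Surjective p := by
    rintro ⟨g, ⟨h, hh, rfl⟩, hg⟩
    exact ⟨⟨h, hh, hg⟩, rfl⟩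
  have hsup : localizedSup P n hingeLoss (rkhsBall H R) d h₀ r = fun z => ⨆ m,
      empiricalProcess P n (fun w => hingeLoss (e m : H) w - hingeLoss h₀ w) z := by
    funext z
    rw [localizedSup, ← hp.iSup_comp]
    exact iSup_comp_of_denseRange he (f := fun i : I =>
      empiricalProcess P n (fun w => hingeLoss (i : H) w - hingeLoss h₀ w) z)
      ((continuous_empiricalProcess_hingeLoss P hk hM hkM hn h₀ z).comp continuous_subtype_val)
      fun i => (abs_le.1 (hbd i i.2.1 z)).2
  refine ⟨fun z => ⟨2 * (2 * (M * R)), ?_⟩, ?_, ?_⟩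
  · rintro _ ⟨⟨_, ⟨h, hh, rfl⟩, _⟩, rfl⟩
    exact (abs_le.1 (hbd h hh z)).2
  · rw [hsup]
    exact integrable_of_measurable_of_abs_le (Measurable.iSup fun m =>
      measurable_empiricalProcess P (measurable_hingeLoss_rkhs_sub hk _ _))
      fun z => abs_iSup_le fun m => hbd _ (e m).2.1 z
  · rw [hsup]
    exact hB (fun m => e m) rfl (fun m => (e m).2.1) fun m => (e m).2.2

end BallProcess

/-! ### The hypotheses of the model selection theorem -/

theorem isSubRoot_mul_sqrt {α : ℝ} (hα : 0 ≤ α) : IsSubRoot fun r => α * √r where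
  nonneg _ _ := by positivity
  mono _ _ _ _ h := mul_le_mul_of_nonneg_left (Real.sqrt_le_sqrt h) hα
  anti r hr s hs _ := by
    have h1 : √r ≠ 0 := (Real.sqrt_pos.2 hr).ne'
    have h2 : √s ≠ 0 := (Real.sqrt_pos.2 hs).ne'
    simp only [mul_div_assoc, div_self h1, div_self h2, le_refl]

/-- Dividing by `√r` gives `√r = C α` for each positive solution. For `α = 0` there is none, and the
formula gives the value `0`. -/
theorem isGreatest_mul_sqrt {α C : ℝ} (hα : 0 ≤ α) (hC : 0 < C) :
    IsGreatest {r : ℝ | 0 ≤ r ∧ α * √r = r / C} ((C * α) ^ 2) := by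
  refine ⟨⟨sq_nonneg _, ?_⟩, ?_⟩
  · rw [Real.sqrt_sq (by positivity)]
    field_simp
  · rintro r ⟨hr, h⟩
    rcases hr.eq_or_lt with h0 | h0
    · rw [← h0]
      positivity
    · have h1 : 0 < √r := Real.sqrt_pos.2 h0
      have h2 : √r * √r = r := Real.mul_self_sqrt hr
      have h3 : √r = C * α := by
        rw [eq_div_iff hC.ne'] at h
        have : √r * √r = √r * (C * α) := by rw [h2]; linarith
        exact mul_left_cancel₀ h1.ne' this
      rw [← h3, Real.sq_sqrt hr]

section Assembly

variable {X : Type*} [MeasurableSpace X] {H : Type*} [NormedAddCommGroup H]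
  [InnerProductSpace ℝ H] [CompleteSpace H] [RKHS ℝ H X ℝ]

theorem variance_hingeLoss_sub_le (P : Measure (X × Label)) [IsProbabilityMeasure P]
    {g g' : X → ℝ} (hg : MemLp g 2 P.fst) (hg' : MemLp g' 2 P.fst) :
    variance (fun z => hingeLoss g z - hingeLoss g' z) P
      ≤ l2Dist P (hingeLoss g) (hingeLoss g') ^ 2 := by
  rw [l2Dist_sq (memLp_hingeLoss hg) (memLp_hingeLoss hg')]
  exact variance_le_expectation_sq ((memLp_hingeLoss hg).sub (memLp_hingeLoss hg')).1

theorem l2Dist_hingeLoss_sq_le (P : Measure (X × Label)) [IsProbabilityMeasure P]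
    {g g' : X → ℝ} (hg : MemLp g 2 P.fst) (hg' : MemLp g' 2 P.fst) :
    l2Dist P (hingeLoss g) (hingeLoss g') ^ 2 ≤ l2Dist P.fst g g' ^ 2 := by
  rw [l2Dist_sq (memLp_hingeLoss hg) (memLp_hingeLoss hg'), l2Dist_sq hg hg']
  have h1 := (hg.sub hg').integrable_sq
  have h2 := measurePreserving_fst_self P
  have h3 : ∫ x, (g x - g' x) ^ 2 ∂P.fst = ∫ z, (g z.1 - g' z.1) ^ 2 ∂P := by
    rw [← h2.map_eq] at h1 ⊢
    exact integral_map h2.measurable.aemeasurable h1.1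
  rw [h3]
  refine integral_mono ((memLp_hingeLoss hg).sub (memLp_hingeLoss hg')).integrable_sq
    (h2.integrable_comp_of_integrable h1) fun z => ?_
  exact sq_le_sq.2 (abs_hingeLoss_sub_le g g' z)

/-- The balls of an RKHS satisfy the hypotheses of the model selection theorem with functions
`φ(r) = α √r`, if the expected suprema over countable families are bounded by `α √r`. -/
theorem modelSelectionHypotheses_rkhsBall [TopologicalSpace.SeparableSpace H]
    (P : Measure (X × Label)) [IsProbabilityMeasure P] {η : X → ℝ}
    (hη : IsRegressionFunction P η)
    (hk : ∀ x : X, Measurable (rkhsKernel H x)) {M : ℝ} (hM : 0 < M)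
    (hkM : ∀ x : X, rkhsKernel H x x ≤ M ^ 2) {n : ℕ} (hn : 0 < n) {radii : Set ℝ}
    (hradii : ∀ R ∈ radii, 0 < R) {d : (X → ℝ) → (X → ℝ) → ℝ}
    (hd : IsPseudoDistanceOn d (squareIntegrable P.fst)) {C α : radii → ℝ}
    (hC : ∀ R, 0 < C R) (hα : ∀ R, 0 ≤ α R)
    (hvar : ∀ g ∈ squareIntegrable P.fst, ∀ g' ∈ squareIntegrable P.fst,
      l2Dist P (hingeLoss g) (hingeLoss g') ^ 2 ≤ d g g' ^ 2)
    (hmargin : ∀ (R : radii) (g : X → ℝ), MemLp g 2 P.fst → (∀ x, |g x| ≤ M * R) →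
      d g (bayesClassifier η) ^ 2
        ≤ C R * ∫ z, (hingeLoss g z - hingeLoss (bayesClassifier η) z) ∂P)
    (hemp : ∀ (R : radii) (r : ℝ), (C R * α R) ^ 2 ≤ r → ∀ u : Option ℕ → H,
      (∀ i, ‖u i‖ ≤ R) → (∀ i, d (u i) (u none) ^ 2 ≤ r) →
      ∫ z, (⨆ i, empiricalProcess P n (fun w => hingeLoss (u i) w - hingeLoss (u none) w) z)
        ∂(Measure.pi fun _ : Fin n => P) ≤ α R * √r) :
    ModelSelectionHypotheses P n (squareIntegrable P.fst) hingeLoss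
      (fun R : radii => rkhsBall H (R : ℝ)) (bayesClassifier η) d (fun R r => α R * √r)
      (fun R : radii => 1 + M * R) C (fun R => (C R * α R) ^ 2) where
  loss_memLp _ hg := memLp_hingeLoss hg
  gstar_mem := bayesClassifier_memLp hη.measurable
  gstar_min _ hg := integral_hingeLoss_bayesClassifier_le hη hg
  model_subset R := by
    rintro _ ⟨h, -, rfl⟩
    exact memLp_coe_rkhs P.fst hk hM hkM h
  pseudoDistance := hd
  subRoot R := isSubRoot_mul_sqrt (hα R)
  b_pos R := by
    have := mul_pos hM (hradii R R.2)
    linarith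
  C_pos := hC
  rstar_spec R := isGreatest_mul_sqrt (hα R) (hC R)
  H1 R := by
    rintro _ ⟨h, hh, rfl⟩ z
    rw [abs_of_nonneg (hingeLoss_nonneg _ _)]
    have h1 := (abs_apply_le_mul_norm hM hkM h z.1).trans (mul_le_mul_of_nonneg_left hh hM.le)
    linarith [hingeLoss_le h z]
  H2 g hg g' hg' := (variance_hingeLoss_sub_le P hg hg').trans (hvar g hg g' hg')
  H3 R := by
    rintro _ ⟨h, hh, rfl⟩
    exact hmargin R h (memLp_coe_rkhs P.fst hk hM hkM h) fun x =>
      (abs_apply_le_mul_norm hM hkM h x).trans (mul_le_mul_of_nonneg_left hh hM.le)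
  H4 R := by
    rintro _ ⟨h₀, hh₀, rfl⟩ r hr
    have h1 : d h₀ h₀ ^ 2 ≤ r := by
      rw [hd.self _ (memLp_coe_rkhs P.fst hk hM hkM h₀), zero_pow two_ne_zero]
      exact (sq_nonneg _).trans hr
    obtain ⟨h2, h3, h4⟩ := localizedSup_hingeLoss_rkhsBall P hk hM hkM hn hh₀ h1
      (B := α R * √r) (by
        rintro u rfl hu hur
        exact hemp R r hr u hu hur)
    exact ⟨Filter.Eventually.of_forall h2, h3, h4⟩

end Assembly

/-! ### Bounds on the expected suprema -/

section Bounds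

variable {X : Type*} [MeasurableSpace X] {H : Type*} [NormedAddCommGroup H]
  [InnerProductSpace ℝ H] [CompleteSpace H] [RKHS ℝ H X ℝ]

/-- The spectral bound on the expected supremum of the empirical process. -/
theorem integral_iSup_empiricalProcess_le_spectrum [TopologicalSpace.SeparableSpace H]
    (P : Measure (X × Label)) [IsProbabilityMeasure P]
    (hk : ∀ x : X, Measurable (rkhsKernel H x)) {M : ℝ} (hM : 0 < M)
    (hkM : ∀ x : X, rkhsKernel H x x ≤ M ^ 2) {lam : ℕ → ℝ}
    (hlam : IsEigenvalueSequence (kernelIntegralOperator (rkhsKernel H) P.fst) lam)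
    {n : ℕ} (hn : 0 < n) (D : ℕ) {ι : Type*} [Nonempty ι] [Countable ι] {u : ι → H} {h₀ : H}
    {R r : ℝ} (hR : 0 ≤ R) (hr0 : 0 ≤ r) (hu : ∀ i, ‖u i‖ ≤ R) (hh₀ : ‖h₀‖ ≤ R)
    (hr : ∀ i, l2Dist P.fst (u i) h₀ ^ 2 ≤ r) :
    ∫ z, (⨆ i, empiricalProcess P n (fun w => hingeLoss (u i) w - hingeLoss h₀ w) z)
        ∂(Measure.pi fun _ : Fin n => P)
      ≤ 2 / n * (√(n * D * r) + 2 * R * √(n * ∑' j, lam (D + j))) := by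
  have hF := fun i => abs_hingeLoss_rkhs_sub_le_of_mem_ball hM hkM (hu i) hh₀
  have hu' : ∀ i, ‖u i - h₀‖ ≤ 2 * R := fun i =>
    (norm_sub_le _ _).trans (by linarith [hu i])
  have hmeas := fun i => measurable_hingeLoss_rkhs_sub hk (u i) h₀
  have hsub : ∀ i (x : X), |(u i - h₀ : H) x| ≤ 2 * (M * R) := fun i x => by
    refine (abs_apply_le_mul_norm hM hkM _ x).trans ?_
    have := mul_le_mul_of_nonneg_left (hu' i) hM.le
    linarith
  refine (integral_iSup_empiricalProcess_le P hn hmeas hF).trans ?_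
  refine mul_le_mul_of_nonneg_left ?_ (by positivity)
  refine le_trans ?_ (integral_rademacherAverage_rkhs_le P hk hM hkM hlam
    (u := fun i => u i - h₀) (ρ := 2 * R) (by positivity) hr0 hu' (fun i => ?_) n D)
  · refine integral_mono (integrable_rademacherAverage hmeas hF P)
      (integrable_rademacherAverage (fun i => (measurable_coe_rkhs hk (u i - h₀)).comp
        measurable_fst) (fun i z => hsub i z.1) P) fun z => ?_
    refine rademacherAverage_le_of_increments (fun i j => hF i (z j))
      (fun i j => hsub i (z j).1) fun i k j => ?_
    have h1 : ((u i - h₀ : H) (z j).1) - ((u k - h₀ : H) (z j).1)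
        = u i (z j).1 - u k (z j).1 := by
      simp only [RKHS.coe_sub, Pi.sub_apply]
      ring
    rw [h1, sub_sub_sub_cancel_right]
    exact abs_hingeLoss_sub_le _ _ _
  · have h1 := hr i
    rw [l2Dist_sq (memLp_coe_rkhs P.fst hk hM hkM _) (memLp_coe_rkhs P.fst hk hM hkM _)] at h1
    simpa only [RKHS.coe_sub, Pi.sub_apply] using h1

/-- The entropy bound on the expected supremum of the empirical process. -/
theorem integral_iSup_empiricalProcess_le_supEntropy [TopologicalSpace X]
    (P : Measure (X × Label)) [IsProbabilityMeasure P]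
    (hk : ∀ x : X, Measurable (rkhsKernel H x)) {M : ℝ} (hM : 0 < M)
    (hkM : ∀ x : X, rkhsKernel H x x ≤ M ^ 2) (hH : HasCompactInclusion H)
    (hint : ∀ x : ℝ, 0 < x → IntervalIntegrable (fun ε => √(supEntropy H ε)) volume 0 x)
    {n : ℕ} (hn : 0 < n) {x₀ : ℝ}
    (hx₀ : IsGreatest {x : ℝ | 0 ≤ x ∧ entropyIntegral H x = M⁻¹ * √n * x ^ 2} x₀)
    {ι : Type*} [Nonempty ι] [Countable ι] {u : ι → H} {i₀ : ι} {R r : ℝ} (hR : 0 < R)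
    (hr0 : 0 ≤ r) (hu : ∀ i, ‖u i‖ ≤ R)
    (hr : ∀ i, l2Dist P (hingeLoss (u i)) (hingeLoss (u i₀)) ^ 2 ≤ r)
    (hrx : 50 * R * x₀ ≤ √r) :
    ∫ z, (⨆ i, empiricalProcess P n (fun w => hingeLoss (u i) w - hingeLoss (u i₀) w) z)
        ∂(Measure.pi fun _ : Fin n => P) ≤ 50 * (x₀ / M) * √r := by
  classical
  have hnR : (0 : ℝ) < n := by exact_mod_cast hn
  have hmem := fun h : H => memLp_hingeLoss (memLp_coe_rkhs P.fst hk hM hkM h)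
  refine integral_iSup_empiricalProcess_le_of_entropy P hn
    (fun i => measurable_hingeLoss_rkhs_sub hk (u i) (u i₀)) hM hR
    (fun i => abs_hingeLoss_rkhs_sub_le_of_mem_ball hM hkM (hu i) (hu i₀))
    ⟨i₀, fun z => sub_self _⟩ (fun i => ?_) hr0 (supEntropy_antitoneOn hH) (fun ε hε => ?_)
    hint hx₀.1.1 (fun x hx hxx => integral_le_of_isGreatest (q := fun ε => √(supEntropy H ε))
      (fun a ha b hb hab => Real.sqrt_le_sqrt (supEntropy_antitoneOn hH ha hb hab)) hint
      (by positivity) hx₀ hx hxx) hrx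
  · rw [← l2Dist_sq (hmem _) (hmem _)]
    exact hr i
  · obtain ⟨C, hC, hne, hcov⟩ := exists_cover_card_eq hH (div_pos hε hR)
    -- A cover of the unit ball at scale `ε / R` is dilated by `R` and composed with the 1-Lipschitz
    -- loss. The centres enter only through their values at the sample, so the topology and the
    -- σ-algebra need not be compatible.
    refine ⟨C.image fun (c : X →ᵇ ℝ) z => hingeLoss (fun x => R * c x) z - hingeLoss (u i₀) z,
      ?_, fun i => ?_⟩
    · rw [← hC]
      refine Real.log_le_log ?_ (by exact_mod_cast Finset.card_image_le)
      exact_mod_cast (hne.image _).card_pos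
    · obtain ⟨c, hc, hcx⟩ := hcov (R⁻¹ • u i) (by
        rw [norm_smul, norm_inv, Real.norm_of_nonneg hR.le, inv_mul_le_iff₀ hR, mul_one]
        exact hu i)
      refine ⟨_, Finset.mem_image_of_mem _ hc, fun z => ?_⟩
      rw [sub_sub_sub_cancel_right]
      refine (abs_hingeLoss_sub_le _ _ z).trans ?_
      have h1 := hcx z.1
      rw [RKHS.coe_smul, Pi.smul_apply, smul_eq_mul] at h1
      have h2 : u i z.1 - R * c z.1 = R * (R⁻¹ * u i z.1 - c z.1) := by
        field_simp
      rw [h2, abs_mul, abs_of_pos hR]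
      calc _ ≤ R * (ε / R) := mul_le_mul_of_nonneg_left h1 hR.le
        _ = ε := by field_simp

end Bounds

/-! ### Fixed points -/

/-- Each summand takes one half of `α √r`. The first does so by the part `16 D / n` of `α²`, with no
slack; the second is free of `r` and needs `√r ≥ C α`, which turns `α √r` into at least `C α²`. -/
theorem two_div_mul_add_le_mul_sqrt {n D M R η₁ τ C α r : ℝ} (hn : 0 < n) (hD : 0 ≤ D)
    (hM : 0 < M) (hR : 0 < R) (hη₁ : 0 < η₁) (hC : 2 * (M * R / η₁) ≤ C) (hα : 0 ≤ α)
    (hα2 : α ^ 2 = 16 / √n * (D / √n + η₁ / M * √τ)) (hr : (C * α) ^ 2 ≤ r) :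
    2 / n * (√(n * D * r) + 2 * R * √(n * τ)) ≤ α * √r := by
  have hsn : 0 < √n := Real.sqrt_pos.2 hn
  have hsn2 : √n * √n = n := Real.mul_self_sqrt hn.le
  have hC0 : 0 ≤ C := le_trans (by positivity) hC
  have hrs : C * α ≤ √r := Real.le_sqrt_of_sq_le hr
  have h1 : 2 / n * √(n * D * r) ≤ α / 2 * √r := by
    have h2 : √(n * D * r) = √(n * D) * √r := Real.sqrt_mul (by positivity) _
    rw [h2, ← mul_assoc]
    refine mul_le_mul_of_nonneg_right ?_ (Real.sqrt_nonneg _)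
    refine abs_le_of_sq_le_sq' ?_ (by positivity) |>.2
    have h3 : (2 / n * √(n * D)) ^ 2 = 4 * D / n := by
      rw [mul_pow, Real.sq_sqrt (by positivity)]
      field_simp
      ring
    have h4 : (α / 2) ^ 2 = 4 * D / n + 4 / √n * (η₁ / M * √τ) := by
      rw [div_pow, hα2, mul_add, ← mul_div_assoc, div_mul_eq_mul_div, div_div, hsn2]
      ring
    have h5 : 0 ≤ 4 / √n * (η₁ / M * √τ) := by positivity
    linarith
  have h4 : 2 / n * (2 * R * √(n * τ)) ≤ α / 2 * √r := by
    have h5 : α / 2 * (C * α) ≤ α / 2 * √r := mul_le_mul_of_nonneg_left hrs (by positivity)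
    have h6 : α ^ 2 / 2 * (2 * (M * R / η₁)) ≤ α ^ 2 / 2 * C :=
      mul_le_mul_of_nonneg_left hC (by positivity)
    have h7 : 2 / n * (2 * R * √(n * τ)) = 4 * R * √τ / √n := by
      rw [Real.sqrt_mul hn.le, ← hsn2, Real.sqrt_mul_self hsn.le]
      field_simp
      ring
    have h8 : α ^ 2 / 2 * (2 * (M * R / η₁)) = 16 * (M * R / η₁) * D / n + 16 * R * √τ / √n := by
      rw [hα2, ← hsn2, Real.sqrt_mul_self hsn.le]
      field_simp
    have h9 : 0 ≤ 16 * (M * R / η₁) * D / n := by positivity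
    have h10 : 4 * R * √τ / √n ≤ 16 * R * √τ / √n := by gcongr; norm_num
    rw [h7]
    linarith
  linarith

/-- As `D / √n` tends to infinity, the infimum over the dimension is attained. One `D` then yields
the stated bound exactly, for all radii at once. -/
theorem exists_forall_div_sqrt_add_le {n : ℝ} (hn : 0 < n) {b : ℕ → ℝ} (hb : ∀ D, 0 ≤ b D) :
    ∃ D₀ : ℕ, ∀ D : ℕ, (D₀ : ℝ) / √n + b D₀ ≤ D / √n + b D := by
  refine Filter.Tendsto.exists_forall_le (f := fun D : ℕ => (D : ℝ) / √n + b D) ?_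
  rw [Nat.cofinite_eq_atTop]
  refine Filter.Tendsto.atTop_add_nonneg ?_ hb
  exact tendsto_natCast_atTop_atTop.atTop_div_const (Real.sqrt_pos.2 hn)

end

/-! ### The theorem -/

theorem theorem4p4
    {X : Type*} [MeasurableSpace X] [TopologicalSpace X]
    {H : Type*} [NormedAddCommGroup H] [InnerProductSpace ℝ H] [CompleteSpace H] [RKHS ℝ H X ℝ]
    (hk : ∀ x : X, Measurable (rkhsKernel H x))
    (P : Measure (X × Label)) [IsProbabilityMeasure P]
    (η : X → ℝ) (hη : IsRegressionFunction P η)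
    (M η₀ : ℝ) (hM : 0 < M) (hη₀ : 0 < η₀)
    (hA1_separable : TopologicalSpace.SeparableSpace H)
    (hA1_bounded : ∀ x : X, rkhsKernel H x x ≤ M ^ 2)
    (hA2 : ∀ x : X, η₀ ≤ |η x - 1 / 2|)
    (n : ℕ) (hn : 0 < n)
    (radii : Set ℝ) (hradii : radii.Countable) (hradii_pos : ∀ R ∈ radii, 0 < R) :
    -- first setting: label noise bounded below, spectrum of the kernel integral operator
    (∀ η₁ : ℝ, 0 < η₁ → (∀ x : X, η₁ ≤ min (η x) (1 - η x)) →
      ∀ lam : ℕ → ℝ,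
        IsEigenvalueSequence (kernelIntegralOperator (rkhsKernel H) P.fst) lam →
        Summable lam ∧
        ∃ (d : (X → ℝ) → (X → ℝ) → ℝ) (φ : radii → ℝ → ℝ) (rstar : radii → ℝ),
          ModelSelectionHypotheses P n (squareIntegrable P.fst) hingeLoss
            (fun R : radii => rkhsBall H (R : ℝ)) (bayesClassifier η) d φ
            (fun R : radii => 1 + M * R)
            (fun R : radii => 2 * (M * R / η₁ + 1 / η₀))
            rstar ∧
          ∀ R : radii, rstar R ≤
            16 * (2 * (M * R / η₁ + 1 / η₀)) ^ 2 / √n *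
              ⨅ D : ℕ, ((D : ℝ) / √n + η₁ / M * √(∑' j : ℕ, lam (D + j)))) ∧
    -- second setting: entropy of the unit ball in the supremum norm
    (HasCompactInclusion H →
      (∀ x : ℝ, 0 < x → IntervalIntegrable (fun ε => √(supEntropy H ε)) volume 0 x) →
      ∀ xstar : ℝ,
        IsGreatest {x : ℝ | 0 ≤ x ∧ entropyIntegral H x = M⁻¹ * √n * x ^ 2} xstar →
        ∃ (d : (X → ℝ) → (X → ℝ) → ℝ) (φ : radii → ℝ → ℝ) (rstar : radii → ℝ),
          ModelSelectionHypotheses P n (squareIntegrable P.fst) hingeLoss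
            (fun R : radii => rkhsBall H (R : ℝ)) (bayesClassifier η) d φ
            (fun R : radii => 1 + M * R)
            (fun R : radii => M * R + 1 / η₀)
            rstar ∧
          ∀ R : radii, rstar R ≤
            2500 * (M ^ 2)⁻¹ * (M * R + 1 / η₀) ^ 2 * xstar ^ 2) := by
  have := hA1_separable
  have hnR : (0 : ℝ) < n := by exact_mod_cast hn
  have hMR : ∀ R : radii, 0 < M * (R : ℝ) := fun R => mul_pos hM (hradii_pos R R.2)
  refine ⟨fun η₁ hη₁ hA3 lam hlam => ?_, fun hH hint xstar hxstar => ?_⟩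
  · obtain ⟨hsum, -⟩ := exists_eigenfunctions P.fst hk hM hA1_bounded hlam
    obtain ⟨D, hD⟩ := exists_forall_div_sqrt_add_le hnR
      (b := fun D => η₁ / M * √(∑' j : ℕ, lam (D + j))) fun D => by positivity
    set τ : ℝ := ∑' j : ℕ, lam (D + j)
    set a : ℝ := 16 / √n * ((D : ℝ) / √n + η₁ / M * √τ) with ha
    have ha0 : 0 ≤ a := by positivity
    have hC : ∀ R : radii, 0 < 2 * (M * (R : ℝ) / η₁ + 1 / η₀) := fun R => by
      have := hMR R
      positivity
    -- The pseudo-distance is that of the predictions themselves; `α = √a` makes `r*` equal to `C_R²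
    -- a`.
    refine ⟨hsum, l2Dist P.fst, _, _, modelSelectionHypotheses_rkhsBall P hη hk hM hA1_bounded hn
      hradii_pos (isPseudoDistanceOn_l2Dist (ℓ := fun g => g) fun g hg => hg)
      (α := fun _ => √a) hC (fun R => Real.sqrt_nonneg _)
      (fun g hg g' hg' => l2Dist_hingeLoss_sq_le P hg hg')
      (fun R g hg hB => l2Dist_bayesClassifier_sq_le hη hη₀ hη₁ hA2 hA3 hg hB)
      fun R r hr u hu hur => ?_, fun R => ?_⟩
    · refine (integral_iSup_empiricalProcess_le_spectrum P hk hM hA1_bounded hlam hn D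
        (hradii_pos R R.2).le ((sq_nonneg _).trans hr) hu (hu none) hur).trans ?_
      refine two_div_mul_add_le_mul_sqrt hnR (Nat.cast_nonneg D) hM (hradii_pos R R.2) hη₁
        ?_ (Real.sqrt_nonneg _) (Real.sq_sqrt ha0) hr
      have : 0 < 1 / η₀ := by positivity
      linarith
    · have h1 : (2 * (M * (R : ℝ) / η₁ + 1 / η₀) * √a) ^ 2
          = 16 * (2 * (M * R / η₁ + 1 / η₀)) ^ 2 / √n * ((D : ℝ) / √n + η₁ / M * √τ) := by
        rw [mul_pow, Real.sq_sqrt ha0, ha]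
        ring
      rw [h1]
      exact mul_le_mul_of_nonneg_left (le_ciInf hD) (by positivity)
  · have hC : ∀ R : radii, 0 < M * (R : ℝ) + 1 / η₀ := fun R => by
      have := hMR R
      positivity
    have hx0 : 0 ≤ xstar := hxstar.1.1
    refine ⟨fun g g' => l2Dist P (hingeLoss g) (hingeLoss g'), _, _,
      modelSelectionHypotheses_rkhsBall P hη hk hM hA1_bounded hn hradii_pos
        (isPseudoDistanceOn_l2Dist fun g hg => memLp_hingeLoss hg)
        (α := fun _ => 50 * (xstar / M)) hC (fun R => by positivity)
        (fun g hg g' hg' => le_rfl)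
        (fun R g hg hB => l2Dist_hingeLoss_bayesClassifier_sq_le hη hη₀ hA2 hg hB)
        fun R r hr u hu hur => ?_, fun R => le_of_eq ?_⟩
    · refine integral_iSup_empiricalProcess_le_supEntropy P hk hM hA1_bounded hH hint hn hxstar
        (hradii_pos R R.2) ((sq_nonneg _).trans hr) hu hur ?_
      refine le_trans ?_ (Real.le_sqrt_of_sq_le hr)
      -- The lower bound on `√r` needed for the entropy estimate is `C_R α ≥ M R · 50 x_* / M`.
      have h1 : 50 * (R : ℝ) * xstar = M * R * (50 * (xstar / M)) := by field_simp
      rw [h1]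
      have h2 : 0 < 1 / η₀ := by positivity
      exact mul_le_mul_of_nonneg_right (by linarith) (by positivity)
    · ring
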